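/- Let $n\ge 1$, $\alpha>0$ and $\max\{\alpha,\tfrac12\}<\beta<1$ with $\alpha+\beta-1\ge 0$. If $1\le q\le\infty$, $2<p<\infty$ and $$\alpha+\beta<1+\frac np<2\beta ,$$ then both homogeneous Besov spaces $$\dot B^{1+\frac np-2\beta}_{p,q}(\mathbb R^n)\qquad\text{and}\qquad \dot B^{1+\frac n2-2\beta}_{2,q}(\mathbb R^n)$$ are continuously embedded in $Q^{\beta,-1}_{\alpha;\infty}(\mathbb R^n)$. Here $Q^{\beta,-1}_{\alpha;\infty}(\mathbb R^n)$ is the space of tempered distributions $f$ with $$\|f\|_{Q^{\beta,-1}_{\alpha;\infty}}=\sup_{x\in\mathbb R^n,\ r>0}\Big(r^{2\alpha-n+2\beta-2}\int_0^{r^{2\beta}}\int_{|y-x|<r}|K_t^\beta*f(y)|^2\,t^{-\alpha/\beta}\,dy\,dt\Big)^{1/2}<\infty ,\qquad \widehat{K_t^\beta}(\xi)=e^{-t|\xi|^{2\beta}} .$$ Membership in this space includes that the convolutions exist: $K_t^\beta*f(y)=\langle f,K_t^\beta(y-\cdot)\rangle=\lim_k\langle f,\eta_kK_t^\beta(y-\cdot)\rangle$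 for all $t>0$ and $y\in\mathbb R^n$, with the same limit for every sequence $\eta_k\in C_0^\infty(\mathbb R^n)$ whose derivatives of each order are bounded uniformly in $k$ and such that, on each ball, $\eta_k=1$ for all large $k$. The Fourier transform is $\widehat g(\xi)=\int g(x)e^{-2\pi i x\cdot\xi}\,dx$. The space $\dot B^s_{p,q}(\mathbb R^n)$ consists of all $f\in\mathscr S_0'$, the dual of the space $\mathscr S_0$ of Schwartz functions all of whose moments vanish, with $\|f\|_{\dot B^s_{p,q}}=\big(\sum_{j\in\mathbb Z}(2^{js}\|\Psi_j*f\|_{L^p})^q\big)^{1/q}<\infty$ (a supremum over $j$ if $q=\infty$). Here $\widehat{\Psi_j}=\phi_j/\sum_{k\in\mathbb Z}\phi_k$ (read as $0$ at the origin) and $\phi_j(\xi)=\phi_0(2^{-j}\xi)$, where $\phi_0$ is any fixed real Schwartz function that is positive for $\frac12<|\xi|<2$ and zero elsewhere. Since elements of $\mathscr S_0'$ are tempered distributions modulo polynomials, the embedding $\dot B^s_{p,q}\hookrightarrow Q^{\beta,-1}_{\alpha;\infty}$ means that there are a linear map $J:\dot B^s_{p,q}\to Q^{\beta,-1}_{\alpha;\infty}$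 and a constant $C<\infty$ such that, for all $f\in\dot B^s_{p,q}$, $Jf$ restricted to $\mathscr S_0$ equals $f$ and $\|Jf\|_{Q^{\beta,-1}_{\alpha;\infty}}\le C\|f\|_{\dot B^s_{p,q}}$. -/

import Mathlib

open MeasureTheory Filter Topology Set
open scoped ENNReal NNReal SchwartzMap FourierTransform ContDiff

noncomputable section

namespace QBesov

/-- The Euclidean space `ℝⁿ`. -/
abbrev Rn (n : ℕ) : Type := EuclideanSpace ℝ (Fin n)

/-! ### The test function space `𝓢₀` and its dual -/

/-- The monomial `x ↦ x ^ γ = x₁ ^ γ₁ ⋯ xₙ ^ γₙ`. -/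
def monomial {n : ℕ} (γ : Fin n → ℕ) (x : Rn n) : ℂ := ∏ i, (x i : ℂ) ^ γ i

/-- Schwartz functions whose Fourier transform vanishes near the origin. -/
def FourierZeroNearOrigin {n : ℕ} (φ : 𝓢(Rn n, ℂ)) : Prop :=
  ∀ᶠ ξ in 𝓝 (0 : Rn n), 𝓕 φ ξ = 0

/-- Multiplication by `g` makes sense on `𝓢` and keeps the Fourier transform zero near `0`. -/
def GoodMultiplier {n : ℕ} (g : Rn n → ℂ) : Prop :=
  g.HasTemperateGrowth ∧ ∀ φ : 𝓢(Rn n, ℂ), FourierZeroNearOrigin φ →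
    FourierZeroNearOrigin (SchwartzMap.smulLeftCLM ℂ g φ)

theorem goodMultiplier_one {n : ℕ} : GoodMultiplier (1 : Rn n → ℂ) := by
  refine ⟨Function.HasTemperateGrowth.const 1, fun φ hφ => ?_⟩
  have : SchwartzMap.smulLeftCLM ℂ (1 : Rn n → ℂ) φ = φ := by
    ext x
    rw [SchwartzMap.smulLeftCLM_apply_apply (g := (1 : Rn n → ℂ))
      (Function.HasTemperateGrowth.const 1)]
    simp
  rwa [this]

theorem GoodMultiplier.mul {n : ℕ} {g h : Rn n → ℂ} (hg : GoodMultiplier g)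
    (hh : GoodMultiplier h) : GoodMultiplier (g * h) := by
  refine ⟨hg.1.mul hh.1, fun φ hφ => ?_⟩
  rw [← SchwartzMap.smulLeftCLM_smulLeftCLM_apply hg.1 hh.1]
  exact hg.2 _ (hh.2 _ hφ)

theorem goodMultiplier_coord {n : ℕ} (i : Fin n) :
    GoodMultiplier (fun x : Rn n => (x i : ℂ)) := by
  have ht : (fun x : Rn n => inner ℝ x (EuclideanSpace.single i (1 : ℝ))).HasTemperateGrowth :=
    Function.hasTemperateGrowth_inner_left _
  have e : (fun x : Rn n => (x i : ℂ))
      = fun x => ((inner ℝ x (EuclideanSpace.single i (1 : ℝ)) : ℝ) : ℂ) := by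
    funext x
    simp [EuclideanSpace.inner_single_right]
  have hg : (fun x : Rn n => (x i : ℂ)).HasTemperateGrowth := by
    rw [e]
    exact Function.HasTemperateGrowth.comp (Complex.ofRealCLM.hasTemperateGrowth) ht
  refine ⟨hg, fun φ hφ => ?_⟩
  have key := SchwartzMap.lineDerivOp_fourier_eq φ (EuclideanSpace.single i (1 : ℝ))
  have h2 : SchwartzMap.smulLeftCLM ℂ (fun x : Rn n => (x i : ℂ)) φ
      = SchwartzMap.smulLeftCLM ℂ (inner ℝ · (EuclideanSpace.single i (1 : ℝ))) φ := by
    rw [e]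
    exact SchwartzMap.smulLeftCLM_ofReal ℂ ht φ
  rw [h2]
  have hz : ∀ᶠ ξ in 𝓝 (0 : Rn n),
      (LineDeriv.lineDerivOp (EuclideanSpace.single i (1 : ℝ)) (𝓕 φ) : 𝓢(Rn n, ℂ)) ξ = 0 := by
    have := (eventually_eventually_nhds.2 hφ)
    filter_upwards [this] with ξ hξ
    rw [SchwartzMap.lineDerivOp_apply_eq_fderiv]
    have h0 : (𝓕 φ : 𝓢(Rn n, ℂ)) =ᶠ[𝓝 ξ] fun _ => (0 : ℂ) := hξ
    rw [h0.fderiv_eq]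
    simp
  rw [key] at hz
  filter_upwards [hz] with ξ hξ
  have hc : (-(2 * Real.pi * Complex.I) : ℂ) ≠ 0 := by
    simp [Real.pi_ne_zero]
  rw [FourierTransform.fourier_smul] at hξ
  simpa [hc] using hξ

theorem goodMultiplier_monomial {n : ℕ} (γ : Fin n → ℕ) :
    GoodMultiplier (monomial (n := n) γ) := by
  have e : monomial (n := n) γ = ∏ i, (fun x : Rn n => (x i : ℂ)) ^ γ i := by
    funext x
    simp [monomial, Finset.prod_apply]
  rw [e]
  refine Finset.prod_induction _ GoodMultiplier (fun _ _ => GoodMultiplier.mul)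
    goodMultiplier_one (fun i _ => ?_)
  induction γ i with
  | zero => simpa using goodMultiplier_one
  | succ k ih => rw [pow_succ]; exact ih.mul (goodMultiplier_coord i)

theorem integrable_monomial_mul {n : ℕ} (γ : Fin n → ℕ) (φ : 𝓢(Rn n, ℂ)) :
    Integrable (fun x => monomial γ x * φ x) := by
  have := (SchwartzMap.smulLeftCLM ℂ (monomial (n := n) γ) φ).integrable (μ := volume)
  rwa [SchwartzMap.smulLeftCLM_apply (goodMultiplier_monomial γ).1] at this

/-- `𝓢₀`: the Schwartz functions all of whose moments vanish. -/
def S0 (n : ℕ) : Submodule ℂ 𝓢(Rn n, ℂ) where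
  carrier := {φ | ∀ γ : Fin n → ℕ, ∫ x, monomial γ x * φ x = 0}
  zero_mem' := fun γ => by simp
  add_mem' := fun {φ ψ} hφ hψ γ => by
    have : ∀ x, monomial γ x * (φ + ψ) x = monomial γ x * φ x + monomial γ x * ψ x :=
      fun x => by simp [mul_add]
    simp only [this]
    rw [integral_add (integrable_monomial_mul γ φ) (integrable_monomial_mul γ ψ), hφ γ, hψ γ,
      add_zero]
  smul_mem' := fun c φ hφ γ => by
    have : ∀ x, monomial γ x * (c • φ) x = c * (monomial γ x * φ x) :=
      fun x => by simp; ring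
    simp only [this]
    rw [integral_const_mul, hφ γ, mul_zero]

theorem mem_S0_of_fourierZero {n : ℕ} {φ : 𝓢(Rn n, ℂ)} (hφ : FourierZeroNearOrigin φ) :
    φ ∈ S0 n := by
  intro γ
  have h := ((goodMultiplier_monomial γ).2 φ hφ).self_of_nhds
  rw [SchwartzMap.fourier_coe, Real.fourier_eq] at h
  simpa [SchwartzMap.smulLeftCLM_apply_apply (goodMultiplier_monomial γ).1] using h

/-- `𝓢₀'`, the topological dual of `𝓢₀` (tempered distributions modulo polynomials). -/
abbrev S0Dual (n : ℕ) : Type := S0 n →L[ℂ] ℂ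

/-! ### The Littlewood-Paley decomposition -/

/-- An admissible choice of `φ₀` together with the functions `Ψⱼ` that it determines:
`φ₀` is a Schwartz function supported in the annulus `1/2 ≤ |ξ| ≤ 2` and positive inside, and
the Fourier transform of `Ψⱼ` is `φⱼ / ∑ₖ φₖ`, where `φⱼ(ξ) = φ₀(2⁻ʲ ξ)`
(at `ξ = 0` numerator and denominator vanish, and the quotient is read as `0`). -/
structure LittlewoodPaley (n : ℕ) where
  phi : 𝓢(Rn n, ℝ)
  phi_pos : ∀ ξ, 1 / 2 < ‖ξ‖ → ‖ξ‖ < 2 → 0 < phi ξ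
  phi_eq_zero : ∀ ξ, ‖ξ‖ ≤ 1 / 2 ∨ 2 ≤ ‖ξ‖ → phi ξ = 0
  Psi : ℤ → 𝓢(Rn n, ℂ)
  fourier_Psi : ∀ (j : ℤ) (ξ : Rn n), 𝓕 (Psi j) ξ
    = ((phi (((2 : ℝ) ^ (-j)) • ξ) / ∑' k : ℤ, phi (((2 : ℝ) ^ (-k)) • ξ) : ℝ) : ℂ)

/-- For `ψ ∈ 𝓢` and `x ∈ ℝⁿ`, the Schwartz function `y ↦ ψ (x - y)`. -/
def reflect {n : ℕ} (ψ : 𝓢(Rn n, ℂ)) (x : Rn n) : 𝓢(Rn n, ℂ) :=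
  SchwartzMap.compCLMOfAntilipschitz (g := fun y => x - y) (K := 1) ℂ (by fun_prop)
    (fun y z => by simp [edist_dist, dist_eq_norm, norm_sub_rev]) ψ

@[simp] theorem reflect_apply {n : ℕ} (ψ : 𝓢(Rn n, ℂ)) (x y : Rn n) :
    reflect ψ x y = ψ (x - y) := rfl

theorem reflect_fourierZero {n : ℕ} {ψ : 𝓢(Rn n, ℂ)} (hψ : FourierZeroNearOrigin ψ) (x : Rn n) :
    FourierZeroNearOrigin (reflect ψ x) := by
  have hneg : Tendsto (fun ξ : Rn n => -ξ) (𝓝 0) (𝓝 0) := by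
    simpa using (continuous_neg (G := Rn n)).tendsto 0
  filter_upwards [hneg.eventually hψ] with ξ hξ
  rw [SchwartzMap.fourier_coe, Real.fourier_eq'] at hξ ⊢
  rw [← integral_sub_left_eq_self _ volume x]
  have : ∀ y : Rn n, Complex.exp (↑(-2 * Real.pi * inner ℝ (x - y) ξ) * Complex.I)
        • (reflect ψ x) (x - y)
      = Complex.exp (↑(-2 * Real.pi * inner ℝ x ξ) * Complex.I) *
        (Complex.exp (↑(-2 * Real.pi * inner ℝ y (-ξ)) * Complex.I) • ψ y) := by
    intro y
    rw [reflect_apply, sub_sub_cancel, smul_eq_mul, smul_eq_mul, ← mul_assoc, ← Complex.exp_add]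
    congr 2
    rw [inner_sub_left, inner_neg_right]
    push_cast
    ring
  simp only [this]
  rw [integral_const_mul, hξ, mul_zero]

theorem LittlewoodPaley.reflect_mem_S0 {n : ℕ} (L : LittlewoodPaley n) (j : ℤ) (x : Rn n) :
    reflect (L.Psi j) x ∈ S0 n := by
  refine mem_S0_of_fourierZero (reflect_fourierZero ?_ x)
  have h2 : (0 : ℝ) < (2 : ℝ) ^ (-j) := by positivity
  have hc : Tendsto (fun ξ : Rn n => ‖((2 : ℝ) ^ (-j)) • ξ‖) (𝓝 0) (𝓝 0) := by
    have : Continuous (fun ξ : Rn n => ‖((2 : ℝ) ^ (-j)) • ξ‖) := by fun_prop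
    simpa using this.tendsto 0
  filter_upwards [hc.eventually (ge_mem_nhds (by norm_num : (0 : ℝ) < 1 / 2))] with ξ hξ
  rw [L.fourier_Psi, L.phi_eq_zero _ (Or.inl hξ)]
  simp

/-- The Littlewood-Paley block `Δⱼ f = Ψⱼ * f`, that is `(Ψⱼ * f)(x) = ⟨f, Ψⱼ(x - ·)⟩`. -/
def LittlewoodPaley.block {n : ℕ} (L : LittlewoodPaley n) (j : ℤ) (f : S0Dual n) (x : Rn n) : ℂ :=
  f ⟨reflect (L.Psi j) x, L.reflect_mem_S0 j x⟩

/-! ### Homogeneous Besov spaces -/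

/-- The number `2 ^ (j s) ‖Δⱼ f‖_{Lᵖ}`. -/
def besovTerm {n : ℕ} (L : LittlewoodPaley n) (s : ℝ) (p : ℝ≥0∞) (f : S0Dual n) (j : ℤ) : ℝ≥0∞ :=
  ENNReal.ofReal ((2 : ℝ) ^ ((j : ℝ) * s)) * eLpNorm (L.block j f) p volume

/-- The homogeneous Besov norm of `f ∈ 𝓢₀'`, possibly infinite. -/
def besovNorm {n : ℕ} (L : LittlewoodPaley n) (s : ℝ) (p q : ℝ≥0∞) (f : S0Dual n) : ℝ≥0∞ :=
  if q = ⊤ then ⨆ j : ℤ, besovTerm L s p f j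
  else (∑' j : ℤ, besovTerm L s p f j ^ q.toReal) ^ (1 / q.toReal)

theorem besovTerm_add_le {n : ℕ} (L : LittlewoodPaley n) (s : ℝ) (p : ℝ≥0∞) {f g : S0Dual n}
    (hf : ∀ j, MemLp (L.block j f) p volume) (hg : ∀ j, MemLp (L.block j g) p volume) (j : ℤ) :
    besovTerm L s p (f + g) j ≤ ENNReal.LpAddConst p * (besovTerm L s p f j + besovTerm L s p g j) := by
  have e : L.block j (f + g) = L.block j f + L.block j g := by
    funext x; simp [LittlewoodPaley.block]
  unfold besovTerm
  rw [e, ← mul_add, mul_left_comm]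
  gcongr
  exact eLpNorm_add_le' (hf j).1 (hg j).1 p

theorem besovTerm_smul {n : ℕ} (L : LittlewoodPaley n) (s : ℝ) (p : ℝ≥0∞) (c : ℂ) (f : S0Dual n)
    (j : ℤ) : besovTerm L s p (c • f) j = ‖c‖ₑ * besovTerm L s p f j := by
  have e : L.block j (c • f) = c • L.block j f := by
    funext x; simp [LittlewoodPaley.block]
  unfold besovTerm
  rw [e, eLpNorm_const_smul, mul_left_comm]

theorem besovNorm_lt_top_of_le {n : ℕ} (L : LittlewoodPaley n) (s : ℝ) (p q : ℝ≥0∞)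
    {f g h : S0Dual n} {C : ℝ≥0∞} (hC : C ≠ ⊤) (hf : besovNorm L s p q f < ⊤)
    (hg : besovNorm L s p q g < ⊤)
    (hle : ∀ j, besovTerm L s p h j ≤ C * (besovTerm L s p f j + besovTerm L s p g j)) :
    besovNorm L s p q h < ⊤ := by
  by_cases hq : q = ⊤
  · simp only [besovNorm, hq, if_true] at hf hg ⊢
    refine lt_of_le_of_lt (b := C * ((⨆ j, besovTerm L s p f j) + ⨆ j, besovTerm L s p g j)) ?_
      (ENNReal.mul_lt_top hC.lt_top (ENNReal.add_lt_top.2 ⟨hf, hg⟩))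
    refine iSup_le fun j => (hle j).trans ?_
    gcongr
    · exact le_iSup (besovTerm L s p f) j
    · exact le_iSup (besovTerm L s p g) j
  · simp only [besovNorm, hq, if_false] at hf hg ⊢
    rcases (ENNReal.toReal_nonneg (a := q)).eq_or_lt with h0 | hpos
    · simp [← h0]
    · have hinv : 0 < 1 / q.toReal := by positivity
      rw [ENNReal.rpow_lt_top_iff_of_pos hinv] at hf hg ⊢
      refine lt_of_le_of_lt (b := (C * 2) ^ q.toReal *
        ((∑' j, besovTerm L s p f j ^ q.toReal) + ∑' j, besovTerm L s p g j ^ q.toReal)) ?_ ?_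
      · rw [← ENNReal.tsum_add, ← ENNReal.tsum_mul_left]
        refine ENNReal.tsum_le_tsum fun j => ?_
        set a := besovTerm L s p f j
        set b := besovTerm L s p g j
        have h1 : besovTerm L s p h j ≤ (C * 2) * max a b := by
          refine (hle j).trans ?_
          rw [mul_assoc, two_mul]
          gcongr
          · exact le_max_left _ _
          · exact le_max_right _ _
        calc besovTerm L s p h j ^ q.toReal ≤ ((C * 2) * max a b) ^ q.toReal := by gcongr
          _ = (C * 2) ^ q.toReal * (max a b) ^ q.toReal :=
              ENNReal.mul_rpow_of_nonneg _ _ hpos.le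
          _ ≤ _ := by
              gcongr
              rcases le_total a b with h | h
              · rw [max_eq_right h]; exact le_add_self
              · rw [max_eq_left h]; exact le_self_add
      · exact ENNReal.mul_lt_top
          (ENNReal.rpow_lt_top_of_nonneg hpos.le (ENNReal.mul_ne_top hC (by simp)))
          (ENNReal.add_lt_top.2 ⟨hf, hg⟩)

/-- The homogeneous Besov space `Ḃˢ_{p,q}`: all `f ∈ 𝓢₀'` with blocks `Δⱼ f ∈ Lᵖ` and finite
Besov norm. -/
def Besov {n : ℕ} (L : LittlewoodPaley n) (s : ℝ) (p q : ℝ≥0∞) : Submodule ℂ (S0Dual n) where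
  carrier := {f | (∀ j, MemLp (L.block j f) p volume) ∧ besovNorm L s p q f < ⊤}
  zero_mem' := by
    have e : ∀ j, L.block j (0 : S0Dual n) = 0 := fun j => by
      funext x; simp [LittlewoodPaley.block]
    refine ⟨fun j => by rw [e]; exact MemLp.zero, ?_⟩
    have h0 : ∀ j, besovTerm L s p (0 : S0Dual n) j = 0 := fun j => by
      simp [besovTerm, e]
    unfold besovNorm
    split_ifs with hq
    · simp [h0]
    · rcases (ENNReal.toReal_nonneg (a := q)).eq_or_lt with h | h
      · simp [← h]
      · simp [h0, ENNReal.zero_rpow_of_pos h, ENNReal.zero_rpow_of_pos (inv_pos.2 h)]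
  add_mem' := fun {f g} hf hg => by
    refine ⟨fun j => ?_, besovNorm_lt_top_of_le L s p q (ENNReal.LpAddConst_lt_top p).ne hf.2 hg.2
      (besovTerm_add_le L s p hf.1 hg.1)⟩
    have e : L.block j (f + g) = L.block j f + L.block j g := by
      funext x; simp [LittlewoodPaley.block]
    rw [e]
    exact (hf.1 j).add (hg.1 j)
  smul_mem' := fun c f hf => by
    refine ⟨fun j => ?_, besovNorm_lt_top_of_le L s p q (C := ‖c‖ₑ) (by simp) hf.2 hf.2
      fun j => ?_⟩
    · have e : L.block j (c • f) = c • L.block j f := by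
        funext x; simp [LittlewoodPaley.block]
      rw [e]
      exact (hf.1 j).const_smul c
    · rw [besovTerm_smul]
      gcongr
      exact le_self_add

/-! ### The semigroup `e^{-t(-Δ)^β}` on tempered distributions -/

/-- The kernel `K_t^β`, whose Fourier transform is `exp (-t |ξ| ^ (2 β))`. -/
def fracKernel (n : ℕ) (β t : ℝ) : Rn n → ℂ :=
  𝓕⁻ (fun ξ : Rn n => (Real.exp (-t * ‖ξ‖ ^ (2 * β)) : ℂ))

/-- A unit sequence: smooth compactly supported functions, with derivatives of each order
uniformly bounded, that are eventually equal to `1` on every ball. -/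
structure IsUnitSequence {n : ℕ} (η : ℕ → Rn n → ℂ) : Prop where
  smooth : ∀ k, ContDiff ℝ ∞ (η k)
  compact : ∀ k, HasCompactSupport (η k)
  bounded : ∀ m : ℕ, ∃ C : ℝ, ∀ k x, ‖iteratedFDeriv ℝ m (η k) x‖ ≤ C
  eventually_one : ∀ R : ℝ, ∀ᶠ k in atTop, ∀ x, ‖x‖ ≤ R → η k x = 1

/-- The pairing `⟨f, ψ⟩` of a tempered distribution with a smooth function `ψ`, not necessarily
a Schwartz function, exists and has the value `z`: it is the limit of `⟨f, ηₖ ψ⟩` for every unit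
sequence `ηₖ`. -/
def HasPairing {n : ℕ} (f : 𝓢'(Rn n, ℂ)) (ψ : Rn n → ℂ) (z : ℂ) : Prop :=
  ∃ hψ : ContDiff ℝ ∞ ψ, ∀ (η : ℕ → Rn n → ℂ) (hη : IsUnitSequence η),
    Tendsto (fun k => f (HasCompactSupport.toSchwartzMap
      ((hη.compact k).mul_right (f' := ψ)) ((hη.smooth k).mul hψ))) atTop (𝓝 z)

/-- `u (t, x) = (K_t^β * f)(x) = ⟨f, K_t^β(x - ·)⟩` for all `t > 0` and `x`. -/
def IsSemigroupOf {n : ℕ} (β : ℝ) (f : 𝓢'(Rn n, ℂ)) (u : ℝ → Rn n → ℂ) : Prop :=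
  ∀ t : ℝ, 0 < t → ∀ x : Rn n, HasPairing f (fun y => fracKernel n β t (x - y)) (u t x)

/-! ### The space `Q^{β,-1}_{α;∞}` -/

/-- The quantity
`sup_{x, r} (r^{2α-n+2β-2} ∫_0^{r^{2β}} ∫_{|y-x|<r} |u(t,y)|² t^{-α/β} dy dt)^{1/2}`. -/
def carlesonNorm {n : ℕ} (α β : ℝ) (u : ℝ → Rn n → ℂ) : ℝ≥0∞ :=
  ⨆ (x : Rn n) (r : ℝ) (_ : 0 < r),
    (ENNReal.ofReal (r ^ (2 * α - n + 2 * β - 2)) *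
      ∫⁻ t in Ioo (0 : ℝ) (r ^ (2 * β)), ∫⁻ y in Metric.ball x r,
        ‖u t y‖ₑ ^ 2 * ENNReal.ofReal (t ^ (-α / β))) ^ (1 / 2 : ℝ)

/-- The norm of a tempered distribution `f` in `Q^{β,-1}_{α;∞}`: the quantity above for
`u (t, x) = (K_t^β * f)(x)`, and `∞` if these convolutions do not exist. (The function `u` is
determined by `f` at all `t > 0`, so the infimum runs over equal values.) -/
def qNorm {n : ℕ} (α β : ℝ) (f : 𝓢'(Rn n, ℂ)) : ℝ≥0∞ :=
  ⨅ (u : ℝ → Rn n → ℂ) (_ : IsSemigroupOf β f u), carlesonNorm α β u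

/-- The space `Q^{β,-1}_{α;∞}` of tempered distributions. -/
def QSpace (n : ℕ) (α β : ℝ) : Set 𝓢'(Rn n, ℂ) := {f | qNorm α β f < ⊤}

/-- `Ḃˢ_{p,q}` is continuously embedded in `Q^{β,-1}_{α;∞}`. Elements of the Besov space are
functionals on `𝓢₀`, that is tempered distributions modulo polynomials; the embedding is a bounded
linear map which sends each of them to a tempered distribution that represents it
(in particular it is injective). -/
def BesovEmbedsInQ {n : ℕ} (L : LittlewoodPaley n) (s : ℝ) (p q : ℝ≥0∞) (α β : ℝ) : Prop :=
  ∃ J : Besov L s p q →ₗ[ℂ] 𝓢'(Rn n, ℂ),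
    (∀ (f : Besov L s p q) (φ : S0 n), J f (φ : 𝓢(Rn n, ℂ)) = (f : S0Dual n) φ) ∧
    (∀ f : Besov L s p q, J f ∈ QSpace n α β) ∧
    ∃ C : ℝ≥0, ∀ f : Besov L s p q, qNorm α β (J f) ≤ C * besovNorm L s p q (f : S0Dual n)

end QBesov

end

open MeasureTheory Filter Topology Set
open scoped ENNReal NNReal SchwartzMap FourierTransform ContDiff

noncomputable section

namespace QBesov

/-! ### Schwartz functions: correlation, dilation, summability -/

variable {n : ℕ}

/-! Put `σ = 2β - 1 - n/p`, the negative of the smoothness of the first Besov space. The hypotheses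
give `0 < σ < 1`, and membership with third index `∞` says exactly that `‖Δⱼ f‖_p ≤ M 2^(jσ)`
(`BlockBound`). Everything follows from this bound.

Realization. Let `q` be conjugate to `p`. Hölder gives `|∫ Δⱼf φ| ≤ M 2^(jσ) ‖φ‖_q`, which is
summable as `j → -∞`. Since `Δⱼ f` has frequencies of size `2^j`, a factor `2^(-j)` can be traded
for a gradient on `φ` (`exists_norm_integral_block_le`), giving `2^(j(σ-1))`, summable as `j → ∞`.
So `φ ↦ ∑ⱼ ∫ Δⱼf φ` is defined on all of `𝓢` and bounded by the first-order `L^q` Sobolev norm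
(`BlockBound.exists_clm`). It extends `f` by the Littlewood-Paley formula in `𝓢₀`
(`hasSum_apply_corr_Psi`). The fractional heat kernel need not be a Schwartz function, but it lies
in this Sobolev space, so the convolution exists in the required sense (`BlockBound.hasPairing`).

Smoothing. A block interacts only with the neighbouring dyadic pieces of the kernel, whose `L¹`
norms are `O((1 + t 2^(2βj))⁻¹)`. By Young's inequality and summation over `j`, `‖K_t * f‖_p ≤ C M
t^(-σ/(2β))` (`exists_eLpNorm_heatExt_le`).

Carleson condition. Hölder on a ball passes from `L²` to `Lᵖ`, leaving the time integral of
`t^(-(σ+α)/β)`. It converges because `α + σ < β`, that is `α + β < 1 + n/p`, and the powers of `r`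
cancel exactly (`exists_carlesonNorm_le`).

A finite third index is covered by `ℓ^q ⊂ ℓ^∞`. The space of exponent `2` embeds into the one of
exponent `p` by Bernstein's inequality (`exists_besovTerm_le`). -/

theorem fourier_reflect (ψ : 𝓢(Rn n, ℂ)) (x ξ : Rn n) :
    𝓕 (reflect ψ x) ξ
      = Complex.exp (↑(-2 * Real.pi * inner ℝ x ξ) * Complex.I) * 𝓕 ψ (-ξ) := by
  rw [SchwartzMap.fourier_coe, SchwartzMap.fourier_coe, Real.fourier_eq', Real.fourier_eq',
    ← integral_sub_left_eq_self _ volume x, ← integral_const_mul]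
  congr 1
  funext y
  rw [reflect_apply, sub_sub_cancel, smul_eq_mul, smul_eq_mul, ← mul_assoc, ← Complex.exp_add]
  congr 2
  rw [inner_sub_left, inner_neg_right]
  push_cast
  ring

/-- The correlation `y ↦ ∫ φ(x) ψ(x - y) dx` of two Schwartz functions. -/
def corr (ψ : 𝓢(Rn n, ℂ)) : 𝓢(Rn n, ℂ) →L[ℂ] 𝓢(Rn n, ℂ) :=
  SchwartzMap.convolution (ContinuousLinearMap.mul ℂ ℂ) (reflect ψ 0)

theorem corr_apply (ψ φ : 𝓢(Rn n, ℂ)) (y : Rn n) :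
    corr ψ φ y = ∫ x, φ x * ψ (x - y) := by
  rw [corr, SchwartzMap.convolution_apply, convolution_def,
    ← integral_sub_left_eq_self _ volume y]
  congr 1
  funext x
  simp [mul_comm]

theorem fourier_corr (ψ φ : 𝓢(Rn n, ℂ)) (ξ : Rn n) :
    𝓕 (corr ψ φ) ξ = 𝓕 ψ (-ξ) * 𝓕 φ ξ := by
  rw [corr, SchwartzMap.fourier_convolution, SchwartzMap.pairing_apply_apply, fourier_reflect]
  simp

theorem schwartz_ext_fourier {f g : 𝓢(Rn n, ℂ)} (h : ∀ ξ, 𝓕 f ξ = 𝓕 g ξ) : f = g := by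
  have h' : 𝓕 f = 𝓕 g := SchwartzMap.ext h
  have hf : 𝓕⁻ (𝓕 f) = f := FourierTransform.fourierInv_fourier_eq f
  have hg : 𝓕⁻ (𝓕 g) = g := FourierTransform.fourierInv_fourier_eq g
  rw [← hf, h', hg]

/-- This lets a functional on `𝓢₀` be applied to frequency-localized versions of arbitrary Schwartz
functions, which is what makes the realization possible. -/
theorem corr_mem_S0 {ψ : 𝓢(Rn n, ℂ)} (hψ : FourierZeroNearOrigin ψ) (φ : 𝓢(Rn n, ℂ)) :
    corr ψ φ ∈ S0 n := by
  refine mem_S0_of_fourierZero ?_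
  have hneg : Tendsto (fun ξ : Rn n => -ξ) (𝓝 0) (𝓝 0) := by
    simpa using (continuous_neg (G := Rn n)).tendsto 0
  filter_upwards [hneg.eventually hψ] with ξ hξ
  rw [fourier_corr, hξ, zero_mul]

/-- The invertible linear map `x ↦ 2 ^ j x`. -/
def dilEquiv (n : ℕ) (j : ℤ) : Rn n ≃L[ℝ] Rn n :=
  ContinuousLinearEquiv.smulLeft (Units.mk0 ((2 : ℝ) ^ j) (by positivity))

/-- The dilation `g ↦ g (2 ^ j ·)`. -/
def dil (j : ℤ) : 𝓢(Rn n, ℂ) →L[ℂ] 𝓢(Rn n, ℂ) :=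
  SchwartzMap.compCLMOfContinuousLinearEquiv ℂ (dilEquiv n j)

@[simp] theorem dil_apply (j : ℤ) (g : 𝓢(Rn n, ℂ)) (x : Rn n) :
    dil j g x = g ((2 : ℝ) ^ j • x) := rfl

/-- The `L¹`-normalised dilation `g ↦ 2 ^ (j n) g (2 ^ j ·)`. -/
def ldil (j : ℤ) (g : 𝓢(Rn n, ℂ)) : 𝓢(Rn n, ℂ) := (((2 : ℝ) ^ j) ^ n : ℂ) • dil j g

theorem ldil_apply (j : ℤ) (g : 𝓢(Rn n, ℂ)) (x : Rn n) :
    ldil j g x = (((2 : ℝ) ^ j) ^ n : ℂ) * g ((2 : ℝ) ^ j • x) := by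
  simp [ldil]

theorem fourier_ldil (j : ℤ) (g : 𝓢(Rn n, ℂ)) (ξ : Rn n) :
    𝓕 (ldil j g) ξ = 𝓕 g ((2 : ℝ) ^ (-j) • ξ) := by
  have h2 : (0 : ℝ) < 2 ^ j := by positivity
  rw [SchwartzMap.fourier_coe, SchwartzMap.fourier_coe, Real.fourier_eq', Real.fourier_eq']
  have key := Measure.integral_comp_smul (μ := (volume : Measure (Rn n)))
    (fun v => Complex.exp (↑(-2 * Real.pi * inner ℝ v ((2 : ℝ) ^ (-j) • ξ)) * Complex.I) • g v)
    ((2 : ℝ) ^ j)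
  have e : ∀ v : Rn n, Complex.exp (↑(-2 * Real.pi * inner ℝ v ξ) * Complex.I) • ldil j g v
      = (((2 : ℝ) ^ j) ^ n : ℂ) * (Complex.exp (↑(-2 * Real.pi *
        inner ℝ ((2 : ℝ) ^ j • v) ((2 : ℝ) ^ (-j) • ξ)) * Complex.I) • g ((2 : ℝ) ^ j • v)) := by
    intro v
    rw [ldil_apply, real_inner_smul_left, real_inner_smul_right, ← mul_assoc ((2 : ℝ) ^ j),
      ← zpow_add₀ (two_ne_zero), add_neg_cancel, zpow_zero, one_mul, smul_eq_mul, smul_eq_mul]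
    ring
  simp only [e]
  rw [integral_const_mul, key, finrank_euclideanSpace_fin, abs_of_pos (by positivity)]
  rw [Complex.real_smul, ← mul_assoc]
  have : (((2 : ℝ) ^ j) ^ n : ℂ) * ((((2 : ℝ) ^ j) ^ n)⁻¹ : ℝ) = 1 := by
    push_cast
    exact mul_inv_cancel₀ (pow_ne_zero _ (zpow_ne_zero _ two_ne_zero))
  rw [this, one_mul]

/-- Summable seminorms allow termwise differentiation, so the pointwise sum determines all
derivatives. The error of a partial sum is then at most the tail of the seminorms. -/
theorem hasSum_of_summable_seminorm {ι : Type*} {f : ι → 𝓢(Rn n, ℂ)} {g : 𝓢(Rn n, ℂ)}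
    (hs : ∀ k l, Summable fun i => SchwartzMap.seminorm ℂ k l (f i))
    (hp : ∀ x, HasSum (fun i => f i x) (g x)) : HasSum f g := by
  have hg : (g : Rn n → ℂ) = fun x => ∑' i, f i x := by
    funext x; exact (hp x).tsum_eq.symm
  have hd : ∀ l x, HasSum (fun i => iteratedFDeriv ℝ l (f i) x) (iteratedFDeriv ℝ l g x) := by
    intro l x
    rw [hg, iteratedFDeriv_tsum_apply (N := ⊤) (v := fun l i => SchwartzMap.seminorm ℂ 0 l (f i))
      (fun i => (f i).smooth ⊤) (fun k _ => hs 0 k)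
      (fun k i x _ => SchwartzMap.norm_iteratedFDeriv_le_seminorm ℂ _ _ _) le_top]
    refine Summable.hasSum (Summable.of_norm_bounded (hs 0 l) fun i => ?_)
    exact SchwartzMap.norm_iteratedFDeriv_le_seminorm ℂ _ _ _
  have key : ∀ k l (s : Finset ι), SchwartzMap.seminorm ℂ k l ((∑ i ∈ s, f i) - g)
      ≤ ∑' i : {i // i ∉ s}, SchwartzMap.seminorm ℂ k l (f i) := by
    intro k l s
    refine SchwartzMap.seminorm_le_bound ℂ k l _ (tsum_nonneg fun i => by positivity) fun x => ?_
    have h1 : iteratedFDeriv ℝ l (((∑ i ∈ s, f i) - g : 𝓢(Rn n, ℂ)) : Rn n → ℂ) x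
        = -∑' i : {i // i ∉ s}, iteratedFDeriv ℝ l (f i) x := by
      have h2 : (((∑ i ∈ s, f i) - g : 𝓢(Rn n, ℂ)) : Rn n → ℂ)
          = (fun y => ∑ i ∈ s, f i y) - g := by
        funext y; simp
      rw [h2, iteratedFDeriv_sub_apply, iteratedFDeriv_fun_sum_apply, ← (hd l x).tsum_eq,
        ← (hd l x).summable.sum_add_tsum_compl (s := s)]
      · simp; rfl
      · exact fun i _ => ((f i).smooth l).contDiffAt
      · exact (ContDiff.sum fun i _ => (f i).smooth l).contDiffAt
      · exact (g.smooth l).contDiffAt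
    rw [h1, norm_neg]
    calc ‖x‖ ^ k * ‖∑' i : {i // i ∉ s}, iteratedFDeriv ℝ l (f i) x‖
        ≤ ‖x‖ ^ k * ∑' i : {i // i ∉ s}, ‖iteratedFDeriv ℝ l (f i) x‖ := by
          gcongr
          refine norm_tsum_le_tsum_norm ?_
          refine ((hs 0 l).subtype _).of_nonneg_of_le (fun _ => norm_nonneg _) fun i => ?_
          exact SchwartzMap.norm_iteratedFDeriv_le_seminorm ℂ _ _ _
      _ = ∑' i : {i // i ∉ s}, ‖x‖ ^ k * ‖iteratedFDeriv ℝ l (f i) x‖ := tsum_mul_left.symm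
      _ ≤ _ := by
          refine Summable.tsum_le_tsum (fun i => SchwartzMap.le_seminorm ℂ _ _ _ _) ?_
            ((hs k l).subtype _)
          refine ((hs k l).subtype _).of_nonneg_of_le (fun _ => by positivity) fun i => ?_
          exact SchwartzMap.le_seminorm ℂ _ _ _ _
  unfold HasSum
  rw [(schwartz_withSeminorms ℂ (Rn n) ℂ).tendsto_nhds]
  rintro ⟨k, l⟩ ε hε
  have := tendsto_tsum_compl_atTop_zero (fun i => SchwartzMap.seminorm ℂ k l (f i))
  filter_upwards [this.eventually (gt_mem_nhds hε)] with s hs'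
  exact (key k l s).trans_lt hs'

end QBesov

namespace QBesov

/-! ### Functionals on `𝓢₀` commute with superpositions of translates -/

variable {n : ℕ}

/-- The bound forces `f` to vanish on the kernel of `j`, so `f` descends to a bounded functional on
the range of `j`, and Hahn-Banach applies. -/
theorem exists_extension_of_norm_le {V E : Type*} [AddCommGroup V] [Module ℂ V]
    [NormedAddCommGroup E] [NormedSpace ℂ E] (f : V →ₗ[ℂ] ℂ) (j : V →ₗ[ℂ] E) (C : ℝ)
    (h : ∀ v, ‖f v‖ ≤ C * ‖j v‖) : ∃ F : E →L[ℂ] ℂ, ∀ v, F (j v) = f v := by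
  have hker : LinearMap.ker j ≤ LinearMap.ker f := by
    intro v hv
    have h1 : j v = 0 := hv
    have := h v
    rw [h1, norm_zero, mul_zero] at this
    simpa using this
  let g0 : LinearMap.range j →ₗ[ℂ] ℂ :=
    ((LinearMap.ker j).liftQ f hker) ∘ₗ (j.quotKerEquivRange.symm : _ →ₗ[ℂ] _)
  have hg0 : ∀ v, g0 ⟨j v, LinearMap.mem_range_self j v⟩ = f v := by
    intro v
    simp only [g0, LinearMap.comp_apply, LinearEquiv.coe_coe]
    rw [LinearMap.quotKerEquivRange_symm_apply_image]
    simp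
  let g1 : LinearMap.range j →L[ℂ] ℂ := g0.mkContinuous C (by
    rintro ⟨_, v, rfl⟩
    rw [hg0]
    exact h v)
  obtain ⟨F, hF, -⟩ := exists_extension_norm_eq (LinearMap.range j) g1
  exact ⟨F, fun v => (hF ⟨j v, LinearMap.mem_range_self j v⟩).trans (hg0 v)⟩

/-- Bounded continuous functions with values in the `l`-linear forms. -/
def DerivSpace (n l : ℕ) : Type :=
  BoundedContinuousFunction (Rn n) (ContinuousMultilinearMap ℝ (fun _ : Fin l => Rn n) ℂ)

namespace DerivSpace

instance (n l : ℕ) : NormedAddCommGroup (DerivSpace n l) :=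
  inferInstanceAs (NormedAddCommGroup (BoundedContinuousFunction (Rn n)
    (ContinuousMultilinearMap ℝ (fun _ : Fin l => Rn n) ℂ)))

instance (n l : ℕ) : NormedSpace ℂ (DerivSpace n l) :=
  inferInstanceAs (NormedSpace ℂ (BoundedContinuousFunction (Rn n)
    (ContinuousMultilinearMap ℝ (fun _ : Fin l => Rn n) ℂ)))

instance (n l : ℕ) : CompleteSpace (DerivSpace n l) :=
  inferInstanceAs (CompleteSpace (BoundedContinuousFunction (Rn n)
    (ContinuousMultilinearMap ℝ (fun _ : Fin l => Rn n) ℂ)))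

/-- The value at a point. -/
def eval {n l : ℕ} (F : DerivSpace n l) (y : Rn n) :
    ContinuousMultilinearMap ℝ (fun _ : Fin l => Rn n) ℂ :=
  (show BoundedContinuousFunction (Rn n)
    (ContinuousMultilinearMap ℝ (fun _ : Fin l => Rn n) ℂ) from F) y

theorem norm_eval_le {n l : ℕ} (F : DerivSpace n l) (y : Rn n) : ‖F.eval y‖ ≤ ‖F‖ :=
  BoundedContinuousFunction.norm_coe_le_norm (α := Rn n)
    (β := ContinuousMultilinearMap ℝ (fun _ : Fin l => Rn n) ℂ) F y

theorem norm_le {n l : ℕ} {F : DerivSpace n l} {C : ℝ} (hC : 0 ≤ C) (h : ∀ y, ‖F.eval y‖ ≤ C) :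
    ‖F‖ ≤ C :=
  (BoundedContinuousFunction.norm_le (α := Rn n)
    (β := ContinuousMultilinearMap ℝ (fun _ : Fin l => Rn n) ℂ) (f := F) hC).2 h

theorem ext {n l : ℕ} {F G : DerivSpace n l} (h : ∀ y, F.eval y = G.eval y) : F = G :=
  BoundedContinuousFunction.ext (α := Rn n)
    (β := ContinuousMultilinearMap ℝ (fun _ : Fin l => Rn n) ℂ) h

/-- The value at a point and at vectors, as a continuous linear functional. -/
def evalCLM {n l : ℕ} (y : Rn n) (m : Fin l → Rn n) : DerivSpace n l →L[ℂ] ℂ :=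
  LinearMap.mkContinuous
    { toFun := fun F => F.eval y m
      map_add' := fun _ _ => rfl
      map_smul' := fun _ _ => rfl } (∏ i, ‖m i‖) fun F => by
    rw [mul_comm]
    exact ((F.eval y).le_opNorm m).trans (by gcongr; exact F.norm_eval_le y)

end DerivSpace

/-- The function `y ↦ |y| ^ k D ^ l φ(y)`. -/
def weightedDerivFun (k l : ℕ) (φ : 𝓢(Rn n, ℂ)) : DerivSpace n l :=
  BoundedContinuousFunction.ofNormedAddCommGroup
      (fun y => ‖y‖ ^ k • iteratedFDeriv ℝ l φ y)
      ((continuous_norm.pow k).smul ((φ.smooth ⊤).continuous_iteratedFDeriv (mod_cast le_top)))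
      (SchwartzMap.seminorm ℂ k l φ)
      (fun y => by simpa [norm_smul] using SchwartzMap.le_seminorm ℂ k l φ y)

theorem weightedDerivFun_eval (k l : ℕ) (φ : 𝓢(Rn n, ℂ)) (y : Rn n) :
    (weightedDerivFun k l φ).eval y = ‖y‖ ^ k • iteratedFDeriv ℝ l φ y := rfl

/-- The map `φ ↦ |y| ^ k D ^ l φ(y)` from Schwartz functions to bounded continuous functions. -/
def weightedDeriv (n k l : ℕ) : 𝓢(Rn n, ℂ) →L[ℂ] DerivSpace n l :=
  SchwartzMap.mkCLMtoNormedSpace (weightedDerivFun k l)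
    (fun φ ψ => DerivSpace.ext fun y => by
      have : iteratedFDeriv ℝ l ((φ + ψ : 𝓢(Rn n, ℂ)) : Rn n → ℂ) y
          = iteratedFDeriv ℝ l φ y + iteratedFDeriv ℝ l ψ y :=
        iteratedFDeriv_add_apply (φ.smooth l).contDiffAt (ψ.smooth l).contDiffAt
      change ‖y‖ ^ k • iteratedFDeriv ℝ l ((φ + ψ : 𝓢(Rn n, ℂ)) : Rn n → ℂ) y
        = ‖y‖ ^ k • iteratedFDeriv ℝ l φ y + ‖y‖ ^ k • iteratedFDeriv ℝ l ψ y
      rw [this, smul_add])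
    (fun c φ => DerivSpace.ext fun y => by
      have : iteratedFDeriv ℝ l ((c • φ : 𝓢(Rn n, ℂ)) : Rn n → ℂ) y
          = c • iteratedFDeriv ℝ l φ y :=
        iteratedFDeriv_const_smul_apply (φ.smooth l).contDiffAt
      change ‖y‖ ^ k • iteratedFDeriv ℝ l ((c • φ : 𝓢(Rn n, ℂ)) : Rn n → ℂ) y
        = c • ‖y‖ ^ k • iteratedFDeriv ℝ l φ y
      rw [this, smul_comm])
    ⟨{(k, l)}, 1, zero_le_one, fun φ => by
      rw [Finset.sup_singleton, one_mul]
      refine DerivSpace.norm_le (apply_nonneg _ _) fun y => ?_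
      rw [weightedDerivFun_eval, norm_smul, norm_pow, norm_norm]
      exact SchwartzMap.le_seminorm ℂ k l φ y⟩

theorem weightedDeriv_eval (k l : ℕ) (φ : 𝓢(Rn n, ℂ)) (y : Rn n) :
    (weightedDeriv n k l φ).eval y = ‖y‖ ^ k • iteratedFDeriv ℝ l φ y := rfl

theorem seminorm_le_norm_weightedDeriv (k l : ℕ) (φ : 𝓢(Rn n, ℂ)) :
    SchwartzMap.seminorm ℂ k l φ ≤ ‖weightedDeriv n k l φ‖ := by
  refine SchwartzMap.seminorm_le_bound ℂ k l φ (norm_nonneg _) fun y => ?_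
  have := (weightedDeriv n k l φ).norm_eval_le y
  rwa [weightedDeriv_eval, norm_smul, norm_pow, norm_norm] at this

/-- The normed space in which Schwartz functions are embedded by finitely many weighted
derivatives. -/
abbrev WeightedSpace (n : ℕ) (s : Finset (ℕ × ℕ)) : Type :=
  (i : s) → DerivSpace n i.1.2

/-- The embedding of Schwartz functions by finitely many weighted derivatives. -/
def weightedEmb (n : ℕ) (s : Finset (ℕ × ℕ)) : 𝓢(Rn n, ℂ) →L[ℂ] WeightedSpace n s :=
  ContinuousLinearMap.pi fun i => weightedDeriv n i.1.1 i.1.2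

/-- Continuity on `𝓢₀` involves only finitely many seminorms, so `f` factors through a normed space.
There Bochner integrals are available and commute with the extended functional. -/
theorem exists_factor_weightedEmb (f : S0Dual n) : ∃ (s : Finset (ℕ × ℕ))
    (F : WeightedSpace n s →L[ℂ] ℂ), ∀ φ : S0 n, F (weightedEmb n s φ) = f φ := by
  have hw : WithSeminorms ((schwartzSeminormFamily ℂ (Rn n) ℂ).comp (S0 n).subtype) :=
    (S0 n).subtype.withSeminorms_induced (schwartz_withSeminorms ℂ (Rn n) ℂ)
  obtain ⟨s, C, -, hC⟩ := Seminorm.bound_of_continuous hw ((normSeminorm ℂ ℂ).comp f.toLinearMap)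
    (by
      have : Continuous fun φ => ‖f φ‖ := f.continuous.norm
      exact this)
  refine ⟨s, ?_⟩
  refine exists_extension_of_norm_le f.toLinearMap
    ((weightedEmb n s).toLinearMap ∘ₗ (S0 n).subtype) C fun φ => ?_
  refine (hC φ).trans ?_
  rw [_root_.smul_apply, NNReal.smul_def, smul_eq_mul]
  gcongr
  refine Seminorm.finset_sup_apply_le (norm_nonneg _) fun i hi => ?_
  calc SchwartzMap.seminorm ℂ i.1 i.2 (φ : 𝓢(Rn n, ℂ))
      ≤ ‖weightedDeriv n i.1 i.2 φ‖ := seminorm_le_norm_weightedDeriv _ _ _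
    _ = ‖weightedEmb n s φ ⟨i, hi⟩‖ := rfl
    _ ≤ ‖weightedEmb n s φ‖ := norm_le_pi_norm (weightedEmb n s φ) ⟨i, hi⟩

open scoped LineDeriv

/-! ### Correlations as Bochner integrals of translates. -/

theorem lineDerivOp_reflect (ψ : 𝓢(Rn n, ℂ)) (x v : Rn n) :
    ∂_{v} (reflect ψ x) = reflect (-∂_{v} ψ) x := by
  ext y
  rw [SchwartzMap.lineDerivOp_apply_eq_fderiv, reflect_apply]
  have h : HasFDerivAt (fun y => ψ (x - y)) ((fderiv ℝ ψ (x - y)).comp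
      (-ContinuousLinearMap.id ℝ (Rn n))) y :=
    HasFDerivAt.comp y (ψ.hasFDerivAt (x - y)) ((hasFDerivAt_id y).const_sub x)
  have h2 : fderiv ℝ (reflect ψ x) y = _ := h.fderiv
  rw [h2]
  simp [SchwartzMap.lineDerivOp_apply_eq_fderiv]

theorem lineDerivOp_corr (ψ φ : 𝓢(Rn n, ℂ)) (v : Rn n) :
    ∂_{v} (corr ψ φ) = corr (-∂_{v} ψ) φ := by
  refine schwartz_ext_fourier fun ξ => ?_
  have ht : (inner ℝ · v : Rn n → ℝ).HasTemperateGrowth := by fun_prop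
  rw [fourier_corr, SchwartzMap.fourier_lineDerivOp_eq, FourierTransform.fourier_neg,
    SchwartzMap.fourier_lineDerivOp_eq]
  simp [SchwartzMap.smulLeftCLM_apply_apply ht, fourier_corr]
  ring

/-- The point is that one `ψ'` serves both formulas: identities between derivatives of a correlation
and of its translates then reduce to order zero, that is to `corr_apply`. -/
theorem exists_deriv_reflect_corr (l : ℕ) (m : Fin l → Rn n) (ψ : 𝓢(Rn n, ℂ)) :
    ∃ ψ' : 𝓢(Rn n, ℂ), (∀ x y, iteratedFDeriv ℝ l (reflect ψ x) y m = reflect ψ' x y) ∧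
      ∀ φ y, iteratedFDeriv ℝ l (corr ψ φ) y m = corr ψ' φ y := by
  suffices h : ∃ ψ' : 𝓢(Rn n, ℂ), (∀ x, ∂^{m} (reflect ψ x) = reflect ψ' x) ∧
      ∀ φ, ∂^{m} (corr ψ φ) = corr ψ' φ by
    obtain ⟨ψ', h1, h2⟩ := h
    refine ⟨ψ', fun x y => ?_, fun φ y => ?_⟩
    · rw [← h1, SchwartzMap.iteratedLineDerivOp_eq_iteratedFDeriv]
    · rw [← h2, SchwartzMap.iteratedLineDerivOp_eq_iteratedFDeriv]
  induction l with
  | zero => exact ⟨ψ, fun x => by simp, fun φ => by simp⟩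
  | succ l ih =>
    obtain ⟨ψ', h1, h2⟩ := ih (Fin.tail m)
    refine ⟨-∂_{m 0} ψ', fun x => ?_, fun φ => ?_⟩
    · rw [LineDeriv.iteratedLineDerivOp_succ_left, h1, lineDerivOp_reflect]
    · rw [LineDeriv.iteratedLineDerivOp_succ_left, h2, lineDerivOp_corr]

theorem iteratedFDeriv_reflect (l : ℕ) (ψ : 𝓢(Rn n, ℂ)) (x y : Rn n) :
    iteratedFDeriv ℝ l (reflect ψ x) y = iteratedFDeriv ℝ l (reflect ψ 0) (y - x) := by
  have : (reflect ψ x : Rn n → ℂ) = fun y => reflect ψ 0 (y - x) := by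
    funext y; simp
  rw [this, iteratedFDeriv_comp_sub]

theorem exists_weight_bound (k l : ℕ) (ψ : 𝓢(Rn n, ℂ)) : ∃ B : ℝ, 0 ≤ B ∧
    ∀ y, (1 + ‖y‖) ^ k * ‖iteratedFDeriv ℝ l ψ y‖ ≤ B :=
  ⟨_, by positivity, fun y => SchwartzMap.one_add_le_sup_seminorm_apply (𝕜 := ℂ) (m := (k, l))
    le_rfl le_rfl ψ y⟩

/-- Since `‖y‖ ≤ (1 + ‖x‖)(1 + ‖y - x‖)`, a translation costs only a polynomial factor in `x`, which
a Schwartz weight `φ x` absorbs. -/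
theorem exists_norm_weightedDeriv_reflect_le (k l : ℕ) (ψ : 𝓢(Rn n, ℂ)) : ∃ B : ℝ, 0 ≤ B ∧
    ∀ x, ‖weightedDeriv n k l (reflect ψ x)‖ ≤ (1 + ‖x‖) ^ k * B := by
  obtain ⟨B, hB, h⟩ := exists_weight_bound k l (reflect ψ 0)
  refine ⟨B, hB, fun x => DerivSpace.norm_le (by positivity) fun y => ?_⟩
  rw [weightedDeriv_eval, norm_smul, norm_pow, norm_norm, iteratedFDeriv_reflect]
  have h1 : ‖y‖ ≤ (1 + ‖x‖) * (1 + ‖y - x‖) := by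
    have := norm_le_insert' y x
    nlinarith [norm_nonneg x, norm_nonneg (y - x)]
  calc ‖y‖ ^ k * ‖iteratedFDeriv ℝ l (reflect ψ 0) (y - x)‖
      ≤ ((1 + ‖x‖) * (1 + ‖y - x‖)) ^ k * ‖iteratedFDeriv ℝ l (reflect ψ 0) (y - x)‖ := by
        gcongr
    _ = (1 + ‖x‖) ^ k * ((1 + ‖y - x‖) ^ k * ‖iteratedFDeriv ℝ l (reflect ψ 0) (y - x)‖) := by
        rw [mul_pow, mul_assoc]
    _ ≤ _ := by gcongr; exact h _

theorem continuous_weightedDeriv_reflect (k l : ℕ) (ψ : 𝓢(Rn n, ℂ)) :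
    Continuous fun x => weightedDeriv n k l (reflect ψ x) := by
  rw [continuous_iff_continuousAt]
  intro x₀
  obtain ⟨B, hB, h⟩ := exists_weight_bound k (l + 1) (reflect ψ 0)
  -- For `z` in the unit ball around `x₀` one has `1 + ‖z‖ ≤ R`, hence `‖y‖ ≤ R (1 + ‖y - z‖)`. The
  -- mean value inequality in the translation parameter then gives a Lipschitz bound uniform in `y`.
  set R : ℝ := 2 + ‖x₀‖ with hR
  have hR0 : 0 ≤ R := by positivity
  have hlip : ∀ x ∈ Metric.ball x₀ 1,
      dist (weightedDeriv n k l (reflect ψ x)) (weightedDeriv n k l (reflect ψ x₀))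
        ≤ R ^ k * B * ‖x - x₀‖ := by
    intro x hx
    rw [dist_eq_norm]
    refine DerivSpace.norm_le (by positivity) fun y => ?_
    change ‖‖y‖ ^ k • iteratedFDeriv ℝ l (reflect ψ x) y
      - ‖y‖ ^ k • iteratedFDeriv ℝ l (reflect ψ x₀) y‖ ≤ _
    rw [iteratedFDeriv_reflect l ψ x, iteratedFDeriv_reflect l ψ x₀]
    have hdiff : Differentiable ℝ (iteratedFDeriv ℝ l (reflect ψ 0)) :=
      ((reflect ψ 0).smooth (l + 1)).differentiable_iteratedFDeriv (mod_cast Nat.lt_succ_self l)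
    have key := (convex_ball x₀ 1).norm_image_sub_le_of_norm_hasFDerivWithin_le
      (f := fun z => ‖y‖ ^ k • iteratedFDeriv ℝ l (reflect ψ 0) (y - z))
      (f' := fun z => ‖y‖ ^ k • ((fderiv ℝ (iteratedFDeriv ℝ l (reflect ψ 0)) (y - z)).comp
        (-ContinuousLinearMap.id ℝ (Rn n)))) (C := R ^ k * B) (fun z hz => ?_) (fun z hz => ?_)
      (Metric.mem_ball_self one_pos) hx
    · exact key
    · have h1 : HasFDerivAt (fun z => iteratedFDeriv ℝ l (reflect ψ 0) (y - z))
          ((fderiv ℝ (iteratedFDeriv ℝ l (reflect ψ 0)) (y - z)).comp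
            (-ContinuousLinearMap.id ℝ (Rn n))) z :=
        HasFDerivAt.comp z (hdiff (y - z)).hasFDerivAt ((hasFDerivAt_id z).const_sub y)
      exact (h1.const_smul (‖y‖ ^ k)).hasFDerivWithinAt
    · have e1 : ‖z‖ ≤ 1 + ‖x₀‖ := by
        have := norm_le_insert' z x₀
        rw [mem_ball_iff_norm] at hz
        linarith
      have e2 : ‖y‖ ≤ R * (1 + ‖y - z‖) := by
        have := norm_le_insert' y z
        nlinarith [norm_nonneg x₀, norm_nonneg (y - z)]
      rw [norm_smul, norm_pow, norm_norm]
      calc ‖y‖ ^ k * ‖(fderiv ℝ (iteratedFDeriv ℝ l (reflect ψ 0)) (y - z)).comp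
            (-ContinuousLinearMap.id ℝ (Rn n))‖
          ≤ (R * (1 + ‖y - z‖)) ^ k * ‖iteratedFDeriv ℝ (l + 1) (reflect ψ 0) (y - z)‖ := by
            gcongr
            rw [← norm_fderiv_iteratedFDeriv, ContinuousLinearMap.comp_neg,
              ContinuousLinearMap.comp_id]
            exact (norm_neg (fderiv ℝ (iteratedFDeriv ℝ l (reflect ψ 0)) (y - z))).le
        _ = R ^ k * ((1 + ‖y - z‖) ^ k * ‖iteratedFDeriv ℝ (l + 1) (reflect ψ 0) (y - z)‖) := by
            rw [mul_pow, mul_assoc]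
        _ ≤ _ := by gcongr; exact h _
  rw [ContinuousAt, tendsto_iff_dist_tendsto_zero]
  have hlim : Tendsto (fun x => R ^ k * B * ‖x - x₀‖) (𝓝 x₀) (𝓝 0) := by
    have : Continuous fun x => R ^ k * B * ‖x - x₀‖ := by fun_prop
    simpa using this.tendsto x₀
  refine squeeze_zero' (Eventually.of_forall fun _ => dist_nonneg) ?_ hlim
  filter_upwards [Metric.ball_mem_nhds x₀ one_pos] with x hx using hlip x hx

theorem integrable_one_add_norm_pow_mul (k : ℕ) (φ : 𝓢(Rn n, ℂ)) :
    Integrable fun x => (1 + ‖x‖) ^ k * ‖φ x‖ := by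
  have : (fun x => (1 + ‖x‖) ^ k * ‖φ x‖)
      = fun x => ∑ i ∈ Finset.range (k + 1), (k.choose i : ℝ) * (‖x‖ ^ i * ‖φ x‖) := by
    funext x
    rw [add_comm, add_pow, Finset.sum_mul]
    refine Finset.sum_congr rfl fun i _ => ?_
    simp; ring
  rw [this]
  exact integrable_finsetSum _ fun i _ => (φ.integrable_pow_mul volume i).const_mul _

theorem integrable_smul_weightedEmb (s : Finset (ℕ × ℕ)) (ψ φ : 𝓢(Rn n, ℂ)) :
    Integrable fun x => φ x • weightedEmb n s (reflect ψ x) := by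
  have hc : ∀ i : s, Continuous fun x => φ x • weightedDeriv n i.1.1 i.1.2 (reflect ψ x) :=
    fun i => φ.continuous.smul (continuous_weightedDeriv_reflect _ _ ψ)
  choose B hB h using fun i : s => exists_norm_weightedDeriv_reflect_le i.1.1 i.1.2 ψ
  refine Integrable.mono' (g := fun x => ∑ i : s, (1 + ‖x‖) ^ i.1.1 * ‖φ x‖ * B i)
    (integrable_finsetSum _ fun i _ => (integrable_one_add_norm_pow_mul i.1.1 φ).mul_const _)
    (continuous_pi hc).aestronglyMeasurable (Eventually.of_forall fun x => ?_)
  refine (pi_norm_le_iff_of_nonneg (Finset.sum_nonneg fun i _ => by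
    have := hB i; positivity)).2 fun i => ?_
  refine le_trans ?_ (Finset.single_le_sum
    (f := fun i : s => (1 + ‖x‖) ^ i.1.1 * ‖φ x‖ * B i) (fun i _ => by
      have := hB i; positivity) (Finset.mem_univ i))
  change ‖φ x • weightedDeriv n i.1.1 i.1.2 (reflect ψ x)‖ ≤ _
  rw [norm_smul]
  calc ‖φ x‖ * _ ≤ ‖φ x‖ * ((1 + ‖x‖) ^ i.1.1 * B i) := by gcongr; exact h i x
    _ = _ := by ring

/-- Evaluations at points and vectors separate the elements of `WeightedSpace` and commute with the
integral, so the identity is checked pointwise. -/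
theorem integral_smul_weightedEmb (s : Finset (ℕ × ℕ)) (ψ φ : 𝓢(Rn n, ℂ)) :
    ∫ x, φ x • weightedEmb n s (reflect ψ x) = weightedEmb n s (corr ψ φ) := by
  have hi := integrable_smul_weightedEmb s ψ φ
  funext i
  refine DerivSpace.ext fun y => ContinuousMultilinearMap.ext fun m => ?_
  let T : WeightedSpace n s →L[ℂ] ℂ := (DerivSpace.evalCLM y m) ∘L (ContinuousLinearMap.proj i)
  change T (∫ x, φ x • weightedEmb n s (reflect ψ x)) = T (weightedEmb n s (corr ψ φ))
  rw [← T.integral_comp_comm hi]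
  obtain ⟨ψ', h1, h2⟩ := exists_deriv_reflect_corr i.1.2 m ψ
  have e1 : T (weightedEmb n s (corr ψ φ)) = ‖y‖ ^ i.1.1 • corr ψ' φ y := by
    rw [← h2]; rfl
  have e2 : ∀ x, T (φ x • weightedEmb n s (reflect ψ x))
      = ‖y‖ ^ i.1.1 • (φ x * ψ' (x - y)) := by
    intro x
    have : T (φ x • weightedEmb n s (reflect ψ x))
        = φ x • ‖y‖ ^ i.1.1 • iteratedFDeriv ℝ i.1.2 (reflect ψ x) y m := rfl
    rw [this, h1, reflect_apply, smul_comm, smul_eq_mul]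
  simp only [e2]
  rw [e1, integral_smul, corr_apply]

/-- With `ψ = Ψⱼ` this becomes `⟨f, Δⱼφ⟩ = ∫ Δⱼf φ`, the passage from the abstract functional to its
blocks. -/
theorem apply_corr (f : S0Dual n) {ψ : 𝓢(Rn n, ℂ)} (h : ∀ x, reflect ψ x ∈ S0 n)
    (φ : 𝓢(Rn n, ℂ)) (h' : corr ψ φ ∈ S0 n) :
    f ⟨corr ψ φ, h'⟩ = ∫ x, φ x * f ⟨reflect ψ x, h x⟩ := by
  obtain ⟨s, F, hF⟩ := exists_factor_weightedEmb f
  rw [← hF, ← integral_smul_weightedEmb, ← F.integral_comp_comm (integrable_smul_weightedEmb s ψ φ)]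
  congr 1
  funext x
  rw [map_smul, ← hF, smul_eq_mul]

theorem continuous_apply_reflect (f : S0Dual n) {ψ : 𝓢(Rn n, ℂ)}
    (h : ∀ x, reflect ψ x ∈ S0 n) : Continuous fun x => f ⟨reflect ψ x, h x⟩ := by
  obtain ⟨s, F, hF⟩ := exists_factor_weightedEmb f
  simp only [← hF]
  exact F.continuous.comp (continuous_pi fun i => continuous_weightedDeriv_reflect _ _ ψ)

end QBesov

namespace QBesov

/-! ### The Littlewood-Paley partition of unity -/

variable {n : ℕ}

namespace LittlewoodPaley

variable (L : LittlewoodPaley n)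

theorem phi_nonneg (ξ : Rn n) : 0 ≤ L.phi ξ := by
  by_cases h : 1 / 2 < ‖ξ‖ ∧ ‖ξ‖ < 2
  · exact (L.phi_pos ξ h.1 h.2).le
  · rw [not_and_or, not_lt, not_lt] at h
    exact (L.phi_eq_zero ξ h).ge

theorem norm_two_zpow_smul (j : ℤ) (ξ : Rn n) : ‖(2 : ℝ) ^ j • ξ‖ = 2 ^ j * ‖ξ‖ := by
  rw [norm_smul, Real.norm_of_nonneg (by positivity)]

/-- The denominator `∑ₖ φₖ` is invariant under dyadic dilations, by shifting the index of summation.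
-/
theorem fourier_Psi_eq_dil (j : ℤ) (ξ : Rn n) :
    𝓕 (L.Psi j) ξ = 𝓕 (L.Psi 0) ((2 : ℝ) ^ (-j) • ξ) := by
  rw [L.fourier_Psi, L.fourier_Psi, neg_zero, zpow_zero, one_smul]
  rw [← (Equiv.addRight j).tsum_eq]
  congr 3
  funext k
  rw [smul_smul, ← zpow_add₀ two_ne_zero, Equiv.coe_addRight, neg_add]

theorem fourier_Psi_zero_eq_zero {ξ : Rn n} (h : ‖ξ‖ ≤ 1 / 2 ∨ 2 ≤ ‖ξ‖) :
    𝓕 (L.Psi 0) ξ = 0 := by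
  rw [L.fourier_Psi, neg_zero, zpow_zero, one_smul, L.phi_eq_zero ξ h]
  simp

theorem fourier_Psi_eq_zero {j : ℤ} {ξ : Rn n} (h : ‖ξ‖ ≤ 2 ^ (j - 1) ∨ 2 ^ (j + 1) ≤ ‖ξ‖) :
    𝓕 (L.Psi j) ξ = 0 := by
  rw [fourier_Psi_eq_dil]
  apply L.fourier_Psi_zero_eq_zero
  rw [norm_two_zpow_smul, zpow_neg]
  have h2 : (0 : ℝ) < 2 ^ j := by positivity
  rw [zpow_sub_one₀ two_ne_zero, zpow_add_one₀ two_ne_zero] at h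
  refine h.imp (fun h => ?_) (fun h => ?_)
  · rw [inv_mul_le_iff₀ h2]; linarith
  · rw [le_inv_mul_iff₀ h2]; linarith

theorem fourierZero_Psi (j : ℤ) : FourierZeroNearOrigin (L.Psi j) := by
  have h2 : (0 : ℝ) < 2 ^ (j - 1) := by positivity
  filter_upwards [Metric.ball_mem_nhds (0 : Rn n) h2] with ξ hξ
  exact L.fourier_Psi_eq_zero (Or.inl (mem_ball_zero_iff.1 hξ).le)

/-- If `2^k ≤ ‖ξ‖ < 2^(k+1)`, only the levels `k` and `k + 1` can contribute, and level `k` is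
strictly positive. So the denominator is a nonzero finite sum. -/
theorem hasSum_fourier_Psi {ξ : Rn n} (hξ : ξ ≠ 0) : HasSum (fun j => 𝓕 (L.Psi j) ξ) 1 := by
  have hξ' : 0 < ‖ξ‖ := norm_pos_iff.2 hξ
  obtain ⟨k, hk1, hk2⟩ := exists_mem_Ico_zpow (y := (2 : ℝ)) hξ' (by norm_num)
  have hz : ∀ j ∉ ({k, k + 1} : Finset ℤ), L.phi ((2 : ℝ) ^ (-j) • ξ) = 0 := by
    intro j hj
    have h2 : (0 : ℝ) < 2 ^ j := by positivity
    apply L.phi_eq_zero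
    rw [norm_two_zpow_smul, zpow_neg, inv_mul_le_iff₀ h2, le_inv_mul_iff₀ h2]
    simp only [Finset.mem_insert, Finset.mem_singleton, not_or] at hj
    rcases lt_or_ge j k with h | h
    · right
      have : (2 : ℝ) ^ (j + 1) ≤ 2 ^ k := zpow_le_zpow_right₀ (by norm_num) h
      rw [zpow_add_one₀ two_ne_zero] at this
      linarith
    · left
      have : (2 : ℝ) ^ (k + 1) ≤ 2 ^ (j - 1) :=
        zpow_le_zpow_right₀ (by norm_num) (by omega)
      rw [zpow_sub_one₀ two_ne_zero] at this
      linarith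
  have hs : Summable fun j : ℤ => L.phi ((2 : ℝ) ^ (-j) • ξ) :=
    summable_of_ne_finset_zero hz
  have hpos : 0 < ∑' j : ℤ, L.phi ((2 : ℝ) ^ (-j) • ξ) := by
    refine hs.tsum_pos (fun j => L.phi_nonneg _) k ?_
    have h2 : (0 : ℝ) < 2 ^ k := by positivity
    rw [zpow_add_one₀ two_ne_zero] at hk2
    apply L.phi_pos
    · rw [norm_two_zpow_smul, zpow_neg, lt_inv_mul_iff₀ h2]; linarith
    · rw [norm_two_zpow_smul, zpow_neg, inv_mul_lt_iff₀ h2]; linarith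
  simp only [L.fourier_Psi]
  have := (hs.hasSum.div_const (∑' j : ℤ, L.phi ((2 : ℝ) ^ (-j) • ξ)))
  rw [div_self hpos.ne'] at this
  exact_mod_cast this.mapL Complex.ofRealCLM

end LittlewoodPaley

/-! ### Schwartz functions whose Fourier transform is flat at the origin -/

open scoped LineDeriv

theorem monomial_add_single (γ : Fin n → ℕ) (i : Fin n) (x : Rn n) :
    monomial (γ + Pi.single i 1) x = x i * monomial γ x := by
  simp only [monomial, Pi.add_apply, pow_add, Finset.prod_mul_distrib]
  rw [mul_comm]
  congr 1
  rw [Finset.prod_eq_single i (fun j _ hj => by simp [Pi.single_eq_of_ne hj])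
    (fun h => absurd (Finset.mem_univ i) h)]
  simp

theorem smulLeft_inner_mem_S0 {φ : 𝓢(Rn n, ℂ)} (hφ : φ ∈ S0 n) (v : Rn n) :
    SchwartzMap.smulLeftCLM ℂ (inner ℝ · v) φ ∈ S0 n := by
  intro γ
  have ht : (inner ℝ · v : Rn n → ℝ).HasTemperateGrowth := by fun_prop
  have e : ∀ x, monomial γ x * SchwartzMap.smulLeftCLM ℂ (inner ℝ · v) φ x
      = ∑ i, (v i : ℂ) * (monomial (γ + Pi.single i 1) x * φ x) := by
    intro x
    rw [SchwartzMap.smulLeftCLM_apply_apply ht, PiLp.inner_apply, Complex.real_smul]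
    push_cast
    rw [Finset.sum_mul, Finset.mul_sum]
    refine Finset.sum_congr rfl fun i _ => ?_
    rw [monomial_add_single]
    simp
    ring
  simp only [e]
  rw [integral_finsetSum _ fun i _ => (integrable_monomial_mul _ φ).const_mul _]
  refine Finset.sum_eq_zero fun i _ => ?_
  rw [integral_const_mul, hφ, mul_zero]

theorem fourier_zero_of_mem_S0 {φ : 𝓢(Rn n, ℂ)} (hφ : φ ∈ S0 n) : 𝓕 φ 0 = 0 := by
  have h := hφ 0
  rw [SchwartzMap.fourier_coe, Real.fourier_eq]
  simpa [monomial] using h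

/-- A derivative of `𝓕 φ` is, up to a constant, the Fourier transform of a linear form times `φ`,
which is again in `𝓢₀`. Iterating reduces to the vanishing of the integral. -/
theorem iteratedFDeriv_fourier_zero_of_mem_S0 {φ : 𝓢(Rn n, ℂ)} (hφ : φ ∈ S0 n) (m : ℕ) :
    iteratedFDeriv ℝ m (𝓕 φ : 𝓢(Rn n, ℂ)) 0 = 0 := by
  ext v
  rw [← SchwartzMap.iteratedLineDerivOp_eq_iteratedFDeriv]
  induction m generalizing φ with
  | zero => simpa using fourier_zero_of_mem_S0 hφ
  | succ m ih =>
    rw [LineDeriv.iteratedLineDerivOp_succ_right, SchwartzMap.lineDerivOp_fourier_eq]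
    refine ih ?_ _
    exact (S0 n).smul_mem _ (smulLeft_inner_mem_S0 hφ _)

/-- The mean value inequality from the origin turns a bound of order `N` on derivative `m + 1` into
one of order `N + 1` on derivative `m`; hence the induction is over `N` with `m` free. -/
theorem exists_norm_iteratedFDeriv_le_pow {g : 𝓢(Rn n, ℂ)}
    (hg : ∀ m, iteratedFDeriv ℝ m g 0 = 0) (N m : ℕ) :
    ∃ C : ℝ, 0 ≤ C ∧ ∀ ξ, ‖iteratedFDeriv ℝ m g ξ‖ ≤ C * ‖ξ‖ ^ N := by
  induction N generalizing m with
  | zero =>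
    exact ⟨SchwartzMap.seminorm ℂ 0 m g, apply_nonneg _ _, fun ξ => by
      simpa using SchwartzMap.norm_iteratedFDeriv_le_seminorm ℂ g m ξ⟩
  | succ N ih =>
    obtain ⟨C, hC, h⟩ := ih (m + 1)
    refine ⟨C, hC, fun ξ => ?_⟩
    have hdiff : Differentiable ℝ (iteratedFDeriv ℝ m g) :=
      (g.smooth (m + 1)).differentiable_iteratedFDeriv (mod_cast Nat.lt_succ_self m)
    have key := (convex_closedBall (0 : Rn n) ‖ξ‖).norm_image_sub_le_of_norm_fderiv_le
      (𝕜 := ℝ) (f := iteratedFDeriv ℝ m g) (C := C * ‖ξ‖ ^ N) (fun z _ => hdiff z)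
      (fun z hz => ?_) (Metric.mem_closedBall_self (norm_nonneg ξ))
      (mem_closedBall_zero_iff.2 le_rfl)
    · rw [hg, sub_zero, sub_zero] at key
      rwa [pow_succ, ← mul_assoc]
    · rw [norm_fderiv_iteratedFDeriv]
      refine (h z).trans ?_
      gcongr
      exact mem_closedBall_zero_iff.1 hz

theorem norm_iteratedFDeriv_dil_le (X : 𝓢(Rn n, ℂ)) (j : ℤ) (i : ℕ) (ξ : Rn n) :
    ‖iteratedFDeriv ℝ i (dil j X) ξ‖
      ≤ ((2 : ℝ) ^ j) ^ i * ‖iteratedFDeriv ℝ i X ((2 : ℝ) ^ j • ξ)‖ := by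
  have e : (dil j X : Rn n → ℂ) = X ∘ ((2 : ℝ) ^ j • ContinuousLinearMap.id ℝ (Rn n)) := by
    funext y; simp
  rw [e, ContinuousLinearMap.iteratedFDeriv_comp_right _ (X.smooth i) ξ le_rfl]
  refine (ContinuousMultilinearMap.norm_compContinuousLinearMap_le _ _).trans ?_
  rw [mul_comm]
  simp only [Finset.prod_const, Finset.card_univ, Fintype.card_fin]
  have : ‖(2 : ℝ) ^ j • ContinuousLinearMap.id ℝ (Rn n)‖ ≤ 2 ^ j := by
    rw [norm_smul, Real.norm_of_nonneg (by positivity)]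
    exact mul_le_of_le_one_right (by positivity) ContinuousLinearMap.norm_id_le
  gcongr
  simp

theorem iteratedFDeriv_eq_zero_of_norm {X : 𝓢(Rn n, ℂ)}
    (hX : ∀ ξ, ‖ξ‖ ≤ 1 / 2 ∨ 2 ≤ ‖ξ‖ → X ξ = 0) (i : ℕ) {ξ : Rn n}
    (hξ : ‖ξ‖ < 1 / 2 ∨ 2 < ‖ξ‖) : iteratedFDeriv ℝ i X ξ = 0 := by
  have h0 : (X : Rn n → ℂ) =ᶠ[𝓝 ξ] fun _ => 0 := by
    rcases hξ with h | h
    · filter_upwards [continuous_norm.continuousAt.eventually_lt_const h] with y hy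
      exact hX y (Or.inl hy.le)
    · filter_upwards [continuous_norm.continuousAt.eventually_const_lt h] with y hy
      exact hX y (Or.inr hy.le)
  rw [(Filter.EventuallyEq.iteratedFDeriv ℝ h0 i).eq_of_nhds]
  change iteratedFDeriv ℝ i (0 : Rn n → ℂ) ξ = 0
  rw [iteratedFDeriv_zero]; rfl

/-- Summable bound for `2 ^ (-|j|)`. -/
theorem summable_two_zpow_neg_abs : Summable fun j : ℤ => (2 : ℝ) ^ (-|j|) := by
  refine Summable.of_nat_of_neg ?_ ?_
  · simpa using summable_geometric_two
  · simpa using summable_geometric_two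

/-- Here `‖ξ‖` is comparable to `2^j`. For `j ≥ 0` one spare power of decay at infinity yields
`2^(-j)`; for `j ≤ 0` flatness of order `i + 1` at the origin beats the loss `2^(-ji)` caused by `i`
derivatives of a dilated cutoff. -/
theorem exists_flat_bound {g : 𝓢(Rn n, ℂ)} (hg : ∀ m, iteratedFDeriv ℝ m g 0 = 0) (k i m : ℕ) :
    ∃ C : ℝ, 0 ≤ C ∧ ∀ (j : ℤ) (ξ : Rn n), 1 / 2 ≤ ‖(2 : ℝ) ^ (-j) • ξ‖ →
      ‖(2 : ℝ) ^ (-j) • ξ‖ ≤ 2 →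
      ‖ξ‖ ^ k * (((2 : ℝ) ^ (-j)) ^ i * ‖iteratedFDeriv ℝ m g ξ‖) ≤ C * 2 ^ (-|j|) := by
  obtain ⟨C, hC, h⟩ := exists_norm_iteratedFDeriv_le_pow hg (i + 1) m
  set p := SchwartzMap.seminorm ℂ (k + 1) m g with hp
  have hp0 : 0 ≤ p := apply_nonneg _ _
  refine ⟨2 * p + C * 2 ^ (k + i + 1), by positivity, fun j ξ h1 h2 => ?_⟩
  rw [LittlewoodPaley.norm_two_zpow_smul] at h1 h2
  have h3 : (0 : ℝ) < 2 ^ (-j) := by positivity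
  set a : ℝ := 2 ^ (-j) with ha
  rcases le_total 0 j with hj | hj
  · have e : (2 : ℝ) ^ (-|j|) = a := by rw [abs_of_nonneg hj]
    have ha1 : a ≤ 1 := zpow_le_one_of_nonpos₀ (by norm_num) (by omega)
    have hs : ‖ξ‖ ^ (k + 1) * ‖iteratedFDeriv ℝ m g ξ‖ ≤ p := SchwartzMap.le_seminorm ℂ _ _ g ξ
    rw [e]
    have h5 : ‖ξ‖ ^ k * ‖iteratedFDeriv ℝ m g ξ‖ ≤ 2 * p * a := by
      have : ‖ξ‖ ^ k * ‖iteratedFDeriv ℝ m g ξ‖ * 1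
          ≤ ‖ξ‖ ^ k * ‖iteratedFDeriv ℝ m g ξ‖ * (2 * (a * ‖ξ‖)) := by
        gcongr; linarith
      calc ‖ξ‖ ^ k * ‖iteratedFDeriv ℝ m g ξ‖
          ≤ 2 * a * (‖ξ‖ ^ (k + 1) * ‖iteratedFDeriv ℝ m g ξ‖) := by
            rw [mul_one] at this; refine this.trans_eq ?_; ring
        _ ≤ 2 * a * p := by gcongr
        _ = _ := by ring
    calc ‖ξ‖ ^ k * (a ^ i * ‖iteratedFDeriv ℝ m g ξ‖)
        ≤ ‖ξ‖ ^ k * (1 * ‖iteratedFDeriv ℝ m g ξ‖) := by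
          gcongr; exact pow_le_one₀ h3.le ha1
      _ ≤ 2 * p * a := by rwa [one_mul]
      _ ≤ _ := by
          have : 0 ≤ C * 2 ^ (k + i + 1) * a := by positivity
          nlinarith
  · have e : (2 : ℝ) ^ (-|j|) = a⁻¹ := by
      rw [abs_of_nonpos hj, neg_neg, ha, zpow_neg, inv_inv]
    have hξ : ‖ξ‖ ≤ 2 * a⁻¹ := by
      rw [← div_eq_mul_inv, le_div_iff₀ h3]; linarith
    have ha1 : a⁻¹ ≤ 1 := inv_le_one_of_one_le₀ (one_le_zpow₀ (by norm_num) (by omega))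
    rw [e]
    calc ‖ξ‖ ^ k * (a ^ i * ‖iteratedFDeriv ℝ m g ξ‖)
        ≤ (2 * a⁻¹) ^ k * (a ^ i * (C * (2 * a⁻¹) ^ (i + 1))) := by
          gcongr
          exact (h ξ).trans (by gcongr)
      _ = (C * 2 ^ (k + i + 1)) * ((a⁻¹) ^ k * ((a * a⁻¹) ^ i * a⁻¹)) := by
          rw [mul_pow, mul_pow, mul_pow]; ring
      _ ≤ (C * 2 ^ (k + i + 1)) * (1 * (1 * a⁻¹)) := by
          rw [mul_inv_cancel₀ h3.ne', one_pow]
          gcongr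
          exact pow_le_one₀ (by positivity) ha1
      _ ≤ _ := by
          have : 0 ≤ 2 * p * a⁻¹ := by positivity
          nlinarith

theorem exists_seminorm_dil_mul_le {X g : 𝓢(Rn n, ℂ)}
    (hX : ∀ ξ, ‖ξ‖ ≤ 1 / 2 ∨ 2 ≤ ‖ξ‖ → X ξ = 0) (hg : ∀ m, iteratedFDeriv ℝ m g 0 = 0)
    (k l : ℕ) : ∃ C : ℝ, ∀ (j : ℤ) (G : 𝓢(Rn n, ℂ)),
      (∀ ξ, G ξ = X ((2 : ℝ) ^ (-j) • ξ) * g ξ) →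
      SchwartzMap.seminorm ℂ k l G ≤ C * 2 ^ (-|j|) := by
  choose C hC h using fun i : ℕ => exists_flat_bound hg k i (l - i)
  have hsum0 : 0 ≤ ∑ i ∈ Finset.range (l + 1),
      (l.choose i : ℝ) * (SchwartzMap.seminorm ℂ 0 i X * C i) :=
    Finset.sum_nonneg fun i _ => by have := hC i; positivity
  refine ⟨∑ i ∈ Finset.range (l + 1), (l.choose i : ℝ) * (SchwartzMap.seminorm ℂ 0 i X * C i),
    fun j G hG => SchwartzMap.seminorm_le_bound ℂ k l G (by positivity) fun ξ => ?_⟩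
  have e : (G : Rn n → ℂ) = fun ξ => dil (-j) X ξ * g ξ := by
    funext ξ; rw [hG, dil_apply]
  rw [e]
  have hmul := norm_iteratedFDeriv_mul_le ((dil (-j) X).smooth l) (g.smooth l) ξ
    (n := l) le_rfl
  calc ‖ξ‖ ^ k * ‖iteratedFDeriv ℝ l (fun ξ => dil (-j) X ξ * g ξ) ξ‖
      ≤ ‖ξ‖ ^ k * ∑ i ∈ Finset.range (l + 1), (l.choose i : ℝ) *
        ‖iteratedFDeriv ℝ i (dil (-j) X) ξ‖ * ‖iteratedFDeriv ℝ (l - i) g ξ‖ := by gcongr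
    _ ≤ ∑ i ∈ Finset.range (l + 1),
        (l.choose i : ℝ) * (SchwartzMap.seminorm ℂ 0 i X * C i) * 2 ^ (-|j|) := by
      rw [Finset.mul_sum]
      refine Finset.sum_le_sum fun i _ => ?_
      have hCi := hC i
      by_cases hξ : 1 / 2 ≤ ‖(2 : ℝ) ^ (-j) • ξ‖ ∧ ‖(2 : ℝ) ^ (-j) • ξ‖ ≤ 2
      · calc ‖ξ‖ ^ k * ((l.choose i : ℝ) * ‖iteratedFDeriv ℝ i (dil (-j) X) ξ‖ *
              ‖iteratedFDeriv ℝ (l - i) g ξ‖)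
            ≤ ‖ξ‖ ^ k * ((l.choose i : ℝ) * (((2 : ℝ) ^ (-j)) ^ i * SchwartzMap.seminorm ℂ 0 i X) *
              ‖iteratedFDeriv ℝ (l - i) g ξ‖) := by
              gcongr
              refine (norm_iteratedFDeriv_dil_le X (-j) i ξ).trans ?_
              gcongr
              exact SchwartzMap.norm_iteratedFDeriv_le_seminorm ℂ X i _
          _ = (l.choose i : ℝ) * SchwartzMap.seminorm ℂ 0 i X * (‖ξ‖ ^ k *
              (((2 : ℝ) ^ (-j)) ^ i * ‖iteratedFDeriv ℝ (l - i) g ξ‖)) := by ring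
          _ ≤ (l.choose i : ℝ) * SchwartzMap.seminorm ℂ 0 i X * (C i * 2 ^ (-|j|)) := by
              exact mul_le_mul_of_nonneg_left (h i j ξ hξ.1 hξ.2) (by positivity)
          _ = _ := by ring
      · rw [not_and_or, not_le, not_le] at hξ
        have h0 : ‖iteratedFDeriv ℝ i (dil (-j) X) ξ‖ = 0 := by
          refine le_antisymm ((norm_iteratedFDeriv_dil_le X (-j) i ξ).trans ?_) (norm_nonneg _)
          rw [iteratedFDeriv_eq_zero_of_norm hX i hξ, norm_zero, mul_zero]
        rw [h0]
        simp only [mul_zero, zero_mul]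
        positivity
    _ = _ := by rw [Finset.sum_mul]

/-- The vanishing moments make `𝓕 φ` flat at the origin, so the low-frequency pieces decay
geometrically in every Schwartz seminorm; the high-frequency ones do so by the decay of `𝓕 φ`. -/
theorem LittlewoodPaley.hasSum_corr_Psi (L : LittlewoodPaley n) {φ : 𝓢(Rn n, ℂ)}
    (hφ : φ ∈ S0 n) : HasSum (fun j => corr (L.Psi j) φ) φ := by
  set X : 𝓢(Rn n, ℂ) := 𝓕 (reflect (L.Psi 0) 0) with hXdef
  have hXv : ∀ ξ, X ξ = 𝓕 (L.Psi 0) (-ξ) := fun ξ => by rw [hXdef, fourier_reflect]; simp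
  have hX : ∀ ξ, ‖ξ‖ ≤ 1 / 2 ∨ 2 ≤ ‖ξ‖ → X ξ = 0 := fun ξ h => by
    rw [hXv]; exact L.fourier_Psi_zero_eq_zero (by rwa [norm_neg])
  have hg := iteratedFDeriv_fourier_zero_of_mem_S0 hφ
  have hv : ∀ j ξ, 𝓕 (corr (L.Psi j) φ) ξ = X ((2 : ℝ) ^ (-j) • ξ) * 𝓕 φ ξ := by
    intro j ξ
    rw [fourier_corr, L.fourier_Psi_eq_dil, hXv, smul_neg]
  have key : HasSum (fun j => 𝓕 (corr (L.Psi j) φ)) (𝓕 φ) := by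
    refine hasSum_of_summable_seminorm (fun k l => ?_) fun ξ => ?_
    · obtain ⟨C, hC⟩ := exists_seminorm_dil_mul_le hX hg k l
      exact (summable_two_zpow_neg_abs.mul_left C).of_nonneg_of_le (fun j => apply_nonneg _ _)
        fun j => hC j _ (hv j)
    -- The partition of unity fails at the origin, but `𝓕 φ` vanishes there.
    · rcases eq_or_ne ξ 0 with rfl | h0
      · simp only [fourier_corr, fourier_zero_of_mem_S0 hφ, mul_zero]
        exact hasSum_zero
      · simp only [fourier_corr]
        simpa using (L.hasSum_fourier_Psi (neg_ne_zero.2 h0)).mul_right (𝓕 φ ξ)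
  have := key.mapL (FourierTransform.fourierInvCLM ℂ 𝓢(Rn n, ℂ))
  simpa using this

theorem LittlewoodPaley.hasSum_apply_corr_Psi (L : LittlewoodPaley n) (f : S0Dual n) (φ : S0 n) :
    HasSum (fun j => f ⟨corr (L.Psi j) φ, corr_mem_S0 (L.fourierZero_Psi j) φ⟩) (f φ) := by
  have h : HasSum (fun j => (⟨corr (L.Psi j) φ, corr_mem_S0 (L.fourierZero_Psi j) φ⟩ : S0 n)) φ := by
    rw [HasSum, Topology.IsEmbedding.subtypeVal.tendsto_nhds_iff]
    have := L.hasSum_corr_Psi φ.2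
    refine this.congr fun s => ?_
    simp
  exact h.mapL f

end QBesov

namespace QBesov

/-! ### `Lᵖ` inequalities -/

variable {n : ℕ}

theorem eLpNorm_ofReal {α E : Type*} [MeasurableSpace α] {μ : Measure α} [NormedAddCommGroup E]
    {p : ℝ} (hp : 0 < p) (f : α → E) :
    eLpNorm f (ENNReal.ofReal p) μ = (∫⁻ x, ‖f x‖ₑ ^ p ∂μ) ^ (1 / p) := by
  rw [eLpNorm_eq_lintegral_rpow_enorm_toReal (by simpa using hp) ENNReal.ofReal_ne_top,
    ENNReal.toReal_ofReal hp.le]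

/-- Young's inequality with an `L¹` kernel: Hölder after the splitting `k = k^(1/p) k^(1/q)`, then
Tonelli. -/
theorem lintegral_conv_rpow_le {p : ℝ} (hp : 1 < p) {f k : Rn n → ℝ≥0∞} (hf : AEMeasurable f)
    (hk : AEMeasurable k) :
    ∫⁻ x, (∫⁻ y, f y * k (x - y)) ^ p ≤ (∫⁻ x, k x) ^ p * ∫⁻ x, f x ^ p := by
  have hpq := Real.HolderConjugate.conjExponent hp
  set q := p.conjExponent
  have hp0 : 0 < p := by linarith
  have hq0 : 0 < q := hpq.symm.pos
  have hkx : ∀ x, AEMeasurable fun y => k (x - y) := fun x =>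
    hk.comp_quasiMeasurePreserving (Measure.measurePreserving_sub_left volume x).quasiMeasurePreserving
  have hkint : ∀ x, ∫⁻ y, k (x - y) = ∫⁻ y, k y := fun x => by
    rw [lintegral_sub_left_eq_self k x]
  have hpt : ∀ x, (∫⁻ y, f y * k (x - y)) ^ p
      ≤ (∫⁻ y, f y ^ p * k (x - y)) * (∫⁻ y, k y) ^ (p - 1) := by
    intro x
    have h1 : ∫⁻ y, f y * k (x - y) ≤ (∫⁻ y, f y ^ p * k (x - y)) ^ (1 / p) *
        (∫⁻ y, k (x - y)) ^ (1 / q) := by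
      have hold := ENNReal.lintegral_mul_le_Lp_mul_Lq volume hpq
        (f := fun y => f y * k (x - y) ^ (1 / p)) (g := fun y => k (x - y) ^ (1 / q))
        (hf.mul ((hkx x).pow_const _)) ((hkx x).pow_const _)
      have e1 : ∀ y, ((fun y => f y * k (x - y) ^ (1 / p)) * fun y => k (x - y) ^ (1 / q)) y
          = f y * k (x - y) := by
        intro y
        simp only [Pi.mul_apply]
        rw [mul_assoc, ← ENNReal.rpow_add_of_nonneg _ _ (by positivity) (by positivity),
          one_div, one_div, hpq.inv_add_inv_eq_one, ENNReal.rpow_one]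
      have e2 : ∀ y, (f y * k (x - y) ^ (1 / p)) ^ p = f y ^ p * k (x - y) := by
        intro y
        rw [ENNReal.mul_rpow_of_nonneg _ _ hp0.le, ← ENNReal.rpow_mul, one_div_mul_cancel hp0.ne',
          ENNReal.rpow_one]
      have e3 : ∀ y, (k (x - y) ^ (1 / q)) ^ q = k (x - y) := by
        intro y
        rw [← ENNReal.rpow_mul, one_div_mul_cancel hq0.ne', ENNReal.rpow_one]
      simpa only [e1, e2, e3] using hold
    calc (∫⁻ y, f y * k (x - y)) ^ p ≤ ((∫⁻ y, f y ^ p * k (x - y)) ^ (1 / p) *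
        (∫⁻ y, k (x - y)) ^ (1 / q)) ^ p := by gcongr
      _ = _ := by
        rw [ENNReal.mul_rpow_of_nonneg _ _ hp0.le, ← ENNReal.rpow_mul, one_div_mul_cancel hp0.ne',
          ENNReal.rpow_one, ← ENNReal.rpow_mul, hkint]
        congr 2
        have := hpq.symm.sub_one_mul_conj
        have h2 := hpq.sub_one_mul_conj
        field_simp
        linarith
  have hm : AEMeasurable (Function.uncurry fun x y => f y ^ p * k (x - y))
      ((volume : Measure (Rn n)).prod volume) := by
    refine AEMeasurable.mul ?_ ?_
    · exact (hf.pow_const p).comp_quasiMeasurePreserving Measure.quasiMeasurePreserving_snd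
    · exact hk.comp_quasiMeasurePreserving (quasiMeasurePreserving_sub_of_right_invariant _ _)
  calc ∫⁻ x, (∫⁻ y, f y * k (x - y)) ^ p
      ≤ ∫⁻ x, (∫⁻ y, f y ^ p * k (x - y)) * (∫⁻ y, k y) ^ (p - 1) := lintegral_mono hpt
    _ = (∫⁻ x, ∫⁻ y, f y ^ p * k (x - y)) * (∫⁻ y, k y) ^ (p - 1) :=
        lintegral_mul_const'' _ hm.lintegral_prod_right'
    _ = (∫⁻ y, f y ^ p * ∫⁻ x, k x) * (∫⁻ y, k y) ^ (p - 1) := by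
        rw [lintegral_lintegral_swap hm]
        congr 2
        funext y
        rw [lintegral_const_mul'', lintegral_sub_right_eq_self k y]
        exact hk.comp_quasiMeasurePreserving (measurePreserving_sub_right volume y).quasiMeasurePreserving
    _ = (∫⁻ y, f y ^ p) * ((∫⁻ x, k x) * (∫⁻ y, k y) ^ (p - 1)) := by
        rw [lintegral_mul_const'' _ (hf.pow_const p), mul_assoc]
    _ = _ := by
        rw [mul_comm]
        congr 1
        conv_lhs => rw [← ENNReal.rpow_one (∫⁻ x, k x)]
        rw [← ENNReal.rpow_mul, one_mul,
          ← ENNReal.rpow_add_of_nonneg _ _ zero_le_one (by linarith)]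
        congr 1
        ring

theorem eLpNorm_conv_le {p : ℝ} (hp : 1 < p) {f k : Rn n → ℂ} (hf : AEStronglyMeasurable f)
    (hk : AEStronglyMeasurable k) :
    eLpNorm (fun x => ∫ y, f y * k (x - y)) (ENNReal.ofReal p) volume
      ≤ eLpNorm k 1 volume * eLpNorm f (ENNReal.ofReal p) volume := by
  have hp0 : 0 < p := by linarith
  rw [eLpNorm_ofReal hp0, eLpNorm_ofReal hp0, eLpNorm_one_eq_lintegral_enorm]
  calc (∫⁻ x, ‖∫ y, f y * k (x - y)‖ₑ ^ p) ^ (1 / p)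
      ≤ ((∫⁻ x, ‖k x‖ₑ) ^ p * ∫⁻ x, ‖f x‖ₑ ^ p) ^ (1 / p) := by
        gcongr
        refine le_trans (lintegral_mono fun x => ?_)
          (lintegral_conv_rpow_le hp hf.enorm hk.enorm)
        gcongr
        refine (enorm_integral_le_lintegral_enorm _).trans (lintegral_mono fun y => ?_)
        rw [enorm_mul]
    _ = _ := by
        rw [ENNReal.mul_rpow_of_nonneg _ _ (by positivity), ← ENNReal.rpow_mul,
          mul_one_div_cancel hp0.ne', ENNReal.rpow_one]

theorem eLpNorm_comp_sub_left {p : ℝ≥0∞} {E : Type*} [NormedAddCommGroup E] {g : Rn n → E}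
    (hg : AEStronglyMeasurable g) (x : Rn n) :
    eLpNorm (fun y => g (x - y)) p volume = eLpNorm g p volume :=
  eLpNorm_comp_measurePreserving hg (Measure.measurePreserving_sub_left volume x)

theorem eLpNorm_corr_le {p : ℝ} (hp : 1 < p) (ψ φ : 𝓢(Rn n, ℂ)) :
    eLpNorm (corr ψ φ) (ENNReal.ofReal p) volume
      ≤ eLpNorm ψ 1 volume * eLpNorm φ (ENNReal.ofReal p) volume := by
  have h := eLpNorm_conv_le hp φ.continuous.aestronglyMeasurable
    (reflect ψ 0).continuous.aestronglyMeasurable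
  have e1 : (fun x => ∫ y, φ y * reflect ψ 0 (x - y)) = corr ψ φ := by
    funext x
    simp [corr_apply]
  have e2 : eLpNorm (reflect ψ 0) 1 volume = eLpNorm ψ 1 volume :=
    eLpNorm_comp_sub_left ψ.continuous.aestronglyMeasurable 0
  rwa [e1, e2] at h

theorem holderTriple_ofReal {p q : ℝ} (h : p.HolderConjugate q) :
    ENNReal.HolderTriple (ENNReal.ofReal p) (ENNReal.ofReal q) 1 :=
  h.ennrealOfReal

theorem integrable_mul_of_memLp {p q : ℝ} (h : p.HolderConjugate q) {f g : Rn n → ℂ}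
    (hf : MemLp f (ENNReal.ofReal p)) (hg : MemLp g (ENNReal.ofReal q)) :
    Integrable fun x => f x * g x := by
  have := holderTriple_ofReal h
  exact hf.integrable_mul hg

theorem integral_norm_mul_le {p q : ℝ} (h : p.HolderConjugate q) {f g : Rn n → ℂ}
    (hf : MemLp f (ENNReal.ofReal p)) (hg : MemLp g (ENNReal.ofReal q)) :
    ∫ x, ‖f x * g x‖ ≤ (eLpNorm f (ENNReal.ofReal p) volume).toReal *
      (eLpNorm g (ENNReal.ofReal q) volume).toReal := by
  have := holderTriple_ofReal h
  have h1 := eLpNorm_smul_le_mul_eLpNorm (p := ENNReal.ofReal p) (q := ENNReal.ofReal q) (r := 1)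
    hg.1 hf.1
  rw [← ENNReal.toReal_mul, integral_norm_eq_lintegral_enorm (f := fun x => f x * g x) (hf.1.mul hg.1)]
  refine ENNReal.toReal_mono (ENNReal.mul_ne_top hf.2.ne hg.2.ne) ?_
  rw [eLpNorm_one_eq_lintegral_enorm] at h1
  exact h1

theorem norm_integral_mul_le {p q : ℝ} (h : p.HolderConjugate q) {f g : Rn n → ℂ}
    (hf : MemLp f (ENNReal.ofReal p)) (hg : MemLp g (ENNReal.ofReal q)) :
    ‖∫ x, f x * g x‖ ≤ (eLpNorm f (ENNReal.ofReal p) volume).toReal *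
      (eLpNorm g (ENNReal.ofReal q) volume).toReal :=
  (norm_integral_le_integral_norm _).trans (integral_norm_mul_le h hf hg)

/-! ### Scaling, countable sums and interpolation of `Lᵖ` norms. -/

theorem eLpNorm_comp_two_zpow_smul {r : ℝ} (hr : 0 < r) {E : Type*} [NormedAddCommGroup E]
    {g : Rn n → E} (hg : Continuous g) (j : ℤ) :
    eLpNorm (fun x => g ((2 : ℝ) ^ j • x)) (ENNReal.ofReal r) volume
      = ENNReal.ofReal ((2 : ℝ) ^ (-(j * n / r))) * eLpNorm g (ENNReal.ofReal r) volume := by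
  have h2 : (2 : ℝ) ^ j ≠ 0 := by positivity
  have hmap := Measure.map_addHaar_smul (volume : Measure (Rn n)) h2
  have hm : AEMeasurable (fun x : Rn n => (2 : ℝ) ^ j • x) := by fun_prop
  have hK : (0 : ℝ) < |(((2 : ℝ) ^ j) ^ Module.finrank ℝ (Rn n))⁻¹| := by positivity
  have h := eLpNorm_map_measure (p := ENNReal.ofReal r)
    (μ := (volume : Measure (Rn n))) (g := g) (f := fun x => (2 : ℝ) ^ j • x)
    hg.aestronglyMeasurable hm
  rw [hmap, eLpNorm_smul_measure_of_ne_zero (by simpa using hK)] at h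
  rw [Function.comp_def] at h
  rw [← h, smul_eq_mul]
  congr 1
  rw [ENNReal.toReal_div, ENNReal.toReal_one, ENNReal.toReal_ofReal hr.le,
    ENNReal.ofReal_rpow_of_pos hK, finrank_euclideanSpace_fin, abs_of_pos (by positivity),
    ← Real.rpow_intCast, ← Real.rpow_natCast, ← Real.rpow_mul (by norm_num),
    ← Real.rpow_neg (by norm_num), ← Real.rpow_mul (by norm_num)]
  congr 2
  field_simp

theorem eLpNorm_ldil {r : ℝ} (hr : 0 < r) (g : 𝓢(Rn n, ℂ)) (j : ℤ) :
    eLpNorm (ldil j g) (ENNReal.ofReal r) volume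
      = ENNReal.ofReal ((2 : ℝ) ^ (j * n * (1 - 1 / r))) * eLpNorm g (ENNReal.ofReal r) volume := by
  have e : (ldil j g : Rn n → ℂ) = (((2 : ℝ) ^ j) ^ n : ℂ) • fun x => g ((2 : ℝ) ^ j • x) := by
    funext x; simp [ldil_apply]
  rw [e, eLpNorm_const_smul, eLpNorm_comp_two_zpow_smul hr g.continuous, ← mul_assoc]
  congr 1
  have : ‖(((2 : ℝ) ^ j) ^ n : ℂ)‖ₑ = ENNReal.ofReal ((2 : ℝ) ^ ((j * n : ℝ))) := by
    rw [← ofReal_norm]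
    congr 1
    rw [norm_pow, Real.rpow_mul (by norm_num), Real.rpow_intCast, Real.rpow_natCast]
    simp
  rw [this, ← ENNReal.ofReal_mul (by positivity), ← Real.rpow_add (by norm_num)]
  congr 2
  ring

theorem eLpNorm_one_ldil (g : 𝓢(Rn n, ℂ)) (j : ℤ) :
    eLpNorm (ldil j g) 1 volume = eLpNorm g 1 volume := by
  have := eLpNorm_ldil one_pos g j
  simpa using this

/-- Fatou's lemma along a sequence of finite sets exhausting `ι`; pointwise convergence is enough.
-/
theorem eLpNorm_tsum_le {ι : Type*} [Countable ι] {E α : Type*} [NormedAddCommGroup E]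
    [MeasurableSpace α] {μ : Measure α}
    {p : ℝ≥0∞} (hp : 1 ≤ p) {u : ι → α → E} (hu : ∀ i, AEStronglyMeasurable (u i) μ) {v : α → E}
    (hs : ∀ x, HasSum (fun i => u i x) (v x)) :
    eLpNorm v p μ ≤ ∑' i, eLpNorm (u i) p μ := by
  obtain ⟨S, hS⟩ := exists_seq_tendsto (atTop : Filter (Finset ι))
  have hm : ∀ N, AEStronglyMeasurable (fun x => ∑ i ∈ S N, u i x) μ := fun N => by
    exact Finset.aestronglyMeasurable_fun_sum _ fun i _ => hu i
  refine (Lp.eLpNorm_lim_le_liminf_eLpNorm hm v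
    (Eventually.of_forall fun x => (hs x).comp hS)).trans ?_
  refine liminf_le_of_frequently_le' (Frequently.of_forall fun N => ?_)
  have e : (fun x => ∑ i ∈ S N, u i x) = ∑ i ∈ S N, u i := by
    funext x; simp
  rw [e]
  exact (eLpNorm_sum_le (fun i _ => hu i) hp).trans (ENNReal.sum_le_tsum _)

/-- Interpolation between `L²` and `L^∞`, from `|f|^p ≤ B^(p-2) |f|²`. -/
theorem eLpNorm_le_of_bound_of_two {p : ℝ} (hp : 2 < p) {f : Rn n → ℂ} {B : ℝ} (hB : 0 ≤ B)
    (h : ∀ x, ‖f x‖ ≤ B) :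
    eLpNorm f (ENNReal.ofReal p) volume
      ≤ ENNReal.ofReal (B ^ (1 - 2 / p)) * eLpNorm f 2 volume ^ (2 / p) := by
  have hp0 : 0 < p := by linarith
  have e2 : eLpNorm f 2 volume = (∫⁻ x, ‖f x‖ₑ ^ (2 : ℝ)) ^ (1 / (2 : ℝ)) := by
    rw [← eLpNorm_ofReal two_pos]; simp
  rw [eLpNorm_ofReal hp0, e2, ← ENNReal.rpow_mul]
  have hpt : ∀ x, ‖f x‖ₑ ^ p ≤ ENNReal.ofReal (B ^ (p - 2)) * ‖f x‖ₑ ^ (2 : ℝ) := by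
    intro x
    have hfx : ‖f x‖ₑ ≤ ENNReal.ofReal B := by
      rw [← ofReal_norm]; exact ENNReal.ofReal_le_ofReal (h x)
    calc ‖f x‖ₑ ^ p = ‖f x‖ₑ ^ (p - 2) * ‖f x‖ₑ ^ (2 : ℝ) := by
          rw [← ENNReal.rpow_add_of_nonneg _ _ (by linarith) (by norm_num)]
          congr 1; ring
      _ ≤ ENNReal.ofReal B ^ (p - 2) * ‖f x‖ₑ ^ (2 : ℝ) := by
          gcongr
      _ = _ := by rw [ENNReal.ofReal_rpow_of_nonneg hB (by linarith)]
  calc (∫⁻ x, ‖f x‖ₑ ^ p) ^ (1 / p)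
      ≤ (ENNReal.ofReal (B ^ (p - 2)) * ∫⁻ x, ‖f x‖ₑ ^ (2 : ℝ)) ^ (1 / p) := by
        gcongr
        rw [← lintegral_const_mul' _ _ ENNReal.ofReal_ne_top]
        exact lintegral_mono hpt
    _ = _ := by
        rw [ENNReal.mul_rpow_of_nonneg _ _ (by positivity),
          ENNReal.ofReal_rpow_of_nonneg (by positivity) (by positivity),
          ← Real.rpow_mul hB]
        congr 3
        · field_simp
        · field_simp

end QBesov

namespace QBesov

/-! ### Smooth multipliers on an annulus -/

variable {n : ℕ}

/-- A smooth function that is `1` on `1/2 ≤ |ξ| ≤ 2` and is supported in `1/4 ≤ |ξ| ≤ 3`. -/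
def cutoff (n : ℕ) (ξ : Rn n) : ℝ :=
  (⟨2, 3, by norm_num, by norm_num⟩ : ContDiffBump (0 : Rn n)) ξ *
    (1 - (⟨1 / 4, 1 / 2, by norm_num, by norm_num⟩ : ContDiffBump (0 : Rn n)) ξ)

theorem contDiff_cutoff : ContDiff ℝ ∞ (cutoff n) :=
  (ContDiffBump.contDiff _).mul (contDiff_const.sub (ContDiffBump.contDiff _))

theorem cutoff_eq_one {ξ : Rn n} (h1 : 1 / 2 ≤ ‖ξ‖) (h2 : ‖ξ‖ ≤ 2) : cutoff n ξ = 1 := by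
  rw [cutoff, ContDiffBump.one_of_mem_closedBall _ (mem_closedBall_zero_iff.2 h2),
    ContDiffBump.zero_of_le_dist _ (by simpa using h1), sub_zero, one_mul]

theorem cutoff_eq_zero {ξ : Rn n} (h : ‖ξ‖ ≤ 1 / 4 ∨ 3 ≤ ‖ξ‖) : cutoff n ξ = 0 := by
  rw [cutoff]
  rcases h with h | h
  · rw [ContDiffBump.one_of_mem_closedBall
      (⟨1 / 4, 1 / 2, by norm_num, by norm_num⟩ : ContDiffBump (0 : Rn n))
      (mem_closedBall_zero_iff.2 h), sub_self, mul_zero]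
  · rw [ContDiffBump.zero_of_le_dist
      (⟨2, 3, by norm_num, by norm_num⟩ : ContDiffBump (0 : Rn n)) (by simpa using h), zero_mul]

theorem contDiff_cutoff_smul {E : Type*} [NormedAddCommGroup E] [NormedSpace ℝ E] {F : Rn n → E}
    (hF : ∀ ξ, ξ ≠ 0 → ContDiffAt ℝ ∞ F ξ) : ContDiff ℝ ∞ fun ξ => cutoff n ξ • F ξ := by
  rw [contDiff_iff_contDiffAt]
  intro ξ
  rcases eq_or_ne ξ 0 with rfl | h
  · have : (fun ξ => cutoff n ξ • F ξ) =ᶠ[𝓝 0] fun _ => 0 := by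
      filter_upwards [Metric.closedBall_mem_nhds (0 : Rn n) (ε := 1 / 4) (by norm_num)] with y hy
      rw [cutoff_eq_zero (Or.inl (mem_closedBall_zero_iff.1 hy)), zero_smul]
    exact contDiffAt_const.congr_of_eventuallyEq this
  · exact contDiff_cutoff.contDiffAt.smul (hF ξ h)

theorem hasCompactSupport_cutoff_smul {E : Type*} [NormedAddCommGroup E] [NormedSpace ℝ E]
    (F : Rn n → E) : HasCompactSupport fun ξ => cutoff n ξ • F ξ := by
  refine HasCompactSupport.intro (isCompact_closedBall (0 : Rn n) 3) fun ξ hξ => ?_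
  rw [cutoff_eq_zero (Or.inr _), zero_smul]
  rw [mem_closedBall_zero_iff, not_le] at hξ
  exact hξ.le

/-- The Schwartz function `cutoff * F` for a function `F` smooth outside the origin. -/
def annMul {E : Type*} [NormedAddCommGroup E] [NormedSpace ℝ E] (F : Rn n → E)
    (hF : ∀ ξ, ξ ≠ 0 → ContDiffAt ℝ ∞ F ξ) : 𝓢(Rn n, E) :=
  (hasCompactSupport_cutoff_smul F).toSchwartzMap (contDiff_cutoff_smul hF)

theorem annMul_apply {E : Type*} [NormedAddCommGroup E] [NormedSpace ℝ E] (F : Rn n → E)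
    (hF : ∀ ξ, ξ ≠ 0 → ContDiffAt ℝ ∞ F ξ) (ξ : Rn n) : annMul F hF ξ = cutoff n ξ • F ξ := rfl

/-- The cutoff equals one on the support of `Ψ̂₀`, so it can be inserted at no cost; this turns
symbols singular at the origin into Schwartz kernels acting on blocks. -/
theorem exists_fourier_eq_cutoff_mul {F : Rn n → ℂ} (hF : ∀ ξ, ξ ≠ 0 → ContDiffAt ℝ ∞ F ξ) :
    ∃ θ : 𝓢(Rn n, ℂ), ∀ ξ, 𝓕 θ ξ = cutoff n ξ * F ξ := by
  refine ⟨𝓕⁻ (annMul F hF), fun ξ => ?_⟩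
  have : 𝓕 (𝓕⁻ (annMul F hF)) = annMul F hF := FourierTransform.fourier_fourierInv_eq _
  rw [this, annMul_apply, Complex.real_smul]

/-! ### Bernstein inequalities for the blocks -/

namespace LittlewoodPaley

variable (L : LittlewoodPaley n)

theorem fourier_Psi_mul_cutoff (j : ℤ) (ξ : Rn n) :
    𝓕 (L.Psi j) ξ * cutoff n ((2 : ℝ) ^ (-j) • ξ) = 𝓕 (L.Psi j) ξ := by
  by_cases h : ‖(2 : ℝ) ^ (-j) • ξ‖ ≤ 1 / 2 ∨ 2 ≤ ‖(2 : ℝ) ^ (-j) • ξ‖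
  · rw [L.fourier_Psi_eq_dil, L.fourier_Psi_zero_eq_zero h, zero_mul]
  · rw [not_or, not_le, not_le] at h
    rw [cutoff_eq_one h.1.le h.2.le]
    simp

/-- The block operator `φ ↦ ∫ φ(x) Ψⱼ(x - ·) dx` from Schwartz functions to `𝓢₀`. -/
def toS0 (j : ℤ) : 𝓢(Rn n, ℂ) →L[ℂ] S0 n :=
  (corr (L.Psi j)).codRestrict (S0 n) (corr_mem_S0 (L.fourierZero_Psi j))

@[simp] theorem coe_toS0 (j : ℤ) (φ : 𝓢(Rn n, ℂ)) : (L.toS0 j φ : 𝓢(Rn n, ℂ)) = corr (L.Psi j) φ :=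
  rfl

theorem apply_toS0 (f : S0Dual n) (j : ℤ) (φ : 𝓢(Rn n, ℂ)) :
    f (L.toS0 j φ) = ∫ x, L.block j f x * φ x := by
  refine (apply_corr f (fun x => L.reflect_mem_S0 j x) φ
    (corr_mem_S0 (L.fourierZero_Psi j) φ)).trans ?_
  exact integral_congr_ae (Eventually.of_forall fun x => mul_comm _ _)

theorem continuous_block (f : S0Dual n) (j : ℤ) : Continuous (L.block j f) :=
  continuous_apply_reflect f fun x => L.reflect_mem_S0 j x

/-- Bernstein's inequality from `L²` to `L^∞`: a block reproduces itself against the kernel `ldil j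
θ`, whose `L²` norm scales like `2^(jn/2)`, and Cauchy-Schwarz applies. -/
theorem exists_norm_block_le : ∃ C : ℝ, 0 ≤ C ∧ ∀ (f : S0Dual n) (j : ℤ),
    MemLp (L.block j f) 2 volume → ∀ x, ‖L.block j f x‖
      ≤ C * (2 : ℝ) ^ ((j : ℝ) * n / 2) * (eLpNorm (L.block j f) 2 volume).toReal := by
  obtain ⟨θ, hθ⟩ := exists_fourier_eq_cutoff_mul (n := n) (F := fun _ => 1)
    fun _ _ => contDiffAt_const
  refine ⟨(eLpNorm θ 2 volume).toReal, ENNReal.toReal_nonneg, fun f j hf x => ?_⟩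
  have e : reflect (L.Psi j) x = corr (L.Psi j) (reflect (ldil j θ) x) := by
    refine schwartz_ext_fourier fun ξ => ?_
    rw [fourier_corr, fourier_reflect, fourier_reflect, fourier_ldil, hθ, mul_one,
      mul_left_comm, L.fourier_Psi_mul_cutoff]
  have e2 : L.block j f x = ∫ y, L.block j f y * reflect (ldil j θ) x y := by
    rw [← apply_toS0, block]
    congr 1
    exact Subtype.ext e
  have h22 : Real.HolderConjugate 2 2 := Real.HolderConjugate.two_two
  have hh := norm_integral_mul_le h22 (f := L.block j f) (g := reflect (ldil j θ) x)
    (by simpa using hf) ((reflect (ldil j θ) x).memLp _)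
  have h3 : eLpNorm (reflect (ldil j θ) x) (ENNReal.ofReal 2) volume
      = ENNReal.ofReal ((2 : ℝ) ^ ((j : ℝ) * n / 2)) * eLpNorm θ 2 volume := by
    have h4 : eLpNorm (reflect (ldil j θ) x) (ENNReal.ofReal 2) volume
      = eLpNorm (ldil j θ) (ENNReal.ofReal 2) volume :=
        eLpNorm_comp_sub_left (ldil j θ).continuous.aestronglyMeasurable x
    rw [h4, eLpNorm_ldil two_pos]
    congr 3
    · ring
    · simp
  rw [h3, ENNReal.toReal_mul, ENNReal.toReal_ofReal (by positivity)] at hh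
  rw [e2]
  refine hh.trans_eq ?_
  rw [ENNReal.ofReal_ofNat]
  ring

/-- The symbol `i ζᵢ / (2 π |ζ|²)`. -/
def invGradSymbol (i : Fin n) (ζ : Rn n) : ℂ :=
  Complex.I * (ζ i * (2 * Real.pi * ‖ζ‖ ^ 2)⁻¹ : ℝ)

theorem contDiffAt_invGradSymbol (i : Fin n) (ζ : Rn n) (hζ : ζ ≠ 0) :
    ContDiffAt ℝ ∞ (invGradSymbol i) ζ := by
  refine contDiffAt_const.mul (Complex.ofRealCLM.contDiff.contDiffAt.comp ζ ?_)
  refine ContDiffAt.mul ?_ (ContDiffAt.inv ?_ ?_)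
  · exact (EuclideanSpace.proj (𝕜 := ℝ) i).contDiff.contDiffAt
  · exact contDiffAt_const.mul (contDiff_norm_sq ℝ).contDiffAt
  · have := norm_pos_iff.2 hζ
    positivity

open scoped LineDeriv

/-- The identity `∑ᵢ ξᵢ² / |ξ|² = 1` recovers a function from its gradient. The symbol is
homogeneous of degree `-1`, hence the factor `2^(-j)`; a correlation evaluates it at `-ξ`, which
fixes its sign. -/
theorem corr_Psi_eq_sum {θ : Fin n → 𝓢(Rn n, ℂ)}
    (hθ : ∀ i ξ, 𝓕 (θ i) ξ = cutoff n ξ * invGradSymbol i ξ) (j : ℤ) (φ : 𝓢(Rn n, ℂ)) :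
    corr (L.Psi j) φ = ∑ i, ((2 : ℝ) ^ (-j) : ℂ) • corr (L.Psi j)
      (corr (ldil j (θ i)) (∂_{EuclideanSpace.single i (1 : ℝ)} φ)) := by
  refine schwartz_ext_fourier fun ξ => ?_
  have hsum : 𝓕 (∑ i, ((2 : ℝ) ^ (-j) : ℂ) • corr (L.Psi j)
      (corr (ldil j (θ i)) (∂_{EuclideanSpace.single i (1 : ℝ)} φ))) ξ
      = ∑ i, ((2 : ℝ) ^ (-j) : ℂ) * 𝓕 (corr (L.Psi j)
      (corr (ldil j (θ i)) (∂_{EuclideanSpace.single i (1 : ℝ)} φ))) ξ := by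
    simp
  rw [hsum]
  have ht : ∀ i : Fin n, (inner ℝ · (EuclideanSpace.single i (1 : ℝ)) : Rn n → ℝ).HasTemperateGrowth :=
    fun i => by fun_prop
  have hterm : ∀ i : Fin n, ((2 : ℝ) ^ (-j) : ℂ) * 𝓕 (corr (L.Psi j)
      (corr (ldil j (θ i)) (∂_{EuclideanSpace.single i (1 : ℝ)} φ))) ξ
      = 𝓕 (L.Psi j) (-ξ) * cutoff n ((2 : ℝ) ^ (-j) • -ξ) * 𝓕 φ ξ *
        (ξ i ^ 2 * (‖ξ‖ ^ 2)⁻¹ : ℝ) := by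
    intro i
    rw [fourier_corr, fourier_corr, fourier_ldil, hθ, SchwartzMap.fourier_lineDerivOp_eq,
      _root_.smul_apply, SchwartzMap.smulLeftCLM_apply_apply (ht i), invGradSymbol]
    have ha : ((2 : ℝ) ^ (-j) : ℂ) ≠ 0 := zpow_ne_zero _ two_ne_zero
    have hpi : (Real.pi : ℂ) ≠ 0 := Complex.ofReal_ne_zero.2 Real.pi_ne_zero
    rw [norm_two_zpow_smul, norm_neg]
    simp only [PiLp.smul_apply, PiLp.neg_apply, smul_eq_mul,
      EuclideanSpace.inner_single_right, Complex.real_smul]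
    push_cast at ha ⊢
    simp only [one_mul, mul_pow, mul_inv, conj_trivial]
    field_simp
    ring_nf
    rw [Complex.I_sq]
    ring
  simp only [hterm]
  rw [← Finset.mul_sum, L.fourier_Psi_mul_cutoff, fourier_corr, ← Complex.ofReal_sum,
    ← Finset.sum_mul, ← EuclideanSpace.real_norm_sq_eq]
  rcases eq_or_ne ξ 0 with rfl | h
  · rw [neg_zero, (L.fourierZero_Psi j).self_of_nhds]; simp
  · rw [mul_inv_cancel₀ (by simpa using h)]; simp

/-- The gain `2^(-j)` comes from `corr_Psi_eq_sum`. The kernels `ldil j (θ i)` have `L¹` norm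
independent of `j`, so Young and Hölder finish. -/
theorem exists_norm_integral_block_le {p q : ℝ} (hpq : p.HolderConjugate q) :
    ∃ C : ℝ, 0 ≤ C ∧ ∀ (f : S0Dual n) (j : ℤ) (φ : 𝓢(Rn n, ℂ)),
      MemLp (L.block j f) (ENNReal.ofReal p) volume →
      ‖∫ x, L.block j f x * φ x‖ ≤ C * (2 : ℝ) ^ (-j) *
        (eLpNorm (L.block j f) (ENNReal.ofReal p) volume).toReal *
        (eLpNorm (fderiv ℝ φ) (ENNReal.ofReal q) volume).toReal := by
  choose θ hθ using fun i : Fin n =>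
    exists_fourier_eq_cutoff_mul (fun ξ hξ => contDiffAt_invGradSymbol i ξ hξ)
  refine ⟨∑ i, (eLpNorm (θ i) 1 volume).toReal,
    Finset.sum_nonneg fun i _ => ENNReal.toReal_nonneg, fun f j φ hf => ?_⟩
  have e : ∫ x, L.block j f x * φ x = ∑ i, ((2 : ℝ) ^ (-j) : ℂ) *
      ∫ x, L.block j f x *
        corr (ldil j (θ i)) (∂_{EuclideanSpace.single i (1 : ℝ)} φ) x := by
    simp only [← L.apply_toS0 f j]
    have h : L.toS0 j φ = ∑ i, ((2 : ℝ) ^ (-j) : ℂ) • L.toS0 j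
        (corr (ldil j (θ i)) (∂_{EuclideanSpace.single i (1 : ℝ)} φ)) := by
      refine Subtype.ext ?_
      rw [coe_toS0, L.corr_Psi_eq_sum hθ]
      simp
    rw [h, map_sum]
    simp only [map_smul, smul_eq_mul]
  have hfd : MemLp (fderiv ℝ φ) (ENNReal.ofReal q) volume :=
    SchwartzMap.memLp (SchwartzMap.fderivCLM ℝ (Rn n) ℂ φ) (ENNReal.ofReal q) volume
  rw [e]
  refine (norm_sum_le _ _).trans ?_
  rw [Finset.sum_mul, Finset.sum_mul, Finset.sum_mul]
  refine Finset.sum_le_sum fun i _ => ?_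
  have h1 := norm_integral_mul_le hpq hf
    ((corr (ldil j (θ i)) (∂_{EuclideanSpace.single i (1 : ℝ)} φ)).memLp (ENNReal.ofReal q))
  have hθ1 : eLpNorm (θ i) 1 volume ≠ ⊤ := ((θ i).eLpNorm_lt_top 1 volume).ne
  have hfd1 : eLpNorm (fderiv ℝ φ) (ENNReal.ofReal q) volume ≠ ⊤ := hfd.2.ne
  have h2 : (eLpNorm (corr (ldil j (θ i)) (∂_{EuclideanSpace.single i (1 : ℝ)} φ))
      (ENNReal.ofReal q) volume).toReal ≤ (eLpNorm (θ i) 1 volume).toReal *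
        (eLpNorm (fderiv ℝ φ) (ENNReal.ofReal q) volume).toReal := by
    rw [← ENNReal.toReal_mul]
    refine ENNReal.toReal_mono (ENNReal.mul_ne_top hθ1 hfd1) ?_
    refine (eLpNorm_corr_le hpq.symm.lt _ _).trans ?_
    rw [eLpNorm_one_ldil]
    gcongr
    refine eLpNorm_mono fun x => ?_
    rw [SchwartzMap.lineDerivOp_apply_eq_fderiv]
    refine ((fderiv ℝ φ x).le_opNorm _).trans ?_
    simp
  rw [norm_mul]
  have h3 : ‖((2 : ℝ) ^ (-j) : ℂ)‖ = (2 : ℝ) ^ (-j) := by simp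
  rw [h3]
  have h4 := h1.trans (mul_le_mul_of_nonneg_left h2 ENNReal.toReal_nonneg)
  refine (mul_le_mul_of_nonneg_left h4 (by positivity)).trans_eq ?_
  ring

end LittlewoodPaley

end QBesov

namespace QBesov

/-! ### The symbols `X(ξ) exp (-τ |ξ| ^ (2 β))` on an annulus -/

variable {n : ℕ}

theorem contDiffAt_norm_rpow (γ : ℝ) (ξ : Rn n) (hξ : ξ ≠ 0) :
    ContDiffAt ℝ ∞ (fun ξ : Rn n => ‖ξ‖ ^ γ) ξ :=
  (contDiffAt_norm ℝ hξ).rpow_const_of_ne (norm_ne_zero_iff.2 hξ)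

/-- A Schwartz function that equals `|ξ| ^ γ` for `1/2 ≤ |ξ| ≤ 2`. -/
def annPow (n : ℕ) (γ : ℝ) : 𝓢(Rn n, ℝ) := annMul (fun ξ => ‖ξ‖ ^ γ) (contDiffAt_norm_rpow γ)

theorem annPow_apply {γ : ℝ} {ξ : Rn n} (h1 : 1 / 2 ≤ ‖ξ‖) (h2 : ‖ξ‖ ≤ 2) :
    annPow n γ ξ = ‖ξ‖ ^ γ := by
  rw [annPow, annMul_apply, cutoff_eq_one h1 h2, one_smul]

/-- The symbol is supported in the annulus `1/2 ≤ |ξ| ≤ 2`. -/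
def AnnulusSupported (X : 𝓢(Rn n, ℂ)) : Prop := ∀ ξ, ‖ξ‖ ≤ 1 / 2 ∨ 2 ≤ ‖ξ‖ → X ξ = 0

theorem AnnulusSupported.hasCompactSupport {X : 𝓢(Rn n, ℂ)} (hX : AnnulusSupported X) :
    HasCompactSupport X := by
  refine HasCompactSupport.intro (isCompact_closedBall (0 : Rn n) 2) fun ξ hξ => hX ξ (Or.inr ?_)
  rw [mem_closedBall_zero_iff, not_le] at hξ
  exact hξ.le

theorem contDiff_exp_annPow (γ τ : ℝ) :
    ContDiff ℝ ∞ fun ξ : Rn n => Real.exp (-τ * annPow n γ ξ) :=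
  Real.contDiff_exp.comp (contDiff_const.mul (annPow n γ).smooth')

/-- The Schwartz function `X(ξ) exp (-τ |ξ| ^ γ)` for `X` supported in an annulus. -/
def heatSymbol (X : 𝓢(Rn n, ℂ)) (hX : AnnulusSupported X) (γ τ : ℝ) : 𝓢(Rn n, ℂ) :=
  HasCompactSupport.toSchwartzMap
    (f := fun ξ => Real.exp (-τ * annPow n γ ξ) • X ξ)
    (hX.hasCompactSupport.smul_left (f := fun ξ => Real.exp (-τ * annPow n γ ξ)))
    ((contDiff_exp_annPow γ τ).smul X.smooth')

theorem heatSymbol_apply' (X : 𝓢(Rn n, ℂ)) (hX : AnnulusSupported X) (γ τ : ℝ) (ξ : Rn n) :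
    heatSymbol X hX γ τ ξ = Real.exp (-τ * annPow n γ ξ) • X ξ := rfl

theorem heatSymbol_apply (X : 𝓢(Rn n, ℂ)) (hX : AnnulusSupported X) (γ τ : ℝ) (ξ : Rn n) :
    heatSymbol X hX γ τ ξ = Real.exp (-τ * ‖ξ‖ ^ γ) * X ξ := by
  rw [heatSymbol_apply', Complex.real_smul]
  by_cases h : ‖ξ‖ ≤ 1 / 2 ∨ 2 ≤ ‖ξ‖
  · rw [hX ξ h, mul_zero, mul_zero]
  · rw [not_or, not_le, not_le] at h
    rw [annPow_apply h.1.le h.2.le]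

theorem annulusSupported_heatSymbol (X : 𝓢(Rn n, ℂ)) (hX : AnnulusSupported X) (γ τ : ℝ) :
    AnnulusSupported (heatSymbol X hX γ τ) := fun ξ hξ => by
  rw [heatSymbol_apply, hX ξ hξ, mul_zero]

theorem one_add_pow_mul_exp_le {c τ : ℝ} (hc : 0 < c) (hτ : 0 ≤ τ) (N : ℕ) :
    (1 + τ) ^ N * Real.exp (-τ * c) ≤ N.factorial * Real.exp c / c ^ N := by
  have h := Real.pow_div_factorial_le_exp (c * (1 + τ)) (by positivity) N
  rw [div_le_iff₀ (by positivity), mul_pow] at h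
  rw [le_div_iff₀ (by positivity)]
  have e : Real.exp (c * (1 + τ)) * Real.exp (-τ * c) = Real.exp c := by
    rw [← Real.exp_add]; ring_nf
  calc (1 + τ) ^ N * Real.exp (-τ * c) * c ^ N
      = (c ^ N * (1 + τ) ^ N) * Real.exp (-τ * c) := by ring
    _ ≤ (Real.exp (c * (1 + τ)) * N.factorial) * Real.exp (-τ * c) := by gcongr
    _ = N.factorial * (Real.exp (c * (1 + τ)) * Real.exp (-τ * c)) := by ring
    _ = _ := by rw [e]

/-- By the chain rule of higher order, each derivative of the exponential costs at most one factor
`1 + τ`. -/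
theorem exists_iteratedFDeriv_exp_annPow_le (γ : ℝ) (l : ℕ) : ∃ C : ℝ, 0 ≤ C ∧ ∀ τ : ℝ, 0 ≤ τ →
    ∀ ξ : Rn n, ‖iteratedFDeriv ℝ l (fun ξ : Rn n => Real.exp (-τ * annPow n γ ξ)) ξ‖
      ≤ C * (1 + τ) ^ l * Real.exp (-τ * annPow n γ ξ) := by
  -- The summand `1` ensures `D ≤ D ^ i` for `i ≥ 1`, the form in which the composition estimate
  -- wants the bounds on the inner function.
  set D : ℝ := 1 + ∑ i ∈ Finset.range (l + 1), SchwartzMap.seminorm ℝ 0 i (annPow n γ) with hD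
  have hD1 : 1 ≤ D := le_add_of_nonneg_right (Finset.sum_nonneg fun i _ => apply_nonneg _ _)
  refine ⟨l.factorial * D ^ l, by positivity, fun τ hτ ξ => ?_⟩
  have h := norm_iteratedFDeriv_comp_le (𝕜 := ℝ) (g := fun y : ℝ => Real.exp (-τ * y))
    (f := annPow n γ) (n := l) (N := ∞) (C := (1 + τ) ^ l * Real.exp (-τ * annPow n γ ξ)) (D := D)
    (by fun_prop) (annPow n γ).smooth' (mod_cast le_top) ξ ?_ ?_
  · refine h.trans_eq (by ring)
  · intro i hi
    rw [norm_iteratedFDeriv_eq_norm_iteratedDeriv, iteratedDeriv_exp_const_mul, norm_mul, norm_pow,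
      Real.norm_eq_abs, abs_neg, abs_of_nonneg hτ, Real.norm_of_nonneg (Real.exp_pos _).le]
    gcongr
    calc τ ^ i ≤ (1 + τ) ^ i := by gcongr; linarith
      _ ≤ (1 + τ) ^ l := pow_le_pow_right₀ (by linarith) hi
  · intro i hi1 hil
    calc _ ≤ SchwartzMap.seminorm ℝ 0 i (annPow n γ) :=
          SchwartzMap.norm_iteratedFDeriv_le_seminorm ℝ _ _ _
      _ ≤ ∑ i ∈ Finset.range (l + 1), SchwartzMap.seminorm ℝ 0 i (annPow n γ) :=
          Finset.single_le_sum (f := fun i => SchwartzMap.seminorm ℝ 0 i (annPow n γ))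
            (fun i _ => apply_nonneg _ _) (Finset.mem_range.2 (by omega))
      _ ≤ D := by linarith
      _ ≤ D ^ i := le_self_pow₀ hD1 (by omega)

/-- On the annulus `|ξ|^γ` is bounded below by some `c > 0`, so `exp (-τ c)` absorbs the factor `(1
+ τ)^l` from differentiation and any further power `M`. -/
theorem exists_seminorm_heatSymbol_le (X : 𝓢(Rn n, ℂ)) (hX : AnnulusSupported X) (γ : ℝ)
    (k l M : ℕ) : ∃ C : ℝ, 0 ≤ C ∧ ∀ τ : ℝ, 0 ≤ τ →
      SchwartzMap.seminorm ℂ k l (heatSymbol X hX γ τ) ≤ C / (1 + τ) ^ M := by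
  choose A hA0 hA using exists_iteratedFDeriv_exp_annPow_le (n := n) γ
  -- The minimum of `|ξ|^γ` sits on the inner or the outer sphere according to the sign of `γ`.
  set c : ℝ := min ((1 / 2) ^ γ) (2 ^ γ) with hc
  have hc0 : 0 < c := by positivity
  set K : ℝ := (l + M).factorial * Real.exp c / c ^ (l + M) with hK
  have hK0 : 0 ≤ K := by positivity
  set S : ℝ := ∑ i ∈ Finset.range (l + 1), (l.choose i : ℝ) * A i *
    SchwartzMap.seminorm ℂ 0 (l - i) X with hS
  have hS0 : 0 ≤ S := Finset.sum_nonneg fun i _ =>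
    mul_nonneg (mul_nonneg (Nat.cast_nonneg _) (hA0 i)) (apply_nonneg _ _)
  refine ⟨2 ^ k * (S * K), by positivity, fun τ hτ => ?_⟩
  refine SchwartzMap.seminorm_le_bound ℂ _ _ _ (by positivity) fun ξ => ?_
  by_cases h : ‖ξ‖ < 1 / 2 ∨ 2 < ‖ξ‖
  · rw [iteratedFDeriv_eq_zero_of_norm (annulusSupported_heatSymbol X hX γ τ) l h, norm_zero,
      mul_zero]
    positivity
  rw [not_or, not_lt, not_lt] at h
  have hcξ : c ≤ annPow n γ ξ := by
    rw [annPow_apply h.1 h.2]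
    rcases le_total 0 γ with hγ | hγ
    · exact (min_le_left _ _).trans (Real.rpow_le_rpow (by norm_num) h.1 hγ)
    · exact (min_le_right _ _).trans
        (Real.rpow_le_rpow_of_nonpos (by linarith [h.1]) h.2 hγ)
  have hexp : (1 + τ) ^ l * Real.exp (-τ * annPow n γ ξ) ≤ K / (1 + τ) ^ M := by
    rw [le_div_iff₀ (by positivity)]
    calc _ = (1 + τ) ^ (l + M) * Real.exp (-τ * annPow n γ ξ) := by ring
      _ ≤ (1 + τ) ^ (l + M) * Real.exp (-τ * c) := by
          gcongr (1 + τ) ^ (l + M) * Real.exp ?_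
          nlinarith
      _ ≤ K := one_add_pow_mul_exp_le hc0 hτ _
  have hd : ‖iteratedFDeriv ℝ l (heatSymbol X hX γ τ) ξ‖ ≤ S * (K / (1 + τ) ^ M) := by
    refine (norm_iteratedFDeriv_smul_le (contDiff_exp_annPow γ τ) X.smooth' ξ
      (mod_cast le_top)).trans ?_
    rw [hS, Finset.sum_mul]
    refine Finset.sum_le_sum fun i hi => ?_
    have hi' : i ≤ l := Nat.lt_succ_iff.1 (Finset.mem_range.1 hi)
    have h1 : ‖iteratedFDeriv ℝ i (fun ξ : Rn n => Real.exp (-τ * annPow n γ ξ)) ξ‖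
        ≤ A i * (K / (1 + τ) ^ M) := by
      refine (hA i τ hτ ξ).trans ?_
      rw [mul_assoc]
      refine mul_le_mul_of_nonneg_left (le_trans ?_ hexp) (hA0 i)
      gcongr
      · linarith
    have h2 := SchwartzMap.norm_iteratedFDeriv_le_seminorm ℂ X (l - i) ξ
    calc _ ≤ (l.choose i : ℝ) * (A i * (K / (1 + τ) ^ M)) *
          SchwartzMap.seminorm ℂ 0 (l - i) X := by
          have := hA0 i
          exact mul_le_mul (mul_le_mul_of_nonneg_left h1 (by positivity)) h2 (norm_nonneg _)
            (by positivity)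
      _ = _ := by ring
  calc ‖ξ‖ ^ k * ‖iteratedFDeriv ℝ l (heatSymbol X hX γ τ) ξ‖
      ≤ 2 ^ k * (S * (K / (1 + τ) ^ M)) := by
        gcongr
        exact h.2
    _ = _ := by ring

theorem exists_continuous_seminorm_heatSymbol_le (X : 𝓢(Rn n, ℂ)) (hX : AnnulusSupported X)
    (γ : ℝ) {q : Seminorm ℂ 𝓢(Rn n, ℂ)} (hq : Continuous q) (M : ℕ) : ∃ C : ℝ, 0 ≤ C ∧
      ∀ τ : ℝ, 0 ≤ τ → q (heatSymbol X hX γ τ) ≤ C / (1 + τ) ^ M := by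
  obtain ⟨s, C, -, hC⟩ := Seminorm.bound_of_continuous (schwartz_withSeminorms ℂ (Rn n) ℂ) q hq
  choose A hA0 hA using fun kl : ℕ × ℕ => exists_seminorm_heatSymbol_le X hX γ kl.1 kl.2 M
  have hs0 : 0 ≤ ∑ kl ∈ s, A kl := Finset.sum_nonneg fun kl _ => hA0 kl
  refine ⟨C * ∑ kl ∈ s, A kl, by positivity, fun τ hτ => ?_⟩
  refine (hC _).trans ?_
  rw [_root_.smul_apply, NNReal.smul_def, smul_eq_mul, mul_div_assoc]
  refine mul_le_mul_of_nonneg_left ?_ C.2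
  refine Seminorm.finset_sup_apply_le (by positivity) fun kl hkl => ?_
  refine (hA kl τ hτ).trans ?_
  gcongr
  exact Finset.single_le_sum (fun kl _ => hA0 kl) hkl

/-! ### Dyadic sums -/

theorem summable_two_rpow_neg_natAbs {ε : ℝ} (hε : 0 < ε) :
    Summable fun j : ℤ => (2 : ℝ) ^ (-(ε * |(j : ℝ)|)) := by
  have h : Summable fun k : ℕ => (2 : ℝ) ^ (-(ε * (k : ℝ))) := by
    have : (fun k : ℕ => (2 : ℝ) ^ (-(ε * (k : ℝ)))) = fun k : ℕ => ((2 : ℝ) ^ (-ε)) ^ k := by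
      funext k
      rw [← Real.rpow_natCast, ← Real.rpow_mul two_pos.le]
      ring_nf
    rw [this]
    exact summable_geometric_of_lt_one (by positivity)
      (Real.rpow_lt_one_of_one_lt_of_neg one_lt_two (by linarith))
  refine Summable.of_nat_of_neg ?_ ?_ <;> simpa using h

/-- The dyadic factor `2 ^ (j a) / (1 + t 2 ^ (γ j)) ^ M`. -/
def dyadicTerm (a γ t : ℝ) (M : ℕ) (j : ℤ) : ℝ :=
  (2 : ℝ) ^ ((j : ℝ) * a) / (1 + t * (2 : ℝ) ^ (γ * j)) ^ M

theorem dyadicTerm_nonneg {a γ t : ℝ} {M : ℕ} (ht : 0 ≤ t) (j : ℤ) : 0 ≤ dyadicTerm a γ t M j := by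
  unfold dyadicTerm; positivity

/-- The numerator decays as `j → -∞` because `a > 0`, and the denominator wins as `j → ∞` because `a
< γ M`. -/
theorem summable_dyadicTerm {a γ t : ℝ} {M : ℕ} (ha : 0 < a) (hM : a < γ * M) (ht : 0 < t) :
    Summable (dyadicTerm a γ t M) := by
  set ε := min a (γ * M - a) with hε
  have hε0 : 0 < ε := lt_min ha (by linarith)
  refine Summable.of_nonneg_of_le (dyadicTerm_nonneg ht.le) (fun j => ?_)
    ((summable_two_rpow_neg_natAbs hε0).mul_left (max 1 (t ^ M)⁻¹))
  rcases le_total 0 j with hj | hj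
  · have hj' : (0 : ℝ) ≤ j := mod_cast hj
    rw [abs_of_nonneg hj', dyadicTerm]
    have h1 : t ^ M * (2 : ℝ) ^ ((j : ℝ) * (γ * M)) ≤ (1 + t * (2 : ℝ) ^ (γ * j)) ^ M := by
      have : (2 : ℝ) ^ ((j : ℝ) * (γ * M)) = ((2 : ℝ) ^ (γ * j)) ^ M := by
        rw [← Real.rpow_natCast, ← Real.rpow_mul two_pos.le]; ring_nf
      rw [this, ← mul_pow]
      gcongr
      linarith
    calc _ ≤ (2 : ℝ) ^ ((j : ℝ) * a) / (t ^ M * (2 : ℝ) ^ ((j : ℝ) * (γ * M))) := by gcongr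
      _ = (t ^ M)⁻¹ * (2 : ℝ) ^ ((j : ℝ) * a - (j : ℝ) * (γ * M)) := by
          rw [Real.rpow_sub two_pos]; field_simp
      _ ≤ (t ^ M)⁻¹ * (2 : ℝ) ^ (-(ε * j)) := by
          gcongr
          · exact one_le_two
          · have : ε ≤ γ * M - a := min_le_right _ _
            nlinarith
      _ ≤ _ := by gcongr; exact le_max_right _ _
  · have hj' : (j : ℝ) ≤ 0 := mod_cast hj
    rw [abs_of_nonpos hj', dyadicTerm]
    calc _ ≤ (2 : ℝ) ^ ((j : ℝ) * a) / 1 := by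
          gcongr
          exact one_le_pow₀ (le_add_of_nonneg_right (by positivity))
      _ ≤ 1 * (2 : ℝ) ^ (-(ε * -j)) := by
          rw [div_one, one_mul]
          gcongr
          · exact one_le_two
          · have : ε ≤ a := min_le_left _ _
            nlinarith
      _ ≤ _ := by gcongr; exact le_max_left _ _

theorem dyadicTerm_le_shift {a γ t : ℝ} (ht : 0 < t) {m : ℤ}
    (hm : t⁻¹ ≤ (2 : ℝ) ^ (γ * (m : ℝ))) (j : ℤ) :
    dyadicTerm a γ t 1 j ≤ (2 : ℝ) ^ ((m : ℝ) * a) * dyadicTerm a γ 1 1 (j - m) := by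
  have h1 : (2 : ℝ) ^ (γ * ((j - m : ℤ) : ℝ)) ≤ t * (2 : ℝ) ^ (γ * j) := by
    rw [Int.cast_sub, mul_sub, Real.rpow_sub two_pos, div_le_iff₀ (by positivity)]
    have h2 := mul_le_mul_of_nonneg_left hm ht.le
    rw [mul_inv_cancel₀ ht.ne'] at h2
    nlinarith [Real.rpow_pos_of_pos two_pos (γ * j)]
  simp only [dyadicTerm, pow_one, one_mul]
  calc _ ≤ (2 : ℝ) ^ ((j : ℝ) * a) / (1 + (2 : ℝ) ^ (γ * ((j - m : ℤ) : ℝ))) := by gcongr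
    _ = _ := by
      rw [← mul_div_assoc, ← Real.rpow_add two_pos]
      congr 2
      push_cast
      ring

theorem exists_two_rpow_approx {γ t : ℝ} (hγ : 0 < γ) (ht : 0 < t) : ∃ m : ℤ,
    t⁻¹ ≤ (2 : ℝ) ^ (γ * (m : ℝ)) ∧ (2 : ℝ) ^ (γ * (m : ℝ)) ≤ 2 ^ γ * t⁻¹ := by
  obtain ⟨m, hm1, hm2⟩ := exists_mem_Ico_zpow (x := t⁻¹) (y := (2 : ℝ) ^ γ) (by positivity)
    (Real.one_lt_rpow one_lt_two hγ)
  rw [← Real.rpow_intCast, ← Real.rpow_mul two_pos.le] at hm1 hm2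
  refine ⟨m + 1, hm2.le, ?_⟩
  rw [Int.cast_add, Int.cast_one, mul_add, mul_one, add_comm, Real.rpow_add two_pos]
  gcongr

theorem tsum_dyadicTerm_shift (a γ : ℝ) (m : ℤ) :
    ∑' j, dyadicTerm a γ 1 1 (j - m) = ∑' j, dyadicTerm a γ 1 1 j :=
  (Equiv.subRight m).tsum_eq (dyadicTerm a γ 1 1)

/-- Scaling: with `t` of size `2^(-γ m)`, shifting the index by `m` replaces `t` by `1` and extracts
`2^(ma)`, of size `t^(-a/γ)`. Rounding to an integer `m` costs the factor `2^a`. -/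
theorem tsum_dyadicTerm_le {a γ t : ℝ} (ha : 0 < a) (hγ : a < γ) (ht : 0 < t) :
    ∑' j, dyadicTerm a γ t 1 j ≤ ((2 : ℝ) ^ a * ∑' j, dyadicTerm a γ 1 1 j) * t ^ (-(a / γ)) := by
  have hγ0 : 0 < γ := ha.trans hγ
  have hs : ∀ {t : ℝ}, 0 < t → Summable (dyadicTerm a γ t 1) := fun ht =>
    summable_dyadicTerm ha (by simpa using hγ) ht
  have hS0 : 0 ≤ ∑' j, dyadicTerm a γ 1 1 j := tsum_nonneg (dyadicTerm_nonneg zero_le_one)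
  obtain ⟨m, hm1, hm2⟩ := exists_two_rpow_approx hγ0 ht
  have hs2 : Summable fun j => dyadicTerm a γ 1 1 (j - m) :=
    ((Equiv.subRight m).summable_iff (f := dyadicTerm a γ 1 1)).2 (hs one_pos)
  have hm3 : (2 : ℝ) ^ ((m : ℝ) * a) ≤ (2 : ℝ) ^ a * t ^ (-(a / γ)) := by
    have h3 := Real.rpow_le_rpow (by positivity) hm2 (by positivity : 0 ≤ a / γ)
    have e1 : γ * m * (a / γ) = m * a := by field_simp
    have e2 : γ * (a / γ) = a := by field_simp
    rwa [← Real.rpow_mul two_pos.le, Real.mul_rpow (by positivity) (by positivity),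
      ← Real.rpow_mul two_pos.le, Real.inv_rpow ht.le, ← Real.rpow_neg ht.le, e1, e2] at h3
  have h4 := (hs ht).tsum_le_tsum (dyadicTerm_le_shift ht hm1) (hs2.mul_left _)
  rw [tsum_mul_left, tsum_dyadicTerm_shift] at h4
  generalize ∑' j, dyadicTerm a γ 1 1 j = S at h4 hS0 ⊢
  have h5 := mul_le_mul_of_nonneg_right hm3 hS0
  linarith

end QBesov

namespace QBesov

/-! ### Dyadic pieces of the heat kernel -/

variable {n : ℕ}

/-- The `L^r` norm after `T` is a continuous seminorm on `𝓢`. The map `T` is left free so as to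
cover the inverse Fourier transform, its gradient, and the identity. -/
theorem exists_eLpNorm_heatSymbol_le {E : Type*} [NormedAddCommGroup E] [NormedSpace ℝ E]
    [NormedSpace ℂ E] [SMulCommClass ℝ ℂ E]
    (T : 𝓢(Rn n, ℂ) →L[ℂ] 𝓢(Rn n, E)) {r : ℝ} (hr : 1 ≤ r) (X : 𝓢(Rn n, ℂ))
    (hX : AnnulusSupported X) (γ : ℝ) (M : ℕ) : ∃ C : ℝ, 0 ≤ C ∧ ∀ τ : ℝ, 0 ≤ τ →
      eLpNorm (T (heatSymbol X hX γ τ)) (ENNReal.ofReal r) volume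
        ≤ ENNReal.ofReal (C / (1 + τ) ^ M) := by
  have : Fact (1 ≤ ENNReal.ofReal r) := ⟨by simpa using ENNReal.ofReal_le_ofReal hr⟩
  set A : 𝓢(Rn n, ℂ) →L[ℂ] Lp E (ENNReal.ofReal r) (volume : Measure (Rn n)) :=
    (SchwartzMap.toLpCLM ℂ E (ENNReal.ofReal r) volume).comp T with hA
  obtain ⟨C, hC0, hC⟩ := exists_continuous_seminorm_heatSymbol_le X hX γ
    (q := (normSeminorm ℂ _).comp A.toLinearMap) (continuous_norm.comp A.continuous) M
  refine ⟨C, hC0, fun τ hτ => ?_⟩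
  have h : ‖A (heatSymbol X hX γ τ)‖ ≤ C / (1 + τ) ^ M := hC τ hτ
  rw [hA, ContinuousLinearMap.comp_apply, SchwartzMap.toLpCLM_apply, SchwartzMap.norm_toLp] at h
  exact (ENNReal.le_ofReal_iff_toReal_le
    ((T (heatSymbol X hX γ τ)).eLpNorm_lt_top _ volume).ne (by positivity)).2 h

theorem norm_iteratedFDeriv_ldil_le (g : 𝓢(Rn n, ℂ)) (j : ℤ) (m : ℕ) (x : Rn n) :
    ‖iteratedFDeriv ℝ m (ldil j g) x‖
      ≤ (2 : ℝ) ^ ((j : ℝ) * (n + m)) * ‖iteratedFDeriv ℝ m g ((2 : ℝ) ^ j • x)‖ := by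
  have h1 : iteratedFDeriv ℝ m (ldil j g) x
      = (((2 : ℝ) ^ j) ^ n : ℂ) • iteratedFDeriv ℝ m (dil j g) x :=
    iteratedFDeriv_const_smul_apply ((dil j g).smooth m).contDiffAt
  have e : (2 : ℝ) ^ ((j : ℝ) * (n + m)) = ((2 : ℝ) ^ j) ^ n * ((2 : ℝ) ^ j) ^ m := by
    rw [mul_add, Real.rpow_add two_pos, Real.rpow_mul two_pos.le, Real.rpow_mul two_pos.le,
      Real.rpow_natCast, Real.rpow_natCast, Real.rpow_intCast]
  rw [h1, norm_smul, e, mul_assoc]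
  have h2 : ‖(((2 : ℝ) ^ j) ^ n : ℂ)‖ = ((2 : ℝ) ^ j) ^ n := by simp
  rw [h2]
  gcongr
  exact norm_iteratedFDeriv_dil_le g j m x

theorem fderiv_ldil (g : 𝓢(Rn n, ℂ)) (j : ℤ) (x : Rn n) :
    fderiv ℝ (ldil j g) x = ((((2 : ℝ) ^ j) ^ n * (2 : ℝ) ^ j : ℝ)) •
      fderiv ℝ g ((2 : ℝ) ^ j • x) := by
  have h : HasFDerivAt (ldil j g) ((((2 : ℝ) ^ j) ^ n : ℝ) •
      ((fderiv ℝ g ((2 : ℝ) ^ j • x)).comp ((2 : ℝ) ^ j • ContinuousLinearMap.id ℝ (Rn n)))) x := by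
    have h1 : HasFDerivAt (fun y : Rn n => (2 : ℝ) ^ j • y)
        ((2 : ℝ) ^ j • ContinuousLinearMap.id ℝ (Rn n)) x :=
      ((2 : ℝ) ^ j • ContinuousLinearMap.id ℝ (Rn n)).hasFDerivAt
    have h2 := ((g.differentiableAt (x := (2 : ℝ) ^ j • x)).hasFDerivAt.comp x h1).const_smul
      (((2 : ℝ) ^ j) ^ n : ℝ)
    refine h2.congr_of_eventuallyEq (Eventually.of_forall fun y => ?_)
    rw [ldil_apply]
    simp
  rw [h.fderiv]
  ext v
  simp [mul_assoc]

theorem eLpNorm_fderiv_ldil {r : ℝ} (hr : 0 < r) (g : 𝓢(Rn n, ℂ)) (j : ℤ) :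
    eLpNorm (fderiv ℝ (ldil j g)) (ENNReal.ofReal r) volume
      = ENNReal.ofReal ((2 : ℝ) ^ ((j : ℝ) * (n * (1 - 1 / r) + 1))) *
        eLpNorm (fderiv ℝ g) (ENNReal.ofReal r) volume := by
  have h1 : fderiv ℝ (ldil j g) = ((((2 : ℝ) ^ j) ^ n * (2 : ℝ) ^ j : ℝ)) •
      fun x => fderiv ℝ g ((2 : ℝ) ^ j • x) := funext fun x => fderiv_ldil g j x
  have hc : Continuous (fderiv ℝ g) := (SchwartzMap.fderivCLM ℝ (Rn n) ℂ g).continuous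
  have h2 := eLpNorm_const_smul ((((2 : ℝ) ^ j) ^ n * (2 : ℝ) ^ j : ℝ))
    (fun x => fderiv ℝ g ((2 : ℝ) ^ j • x)) (ENNReal.ofReal r) (volume : Measure (Rn n))
  rw [h1]
  refine h2.trans ?_
  rw [eLpNorm_comp_two_zpow_smul hr hc, ← mul_assoc,
    Real.enorm_eq_ofReal (by positivity), ← ENNReal.ofReal_mul (by positivity)]
  congr 2
  rw [← Real.rpow_intCast, ← Real.rpow_natCast, ← Real.rpow_mul two_pos.le,
    ← Real.rpow_add two_pos, ← Real.rpow_add two_pos]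
  ring_nf

namespace LittlewoodPaley

variable (L : LittlewoodPaley n)

theorem annulusSupported_fourier_Psi : AnnulusSupported (𝓕 (L.Psi 0) : 𝓢(Rn n, ℂ)) :=
  fun _ h => L.fourier_Psi_zero_eq_zero h

/-- The Schwartz function with Fourier transform `Ψ̂₀(ξ) exp (-τ |ξ| ^ γ)`. -/
def unitHeatPiece (γ τ : ℝ) : 𝓢(Rn n, ℂ) :=
  𝓕⁻ (heatSymbol (𝓕 (L.Psi 0)) L.annulusSupported_fourier_Psi γ τ)

/-- The Schwartz function with Fourier transform `Ψ̂ⱼ(ξ) exp (-t |ξ| ^ γ)`. -/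
def heatPiece (γ t : ℝ) (j : ℤ) : 𝓢(Rn n, ℂ) := ldil j (L.unitHeatPiece γ (t * 2 ^ (γ * j)))

theorem fourier_unitHeatPiece (γ τ : ℝ) (ξ : Rn n) :
    𝓕 (L.unitHeatPiece γ τ) ξ = Real.exp (-τ * ‖ξ‖ ^ γ) * 𝓕 (L.Psi 0) ξ := by
  have : 𝓕 (L.unitHeatPiece γ τ) = heatSymbol (𝓕 (L.Psi 0)) L.annulusSupported_fourier_Psi γ τ :=
    FourierTransform.fourier_fourierInv_eq _
  rw [this, heatSymbol_apply]

theorem fourier_heatPiece (γ t : ℝ) (j : ℤ) (ξ : Rn n) :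
    𝓕 (L.heatPiece γ t j) ξ = Real.exp (-t * ‖ξ‖ ^ γ) * 𝓕 (L.Psi j) ξ := by
  rw [heatPiece, fourier_ldil, fourier_unitHeatPiece, ← fourier_Psi_eq_dil, norm_two_zpow_smul]
  congr 3
  rw [Real.mul_rpow (by positivity) (norm_nonneg _), ← Real.rpow_intCast,
    ← Real.rpow_mul two_pos.le, neg_mul, neg_mul, neg_inj, mul_assoc, ← mul_assoc ((2 : ℝ) ^ _),
    ← Real.rpow_add two_pos]
  push_cast
  ring_nf
  simp

theorem exists_eLpNorm_heatPiece_le {r : ℝ} (hr : 1 ≤ r) (γ : ℝ) (M : ℕ) : ∃ C : ℝ, 0 ≤ C ∧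
    ∀ t : ℝ, 0 ≤ t → ∀ j : ℤ, eLpNorm (L.heatPiece γ t j) (ENNReal.ofReal r) volume
      ≤ ENNReal.ofReal (C * dyadicTerm (n * (1 - 1 / r)) γ t M j) := by
  obtain ⟨C, hC0, hC⟩ := exists_eLpNorm_heatSymbol_le
    (FourierTransform.fourierInvCLM ℂ 𝓢(Rn n, ℂ)) hr _ L.annulusSupported_fourier_Psi γ M
  refine ⟨C, hC0, fun t ht j => ?_⟩
  rw [heatPiece, eLpNorm_ldil (by linarith)]
  refine (mul_le_mul_right (hC (t * 2 ^ (γ * j)) (by positivity)) _).trans_eq ?_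
  rw [← ENNReal.ofReal_mul (by positivity), dyadicTerm]
  ring_nf

theorem exists_eLpNorm_fderiv_heatPiece_le {r : ℝ} (hr : 1 ≤ r) (γ : ℝ) (M : ℕ) : ∃ C : ℝ, 0 ≤ C ∧
    ∀ t : ℝ, 0 ≤ t → ∀ j : ℤ, eLpNorm (fderiv ℝ (L.heatPiece γ t j)) (ENNReal.ofReal r) volume
      ≤ ENNReal.ofReal (C * dyadicTerm (n * (1 - 1 / r) + 1) γ t M j) := by
  obtain ⟨C, hC0, hC⟩ := exists_eLpNorm_heatSymbol_le
    ((SchwartzMap.fderivCLM ℂ (Rn n) ℂ).comp (FourierTransform.fourierInvCLM ℂ 𝓢(Rn n, ℂ))) hr _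
    L.annulusSupported_fourier_Psi γ M
  refine ⟨C, hC0, fun t ht j => ?_⟩
  rw [heatPiece, eLpNorm_fderiv_ldil (by linarith)]
  refine (mul_le_mul_right (hC (t * 2 ^ (γ * j)) (by positivity)) _).trans_eq ?_
  rw [← ENNReal.ofReal_mul (by positivity), dyadicTerm]
  ring_nf

theorem exists_norm_iteratedFDeriv_heatPiece_le (γ : ℝ) (m M : ℕ) : ∃ C : ℝ, 0 ≤ C ∧
    ∀ t : ℝ, 0 ≤ t → ∀ (j : ℤ) (x : Rn n), ‖iteratedFDeriv ℝ m (L.heatPiece γ t j) x‖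
      ≤ C * dyadicTerm (n + m) γ t M j := by
  set A := FourierTransform.fourierInvCLM ℂ 𝓢(Rn n, ℂ) (F := 𝓢(Rn n, ℂ)) with hA
  have hq : Continuous ((SchwartzMap.seminorm ℂ 0 m).comp A.toLinearMap) :=
    ((schwartz_withSeminorms ℂ (Rn n) ℂ).continuous_seminorm (0, m)).comp A.continuous
  obtain ⟨C, hC0, hC⟩ := exists_continuous_seminorm_heatSymbol_le _
    L.annulusSupported_fourier_Psi γ hq M
  refine ⟨C, hC0, fun t ht j x => ?_⟩
  refine (norm_iteratedFDeriv_ldil_le _ j m x).trans ?_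
  have h1 := (SchwartzMap.norm_iteratedFDeriv_le_seminorm ℂ
    (L.unitHeatPiece γ (t * 2 ^ (γ * j))) m ((2 : ℝ) ^ j • x)).trans
    (hC (t * 2 ^ (γ * j)) (by positivity))
  refine (mul_le_mul_of_nonneg_left h1 (by positivity)).trans_eq ?_
  rw [dyadicTerm]
  ring

theorem exists_integral_norm_fourier_heatPiece_le (γ : ℝ) (M : ℕ) : ∃ C : ℝ, 0 ≤ C ∧
    ∀ t : ℝ, 0 ≤ t → ∀ j : ℤ, ∫ ξ, ‖𝓕 (L.heatPiece γ t j) ξ‖ ≤ C * dyadicTerm n γ t M j := by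
  obtain ⟨C, hC0, hC⟩ := exists_eLpNorm_heatSymbol_le
    (ContinuousLinearMap.id ℂ 𝓢(Rn n, ℂ)) le_rfl _ L.annulusSupported_fourier_Psi γ M
  refine ⟨C, hC0, fun t ht j => ?_⟩
  set H := heatSymbol (𝓕 (L.Psi 0)) L.annulusSupported_fourier_Psi γ (t * 2 ^ (γ * j)) with hH
  have e : ⇑(𝓕 (L.heatPiece γ t j) : 𝓢(Rn n, ℂ)) = fun ξ => H ((2 : ℝ) ^ (-j) • ξ) := by
    funext ξ
    have : 𝓕 (L.unitHeatPiece γ (t * 2 ^ (γ * j))) = H := FourierTransform.fourier_fourierInv_eq _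
    rw [heatPiece, fourier_ldil, this]
  rw [integral_norm_eq_lintegral_enorm
    (𝓕 (L.heatPiece γ t j) : 𝓢(Rn n, ℂ)).continuous.aestronglyMeasurable,
    ← eLpNorm_one_eq_lintegral_enorm, ← ENNReal.ofReal_one]
  refine ENNReal.toReal_le_of_le_ofReal (mul_nonneg hC0 (dyadicTerm_nonneg ht j)) ?_
  rw [e, eLpNorm_comp_two_zpow_smul one_pos H.continuous]
  refine (mul_le_mul_right (hC (t * 2 ^ (γ * j)) (by positivity)) _).trans_eq ?_
  rw [← ENNReal.ofReal_mul (by positivity), dyadicTerm]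
  congr 1
  push_cast
  ring_nf

/-! ### The heat kernel as the sum of its pieces -/

theorem exists_dyadic_exponent {γ : ℝ} (hγ : 0 < γ) (a : ℝ) : ∃ M : ℕ, a < γ * M := by
  obtain ⟨M, hM⟩ := exists_nat_gt (a / γ)
  exact ⟨M, by rwa [div_lt_iff₀' hγ] at hM⟩

theorem heatPiece_apply (γ t : ℝ) (j : ℤ) (x : Rn n) : L.heatPiece γ t j x =
    ∫ ξ, Complex.exp (↑(2 * Real.pi * inner ℝ ξ x) * Complex.I) • 𝓕 (L.heatPiece γ t j) ξ := by
  have h : 𝓕⁻ (𝓕 (L.heatPiece γ t j)) = L.heatPiece γ t j := FourierTransform.fourierInv_fourier_eq _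
  rw [← Real.fourierInv_eq', ← SchwartzMap.fourierInv_coe, h]

/-- The `L¹` norms of the Fourier transforms of the pieces are summable, so the sum can be taken
under the inverse Fourier integral. -/
theorem hasSum_heatPiece (hn : 1 ≤ n) {β t : ℝ} (hβ : 0 < β) (ht : 0 < t) (x : Rn n) :
    HasSum (fun j => L.heatPiece (2 * β) t j x) (fracKernel n β t x) := by
  have : Nonempty (Fin n) := ⟨⟨0, hn⟩⟩
  have hγ : 0 < 2 * β := by positivity
  obtain ⟨M, hM⟩ := exists_dyadic_exponent hγ n
  obtain ⟨C, hC0, hC⟩ := L.exists_integral_norm_fourier_heatPiece_le (2 * β) M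
  have hnorm : ∀ (j : ℤ) (ξ : Rn n),
      ‖Complex.exp (↑(2 * Real.pi * inner ℝ ξ x) * Complex.I) • 𝓕 (L.heatPiece (2 * β) t j) ξ‖
        = ‖𝓕 (L.heatPiece (2 * β) t j) ξ‖ := fun j ξ => by
    rw [norm_smul, Complex.norm_exp_ofReal_mul_I, one_mul]
  have hint : ∀ j : ℤ, Integrable fun ξ : Rn n =>
      Complex.exp (↑(2 * Real.pi * inner ℝ ξ x) * Complex.I) • 𝓕 (L.heatPiece (2 * β) t j) ξ := by
    intro j
    refine ((𝓕 (L.heatPiece (2 * β) t j)).integrable (μ := volume)).mono ?_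
      (Eventually.of_forall fun ξ => (hnorm j ξ).le)
    exact Continuous.aestronglyMeasurable (by
      have := (𝓕 (L.heatPiece (2 * β) t j)).continuous
      fun_prop)
  have hs := hasSum_integral_of_summable_integral_norm hint (by
    simp only [hnorm]
    refine Summable.of_nonneg_of_le (fun j => by positivity) (hC t ht.le)
      ((summable_dyadicTerm (by exact_mod_cast hn) hM ht).mul_left C))
  have e : ∫ ξ : Rn n, ∑' j, Complex.exp (↑(2 * Real.pi * inner ℝ ξ x) * Complex.I) •
      𝓕 (L.heatPiece (2 * β) t j) ξ = fracKernel n β t x := by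
    rw [fracKernel, Real.fourierInv_eq']
    refine integral_congr_ae ?_
    -- The partition of unity fails only at the origin, a null set since `n ≥ 1`.
    filter_upwards [compl_mem_ae_iff.2 (measure_singleton (0 : Rn n))] with ξ hξ
    have h1 := (((L.hasSum_fourier_Psi hξ).mul_left
      (Real.exp (-t * ‖ξ‖ ^ (2 * β)) : ℂ)).mul_left
        (Complex.exp (↑(2 * Real.pi * inner ℝ ξ x) * Complex.I))).tsum_eq
    simp only [L.fourier_heatPiece, smul_eq_mul]
    rw [h1, mul_one]
  rw [e] at hs
  simpa only [← L.heatPiece_apply] using hs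

theorem fracKernel_eq_tsum (hn : 1 ≤ n) {β t : ℝ} (hβ : 0 < β) (ht : 0 < t) :
    fracKernel n β t = fun x => ∑' j, L.heatPiece (2 * β) t j x :=
  funext fun x => (L.hasSum_heatPiece hn hβ ht x).tsum_eq.symm

theorem contDiff_fracKernel (L : LittlewoodPaley n) (hn : 1 ≤ n) {β t : ℝ} (hβ : 0 < β) (ht : 0 < t) :
    ContDiff ℝ ∞ (fracKernel n β t) := by
  choose M hM using fun m : ℕ => exists_dyadic_exponent (by positivity : 0 < 2 * β) (n + m)
  choose C hC0 hC using fun m : ℕ =>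
    L.exists_norm_iteratedFDeriv_heatPiece_le (2 * β) m (M m)
  rw [L.fracKernel_eq_tsum hn hβ ht]
  refine contDiff_tsum (N := ⊤) (v := fun m j => C m * dyadicTerm (n + m) (2 * β) t (M m) j)
    (fun j => (L.heatPiece (2 * β) t j).smooth') (fun m _ => ?_) fun m j x _ => hC m t ht.le j x
  have hn' : (0 : ℝ) < n := by exact_mod_cast hn
  exact (summable_dyadicTerm (by positivity) (hM m) ht).mul_left _

theorem hasSum_fderiv_heatPiece (hn : 1 ≤ n) {β t : ℝ} (hβ : 0 < β) (ht : 0 < t) (x : Rn n) :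
    HasSum (fun j => fderiv ℝ (L.heatPiece (2 * β) t j) x) (fderiv ℝ (fracKernel n β t) x) := by
  have hn' : (0 : ℝ) < n := by exact_mod_cast hn
  obtain ⟨M, hM⟩ := exists_dyadic_exponent (by positivity : 0 < 2 * β) (n + 1)
  obtain ⟨C, hC0, hC⟩ := L.exists_norm_iteratedFDeriv_heatPiece_le (2 * β) 1 M
  have hle : ∀ (j : ℤ) (x : Rn n), ‖fderiv ℝ (L.heatPiece (2 * β) t j) x‖
      ≤ C * dyadicTerm (n + 1) (2 * β) t M j := fun j x => by
    have := hC t ht.le j x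
    rwa [norm_iteratedFDeriv_one, Nat.cast_one] at this
  have hs : Summable fun j => C * dyadicTerm (n + 1) (2 * β) t M j :=
    (summable_dyadicTerm (by positivity) hM ht).mul_left _
  rw [L.fracKernel_eq_tsum hn hβ ht, fderiv_tsum_apply hs
    (fun j => (L.heatPiece (2 * β) t j).differentiable) hle (L.hasSum_heatPiece hn hβ ht x).summable]
  exact (Summable.of_norm_bounded hs fun j => hle j x).hasSum

/-- The condition `r > 1` makes the exponent `n (1 - 1/r)` positive; at `r = 1` the bounds on the
low-frequency pieces would not decay. -/
theorem summable_eLpNorm_heatPiece (hn : 1 ≤ n) {β t r : ℝ} (hβ : 0 < β) (ht : 0 < t) (hr : 1 < r) :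
    Summable fun j => (eLpNorm (L.heatPiece (2 * β) t j) (ENNReal.ofReal r) volume).toReal := by
  have hn' : (0 : ℝ) < n := by exact_mod_cast hn
  have hr' : 0 < 1 - 1 / r := by rw [sub_pos, div_lt_one (by linarith)]; exact hr
  obtain ⟨M, hM⟩ := exists_dyadic_exponent (by positivity : 0 < 2 * β) (n * (1 - 1 / r))
  obtain ⟨C, hC0, hC⟩ := L.exists_eLpNorm_heatPiece_le hr.le (2 * β) M
  refine Summable.of_nonneg_of_le (fun j => ENNReal.toReal_nonneg) (fun j => ?_)
    ((summable_dyadicTerm (by positivity) hM ht).mul_left C)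
  exact ENNReal.toReal_le_of_le_ofReal (mul_nonneg hC0 (dyadicTerm_nonneg ht.le j)) (hC t ht.le j)

theorem memLp_fracKernel (L : LittlewoodPaley n) (hn : 1 ≤ n) {β t r : ℝ} (hβ : 0 < β) (ht : 0 < t) (hr : 1 < r) :
    MemLp (fracKernel n β t) (ENNReal.ofReal r) volume := by
  refine ⟨(L.contDiff_fracKernel hn hβ ht).continuous.aestronglyMeasurable, ?_⟩
  have hr1 : 1 ≤ ENNReal.ofReal r := by simpa using ENNReal.ofReal_le_ofReal hr.le
  refine (eLpNorm_tsum_le hr1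
    (fun j => (L.heatPiece (2 * β) t j).continuous.aestronglyMeasurable)
    (L.hasSum_heatPiece hn hβ ht)).trans_lt ?_
  have h := (L.summable_eLpNorm_heatPiece hn hβ ht hr).tsum_ofReal_lt_top
  refine lt_of_eq_of_lt (tsum_congr fun j => ?_) h
  rw [ENNReal.ofReal_toReal ((L.heatPiece (2 * β) t j).eLpNorm_lt_top _ volume).ne]

theorem memLp_fderiv_fracKernel (L : LittlewoodPaley n) (hn : 1 ≤ n) {β t r : ℝ} (hβ : 0 < β) (ht : 0 < t) (hr : 1 < r) :
    MemLp (fderiv ℝ (fracKernel n β t)) (ENNReal.ofReal r) volume := by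
  refine ⟨((L.contDiff_fracKernel hn hβ ht).continuous_fderiv (by simp)).aestronglyMeasurable, ?_⟩
  have hr1 : 1 ≤ ENNReal.ofReal r := by simpa using ENNReal.ofReal_le_ofReal hr.le
  refine (eLpNorm_tsum_le hr1 (fun j => (SchwartzMap.fderivCLM ℝ (Rn n) ℂ
    (L.heatPiece (2 * β) t j)).continuous.aestronglyMeasurable)
    (L.hasSum_fderiv_heatPiece hn hβ ht)).trans_lt ?_
  have hn' : (0 : ℝ) < n := by exact_mod_cast hn
  have hr' : 0 < 1 - 1 / r := by rw [sub_pos, div_lt_one (by linarith)]; exact hr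
  obtain ⟨M, hM⟩ := exists_dyadic_exponent (by positivity : 0 < 2 * β) (n * (1 - 1 / r) + 1)
  obtain ⟨C, hC0, hC⟩ := L.exists_eLpNorm_fderiv_heatPiece_le hr.le (2 * β) M
  refine (ENNReal.tsum_le_tsum (hC t ht.le)).trans_lt ?_
  exact ((summable_dyadicTerm (by positivity) hM ht).mul_left C).tsum_ofReal_lt_top

end LittlewoodPaley

end QBesov

namespace QBesov

/-! ### Functionals with dyadically bounded blocks -/

variable {n : ℕ}

/-- The sum of the `L^q` norms of a function and of its derivative. -/
def sobolevNorm (q : ℝ) (φ : Rn n → ℂ) : ℝ :=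
  (eLpNorm φ (ENNReal.ofReal q) volume).toReal +
    (eLpNorm (fderiv ℝ φ) (ENNReal.ofReal q) volume).toReal

theorem sobolevNorm_nonneg (q : ℝ) (φ : Rn n → ℂ) : 0 ≤ sobolevNorm q φ :=
  add_nonneg ENNReal.toReal_nonneg ENNReal.toReal_nonneg

theorem exists_sobolevNorm_le {q : ℝ} (hq : 1 ≤ q) : ∃ (s : Finset (ℕ × ℕ)) (C : ℝ), 0 ≤ C ∧
    ∀ φ : 𝓢(Rn n, ℂ), sobolevNorm q φ ≤ C * s.sup (schwartzSeminormFamily ℂ (Rn n) ℂ) φ := by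
  have : Fact (1 ≤ ENNReal.ofReal q) := ⟨by simpa using ENNReal.ofReal_le_ofReal hq⟩
  set A : 𝓢(Rn n, ℂ) →L[ℂ] Lp ℂ (ENNReal.ofReal q) (volume : Measure (Rn n)) :=
    SchwartzMap.toLpCLM ℂ ℂ (ENNReal.ofReal q) volume with hA
  set B : 𝓢(Rn n, ℂ) →L[ℂ] Lp (Rn n →L[ℝ] ℂ) (ENNReal.ofReal q) (volume : Measure (Rn n)) :=
    (SchwartzMap.toLpCLM ℂ (Rn n →L[ℝ] ℂ) (ENNReal.ofReal q) volume).comp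
      (SchwartzMap.fderivCLM ℂ (Rn n) ℂ) with hB
  have hc : Continuous ((normSeminorm ℂ _).comp A.toLinearMap +
      (normSeminorm ℂ _).comp B.toLinearMap) :=
    (continuous_norm.comp A.continuous).add (continuous_norm.comp B.continuous)
  obtain ⟨s, C, -, hC⟩ := Seminorm.bound_of_continuous (schwartz_withSeminorms ℂ (Rn n) ℂ) _ hc
  refine ⟨s, C, C.2, fun φ => ?_⟩
  have h : ‖A φ‖ + ‖B φ‖ ≤ C * s.sup (schwartzSeminormFamily ℂ (Rn n) ℂ) φ := hC φ
  rw [hA, hB, ContinuousLinearMap.comp_apply, SchwartzMap.toLpCLM_apply, SchwartzMap.toLpCLM_apply,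
    SchwartzMap.norm_toLp, SchwartzMap.norm_toLp] at h
  exact h

/-- The weight `min (2 ^ (j σ)) (2 ^ (j (σ - 1)))`. -/
def blockWeight (σ : ℝ) (j : ℤ) : ℝ :=
  min ((2 : ℝ) ^ ((j : ℝ) * σ)) ((2 : ℝ) ^ ((j : ℝ) * (σ - 1)))

theorem blockWeight_nonneg (σ : ℝ) (j : ℤ) : 0 ≤ blockWeight σ j := by
  unfold blockWeight; positivity

theorem summable_blockWeight {σ : ℝ} (h0 : 0 < σ) (h1 : σ < 1) : Summable (blockWeight σ) := by
  have hε : 0 < min σ (1 - σ) := lt_min h0 (by linarith)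
  refine Summable.of_nonneg_of_le (blockWeight_nonneg σ) (fun j => ?_)
    (summable_two_rpow_neg_natAbs hε)
  rcases le_total 0 j with hj | hj
  · have hj' : (0 : ℝ) ≤ j := mod_cast hj
    refine (min_le_right _ _).trans (Real.rpow_le_rpow_of_exponent_le one_le_two ?_)
    rw [abs_of_nonneg hj']
    nlinarith [min_le_right σ (1 - σ)]
  · have hj' : (j : ℝ) ≤ 0 := mod_cast hj
    refine (min_le_left _ _).trans (Real.rpow_le_rpow_of_exponent_le one_le_two ?_)
    rw [abs_of_nonpos hj']
    nlinarith [min_le_left σ (1 - σ)]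

namespace LittlewoodPaley

/-- The blocks of `f` satisfy `‖Δⱼ f‖_p ≤ M 2 ^ (j σ)`. -/
structure BlockBound (L : LittlewoodPaley n) (σ p M : ℝ) (f : S0Dual n) : Prop where
  memLp : ∀ j, MemLp (L.block j f) (ENNReal.ofReal p) volume
  le : ∀ j : ℤ, (eLpNorm (L.block j f) (ENNReal.ofReal p) volume).toReal
    ≤ M * (2 : ℝ) ^ ((j : ℝ) * σ)

variable {L : LittlewoodPaley n} {σ p q M : ℝ} {f : S0Dual n}

theorem BlockBound.nonneg (hf : L.BlockBound σ p M f) : 0 ≤ M := by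
  simpa using ENNReal.toReal_nonneg.trans (hf.le 0)

/-- Hölder gives the weight `2^(jσ)` with constant `1`; the gradient estimate gives `2^(j(σ-1))`
with constant `C`. The smaller one is kept. -/
theorem exists_norm_integral_block_le_weight (L : LittlewoodPaley n) (hpq : p.HolderConjugate q)
    (σ : ℝ) : ∃ C : ℝ, 0 ≤ C ∧ ∀ (f : S0Dual n) (M : ℝ), L.BlockBound σ p M f →
      ∀ (j : ℤ) (φ : 𝓢(Rn n, ℂ)), ‖∫ x, L.block j f x * φ x‖
        ≤ C * M * blockWeight σ j * sobolevNorm q φ := by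
  obtain ⟨C, hC0, hC⟩ := L.exists_norm_integral_block_le hpq
  refine ⟨max 1 C, by positivity, fun f M hf j φ => ?_⟩
  have hM := hf.nonneg
  have h1 := norm_integral_mul_le hpq (hf.memLp j) (φ.memLp (ENNReal.ofReal q) volume)
  have h2 := hC f j φ (hf.memLp j)
  have hj := hf.le j
  have hw := blockWeight_nonneg σ j
  have hN := sobolevNorm_nonneg q φ
  unfold sobolevNorm at hN ⊢
  set A := (eLpNorm φ (ENNReal.ofReal q) volume).toReal
  set B := (eLpNorm (fderiv ℝ φ) (ENNReal.ofReal q) volume).toReal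
  have hA0 : 0 ≤ A := ENNReal.toReal_nonneg
  have hB0 : 0 ≤ B := ENNReal.toReal_nonneg
  rcases le_total ((2 : ℝ) ^ ((j : ℝ) * σ)) ((2 : ℝ) ^ ((j : ℝ) * (σ - 1))) with h | h
  · rw [blockWeight, min_eq_left h]
    calc _ ≤ (M * (2 : ℝ) ^ ((j : ℝ) * σ)) * A := h1.trans (by gcongr)
      _ = 1 * M * (2 : ℝ) ^ ((j : ℝ) * σ) * A := by ring
      _ ≤ _ := by
        gcongr
        · exact le_max_left _ _
        · linarith
  · rw [blockWeight, min_eq_right h]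
    have e : (2 : ℝ) ^ ((j : ℝ) * (σ - 1)) = (2 : ℝ) ^ (-j) * (2 : ℝ) ^ ((j : ℝ) * σ) := by
      rw [← Real.rpow_intCast, ← Real.rpow_add two_pos]
      congr 1
      push_cast
      ring
    calc _ ≤ C * (2 : ℝ) ^ (-j) * (M * (2 : ℝ) ^ ((j : ℝ) * σ)) * B := h2.trans (by gcongr)
      _ = C * M * (2 : ℝ) ^ ((j : ℝ) * (σ - 1)) * B := by rw [e]; ring
      _ ≤ _ := by
        gcongr
        · exact le_max_right _ _
        · linarith

theorem BlockBound.summable_apply_toS0 (hpq : p.HolderConjugate q) (h0 : 0 < σ) (h1 : σ < 1)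
    (hf : L.BlockBound σ p M f) (φ : 𝓢(Rn n, ℂ)) : Summable fun j => f (L.toS0 j φ) := by
  obtain ⟨C, hC0, hC⟩ := L.exists_norm_integral_block_le_weight hpq σ
  refine Summable.of_norm_bounded
    (((summable_blockWeight h0 h1).mul_left (C * M)).mul_right (sobolevNorm q φ)) fun j => ?_
  rw [L.apply_toS0]
  exact hC f M hf j φ

/-- The block weights are summable exactly because `0 < σ` controls low and `σ < 1` high
frequencies. The series therefore defines a tempered distribution, with no polynomial ambiguity
left. -/
theorem BlockBound.exists_clm (hpq : p.HolderConjugate q) (h0 : 0 < σ) (h1 : σ < 1)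
    (hf : L.BlockBound σ p M f) :
    ∃ T : 𝓢(Rn n, ℂ) →L[ℂ] ℂ, ∀ φ, T φ = ∑' j, f (L.toS0 j φ) := by
  obtain ⟨C, hC0, hC⟩ := L.exists_norm_integral_block_le_weight hpq σ
  obtain ⟨s, D, hD0, hD⟩ := exists_sobolevNorm_le (n := n) hpq.symm.lt.le
  have hs := hf.summable_apply_toS0 hpq h0 h1
  have hM := hf.nonneg
  have hW : 0 ≤ ∑' j, blockWeight σ j := tsum_nonneg (blockWeight_nonneg σ)
  refine ⟨SchwartzMap.mkCLMtoNormedSpace (σ := RingHom.id ℂ) (fun φ => ∑' j, f (L.toS0 j φ))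
    (fun φ ψ => ?_) (fun a φ => ?_) ⟨s, C * M * (∑' j, blockWeight σ j) * D, by positivity,
      fun φ => ?_⟩, fun φ => rfl⟩
  · simp only [map_add]
    exact (hs φ).tsum_add (hs ψ)
  · simp only [map_smul, smul_eq_mul, RingHom.id_apply]
    exact tsum_mul_left
  · have hb : ∀ j, ‖f (L.toS0 j φ)‖ ≤ C * M * blockWeight σ j * sobolevNorm q φ := fun j => by
      rw [L.apply_toS0]
      exact hC f M hf j φ
    have hsum := ((summable_blockWeight h0 h1).mul_left (C * M)).mul_right (sobolevNorm q φ)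
    have h2 := tsum_of_norm_bounded hsum.hasSum hb
    rw [tsum_mul_right, tsum_mul_left] at h2
    refine h2.trans ?_
    calc _ ≤ C * M * (∑' j, blockWeight σ j) *
          (D * s.sup (schwartzSeminormFamily ℂ (Rn n) ℂ) φ) := by
          gcongr
          exact hD φ
      _ = _ := by ring

/-! ### Pairing with smooth functions -/

/-- By the product rule, only the uniform bounds on `η` and its first derivative enter. Uniformity
in `k` provides the dominating series in `BlockBound.hasPairing`. -/
theorem IsUnitSequence.exists_sobolevNorm_mul_le {η : ℕ → Rn n → ℂ} (hη : IsUnitSequence η)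
    (hq : 1 ≤ q) {ψ : Rn n → ℂ} (hψ : ContDiff ℝ ∞ ψ)
    (hψ0 : MemLp ψ (ENNReal.ofReal q) volume)
    (hψ1 : MemLp (fderiv ℝ ψ) (ENNReal.ofReal q) volume) :
    ∃ C : ℝ, ∀ k, sobolevNorm q (fun x => η k x * ψ x) ≤ C := by
  have hq1 : 1 ≤ ENNReal.ofReal q := by simpa using ENNReal.ofReal_le_ofReal hq
  obtain ⟨C0, hC0⟩ := hη.bounded 0
  obtain ⟨C1, hC1⟩ := hη.bounded 1
  simp only [norm_iteratedFDeriv_zero] at hC0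
  simp only [norm_iteratedFDeriv_one] at hC1
  set A := eLpNorm ψ (ENNReal.ofReal q) volume with hA
  set B := eLpNorm (fderiv ℝ ψ) (ENNReal.ofReal q) volume with hB
  have hAt : A ≠ ⊤ := hψ0.2.ne
  have hBt : B ≠ ⊤ := hψ1.2.ne
  refine ⟨(ENNReal.ofReal C0 * A).toReal + (ENNReal.ofReal C0 * B + ENNReal.ofReal C1 * A).toReal,
    fun k => add_le_add (ENNReal.toReal_mono (by finiteness) ?_)
      (ENNReal.toReal_mono (by finiteness) ?_)⟩
  · refine eLpNorm_le_mul_eLpNorm_of_ae_le_mul (Eventually.of_forall fun x => ?_) _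
    rw [norm_mul]
    gcongr
    exact hC0 k x
  · have hηd : ContDiff ℝ ∞ (η k) := hη.smooth k
    have e : fderiv ℝ (fun x => η k x * ψ x)
        = (fun x => η k x • fderiv ℝ ψ x) + fun x => ψ x • fderiv ℝ (η k) x := by
      funext x
      exact fderiv_fun_mul ((hηd.differentiable (by simp)) x) ((hψ.differentiable (by simp)) x)
    have m1 : Continuous fun x => η k x • fderiv ℝ ψ x :=
      hηd.continuous.smul (hψ.continuous_fderiv (by simp))
    have m2 : Continuous fun x => ψ x • fderiv ℝ (η k) x :=
      hψ.continuous.smul (hηd.continuous_fderiv (by simp))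
    rw [e]
    refine (eLpNorm_add_le m1.aestronglyMeasurable m2.aestronglyMeasurable hq1).trans ?_
    refine add_le_add
      (eLpNorm_le_mul_eLpNorm_of_ae_le_mul (Eventually.of_forall fun x => ?_) _)
      (eLpNorm_le_mul_eLpNorm_of_ae_le_mul (Eventually.of_forall fun x => ?_) _)
    · rw [norm_smul]
      gcongr
      exact hC0 k x
    · rw [norm_smul, mul_comm]
      gcongr
      exact hC1 k x

/-- Dominated convergence is used twice: in the integral for each fixed `j`, and in the sum over
`j`, where the block weights times a uniform Sobolev bound dominate. -/
theorem BlockBound.hasPairing (hpq : p.HolderConjugate q) (h0 : 0 < σ) (h1 : σ < 1)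
    (hf : L.BlockBound σ p M f) {T : 𝓢'(Rn n, ℂ)} (hT : ∀ φ, T φ = ∑' j, f (L.toS0 j φ))
    {ψ : Rn n → ℂ} (hψ : ContDiff ℝ ∞ ψ) (hψ0 : MemLp ψ (ENNReal.ofReal q) volume)
    (hψ1 : MemLp (fderiv ℝ ψ) (ENNReal.ofReal q) volume) :
    HasPairing T ψ (∑' j, ∫ y, L.block j f y * ψ y) := by
  refine ⟨hψ, fun η hη => ?_⟩
  obtain ⟨C, hC0, hC⟩ := L.exists_norm_integral_block_le_weight hpq σ
  obtain ⟨D, hD⟩ := IsUnitSequence.exists_sobolevNorm_mul_le hη hpq.symm.lt.le hψ hψ0 hψ1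
  obtain ⟨C0, hC0'⟩ := hη.bounded 0
  simp only [norm_iteratedFDeriv_zero] at hC0'
  have hM := hf.nonneg
  simp only [hT, L.apply_toS0]
  refine tendsto_tsum_of_dominated_convergence
    (((summable_blockWeight h0 h1).mul_left (C * M)).mul_right D) (fun j => ?_)
    (Eventually.of_forall fun k j => ?_)
  · have hint := integrable_mul_of_memLp hpq (hf.memLp j) hψ0
    refine tendsto_integral_of_dominated_convergence (fun x => C0 * ‖L.block j f x * ψ x‖)
      (fun k => ?_) (hint.norm.const_mul C0) (fun k => Eventually.of_forall fun x => ?_)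
      (Eventually.of_forall fun x => ?_)
    · exact ((L.continuous_block f j).mul
        ((hη.smooth k).continuous.mul hψ.continuous)).aestronglyMeasurable
    · change ‖L.block j f x * (η k x * ψ x)‖ ≤ _
      rw [mul_left_comm, norm_mul]
      gcongr
      exact hC0' k x
    · change Tendsto (fun k => L.block j f x * (η k x * ψ x)) atTop _
      refine tendsto_const_nhds.congr' ?_
      filter_upwards [hη.eventually_one ‖x‖] with k hk
      rw [hk x le_rfl, one_mul]
  · refine (hC f M hf j _).trans ?_
    have := blockWeight_nonneg σ j
    gcongr
    exact hD k

end LittlewoodPaley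

/-- On spaces of exponent `q = ∞`, membership is a bound on the blocks. -/
theorem Besov.blockBound {L : LittlewoodPaley n} {s p : ℝ} {f : S0Dual n}
    (hf : f ∈ Besov L s (ENNReal.ofReal p) ⊤) :
    L.BlockBound (-s) p (besovNorm L s (ENNReal.ofReal p) ⊤ f).toReal f := by
  refine ⟨hf.1, fun j => ?_⟩
  have h1 : besovTerm L s (ENNReal.ofReal p) f j ≤ besovNorm L s (ENNReal.ofReal p) ⊤ f := by
    rw [besovNorm, if_pos rfl]
    exact le_iSup (besovTerm L s (ENNReal.ofReal p) f) j
  have h2 := ENNReal.toReal_mono hf.2.ne h1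
  rw [besovTerm, ENNReal.toReal_mul, ENNReal.toReal_ofReal (by positivity)] at h2
  rw [mul_neg, Real.rpow_neg two_pos.le, ← div_eq_mul_inv, le_div_iff₀ (by positivity), mul_comm]
  exact h2

/-- The realization of the elements of a Besov space as tempered distributions. -/
theorem exists_realization (L : LittlewoodPaley n) {s p q : ℝ} (hpq : p.HolderConjugate q)
    (h0 : -1 < s) (h1 : s < 0) : ∃ J : Besov L s (ENNReal.ofReal p) ⊤ →ₗ[ℂ] 𝓢'(Rn n, ℂ),
      ∀ f φ, J f φ = ∑' j, (f : S0Dual n) (L.toS0 j φ) := by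
  choose T hT using fun f : Besov L s (ENNReal.ofReal p) ⊤ =>
    (Besov.blockBound f.2).exists_clm hpq (by linarith) (by linarith)
  have hs : ∀ (f : Besov L s (ENNReal.ofReal p) ⊤) (φ : 𝓢(Rn n, ℂ)),
      Summable fun j => (f : S0Dual n) (L.toS0 j φ) := fun f =>
    (Besov.blockBound f.2).summable_apply_toS0 hpq (by linarith) (by linarith)
  have hadd : ∀ f g, T (f + g) = T f + T g := fun f g => by
    ext φ
    rw [_root_.add_apply, hT, hT, hT]
    exact (hs f φ).tsum_add (hs g φ)
  have hsmul : ∀ (c : ℂ) f, T (c • f) = c • T f := fun c f => by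
    ext φ
    rw [_root_.smul_apply, hT, hT]
    exact tsum_mul_left
  let T' : Besov L s (ENNReal.ofReal p) ⊤ →ₗ[ℂ] (𝓢(Rn n, ℂ) →L[ℂ] ℂ) :=
    { toFun := T, map_add' := hadd, map_smul' := hsmul }
  exact ⟨(ContinuousLinearMap.toPointwiseConvergenceCLM ℂ (RingHom.id ℂ) 𝓢(Rn n, ℂ)
    ℂ).toLinearMap ∘ₗ T', hT⟩

end QBesov

namespace QBesov

/-! ### The heat extension -/

variable {n : ℕ}

namespace LittlewoodPaley

/-- The heat extension of `f`, as the sum of the heat extensions of its blocks. -/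
def heatExt (L : LittlewoodPaley n) (β : ℝ) (f : S0Dual n) (t : ℝ) (x : Rn n) : ℂ :=
  ∑' j, ∫ y, L.block j f y * fracKernel n β t (x - y)

variable {L : LittlewoodPaley n} {σ p q M β t : ℝ} {f : S0Dual n}

theorem norm_fderiv_comp_sub {ψ : Rn n → ℂ} (hψ : ContDiff ℝ ∞ ψ) (x y : Rn n) :
    ‖fderiv ℝ (fun y => ψ (x - y)) y‖ = ‖fderiv ℝ ψ (x - y)‖ := by
  have h := ((hψ.differentiable (by simp)) (x - y)).hasFDerivAt.comp y
    ((hasFDerivAt_id y).const_sub x)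
  have h2 : fderiv ℝ (fun y => ψ (x - y)) y = -fderiv ℝ ψ (x - y) := by
    refine HasFDerivAt.fderiv (h.congr_fderiv ?_)
    ext v
    simp
  rw [h2, norm_neg]

theorem BlockBound.isSemigroupOf (hn : 1 ≤ n) (hβ : 0 < β) (hpq : p.HolderConjugate q)
    (h0 : 0 < σ) (h1 : σ < 1) (hf : L.BlockBound σ p M f) {T : 𝓢'(Rn n, ℂ)}
    (hT : ∀ φ, T φ = ∑' j, f (L.toS0 j φ)) : IsSemigroupOf β T (L.heatExt β f) := by
  intro t ht x
  have hK := L.contDiff_fracKernel hn hβ ht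
  have hKx : ContDiff ℝ ∞ fun y => fracKernel n β t (x - y) :=
    hK.comp (contDiff_const.sub contDiff_id)
  have m0 := L.memLp_fracKernel hn hβ ht hpq.symm.lt
  have m1 := L.memLp_fderiv_fracKernel hn hβ ht hpq.symm.lt
  refine hf.hasPairing hpq h0 h1 hT hKx
    ⟨hKx.continuous.aestronglyMeasurable, ?_⟩
    ⟨(hKx.continuous_fderiv (by simp)).aestronglyMeasurable, ?_⟩
  · rw [eLpNorm_comp_sub_left m0.1]
    exact m0.2
  · refine lt_of_eq_of_lt ?_ m1.2
    rw [← eLpNorm_comp_sub_left m1.1 x]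
    exact eLpNorm_congr_norm_ae (Eventually.of_forall fun y => norm_fderiv_comp_sub hK x y)

/-- The convolution of a block with a piece of the heat kernel. -/
def blockHeat (L : LittlewoodPaley n) (γ : ℝ) (f : S0Dual n) (t : ℝ) (j i : ℤ) (x : Rn n) : ℂ :=
  ∫ y, L.block j f y * L.heatPiece γ t i (x - y)

/-- `Ψ̂ᵢ` and `Ψ̂ⱼ` have no common frequency at which both are nonzero. -/
theorem blockHeat_eq_zero (γ : ℝ) (f : S0Dual n) (t : ℝ) {j i : ℤ} (h : 2 ≤ |i - j|) (x : Rn n) :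
    L.blockHeat γ f t j i x = 0 := by
  have h1 : L.blockHeat γ f t j i x = f (L.toS0 j (reflect (L.heatPiece γ t i) x)) := by
    rw [L.apply_toS0]
    rfl
  have h2 : L.toS0 j (reflect (L.heatPiece γ t i) x) = 0 := by
    refine Subtype.ext (schwartz_ext_fourier fun ξ => ?_)
    rw [coe_toS0, fourier_corr, fourier_reflect, fourier_heatPiece]
    have h3 : 𝓕 (L.Psi j) (-ξ) * 𝓕 (L.Psi i) (-ξ) = 0 := by
      have key : ∀ {a b : ℤ}, a + 2 ≤ b → 𝓕 (L.Psi a) (-ξ) * 𝓕 (L.Psi b) (-ξ) = 0 := by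
        intro a b hab
        rcases le_total ‖-ξ‖ (2 ^ (b - 1)) with h | h
        · rw [L.fourier_Psi_eq_zero (Or.inl h), mul_zero]
        · rw [L.fourier_Psi_eq_zero (j := a) (Or.inr (le_trans
            (zpow_le_zpow_right₀ one_le_two (by omega)) h)), zero_mul]
      rcases le_abs'.1 h with h | h
      · rw [mul_comm]; exact key (by omega)
      · exact key (by omega)
    rw [show ∀ a b c d : ℂ, a * (b * (c * d)) = b * c * (a * d) from fun a b c d => by ring, h3,
      mul_zero]
    simp
  rw [h1, h2, map_zero]

theorem BlockBound.norm_blockHeat_le (hpq : p.HolderConjugate q) (hf : L.BlockBound σ p M f)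
    (γ t : ℝ) (j i : ℤ) (x : Rn n) : ‖L.blockHeat γ f t j i x‖ ≤
      (eLpNorm (L.block j f) (ENNReal.ofReal p) volume).toReal *
        (eLpNorm (L.heatPiece γ t i) (ENNReal.ofReal q) volume).toReal ∧
      ∫ y, ‖L.block j f y * L.heatPiece γ t i (x - y)‖ ≤
      (eLpNorm (L.block j f) (ENNReal.ofReal p) volume).toReal *
        (eLpNorm (L.heatPiece γ t i) (ENNReal.ofReal q) volume).toReal := by
  have h := integral_norm_mul_le hpq (hf.memLp j)
    ((reflect (L.heatPiece γ t i) x).memLp (ENNReal.ofReal q) volume)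
  have h4 : eLpNorm (reflect (L.heatPiece γ t i) x) (ENNReal.ofReal q) volume
      = eLpNorm (L.heatPiece γ t i) (ENNReal.ofReal q) volume :=
    eLpNorm_comp_sub_left (L.heatPiece γ t i).continuous.aestronglyMeasurable x
  rw [h4] at h
  exact ⟨(norm_integral_le_integral_norm _).trans h, h⟩

/-- Hölder makes the expansion of the kernel into pieces absolutely summable under the integral;
almost orthogonality leaves the pieces `j - 1`, `j`, `j + 1`. -/
theorem BlockBound.integral_block_mul_fracKernel (hn : 1 ≤ n) (hβ : 0 < β) (ht : 0 < t)
    (hpq : p.HolderConjugate q) (hf : L.BlockBound σ p M f) (j : ℤ) (x : Rn n) :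
    ∫ y, L.block j f y * fracKernel n β t (x - y)
      = ∑ d ∈ Finset.Icc (-1 : ℤ) 1, L.blockHeat (2 * β) f t j (j + d) x := by
  have hs : Summable fun i => (eLpNorm (L.block j f) (ENNReal.ofReal p) volume).toReal *
      (eLpNorm (L.heatPiece (2 * β) t i) (ENNReal.ofReal q) volume).toReal :=
    (L.summable_eLpNorm_heatPiece hn hβ ht hpq.symm.lt).mul_left _
  have h1 := hasSum_integral_of_summable_integral_norm
    (F := fun (i : ℤ) y => L.block j f y * L.heatPiece (2 * β) t i (x - y)) (μ := volume)
    (fun i => integrable_mul_of_memLp hpq (hf.memLp j)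
      ((reflect (L.heatPiece (2 * β) t i) x).memLp (ENNReal.ofReal q) volume))
    (Summable.of_nonneg_of_le (fun i => by positivity)
      (fun i => (hf.norm_blockHeat_le hpq (2 * β) t j i x).2) hs)
  have e : ∀ y, ∑' i, L.block j f y * L.heatPiece (2 * β) t i (x - y)
      = L.block j f y * fracKernel n β t (x - y) := fun y =>
    ((L.hasSum_heatPiece hn hβ ht (x - y)).mul_left _).tsum_eq
  simp only [e] at h1
  rw [← h1.tsum_eq, ← (Equiv.addLeft j).tsum_eq]
  refine tsum_eq_sum fun d hd => ?_
  refine blockHeat_eq_zero (2 * β) f t ?_ x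
  rw [Finset.mem_Icc, not_and_or] at hd
  simp only [Equiv.coe_addLeft, add_sub_cancel_left]
  rw [le_abs']
  omega

theorem stronglyMeasurable_blockHeat (L : LittlewoodPaley n) (γ : ℝ) (f : S0Dual n) (t : ℝ)
    (j i : ℤ) : StronglyMeasurable (L.blockHeat γ f t j i) := by
  refine StronglyMeasurable.integral_prod_right (Continuous.stronglyMeasurable ?_)
  have h1 := L.continuous_block f j
  have h2 := (L.heatPiece γ t i).continuous
  exact (h1.comp continuous_snd).mul (h2.comp (continuous_fst.sub continuous_snd))

/-- A crude sup bound by Hölder suffices: pointwise convergence is needed only for measurability and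
for the countable triangle inequality `eLpNorm_tsum_le`. -/
theorem BlockBound.hasSum_heatExt (hn : 1 ≤ n) (hβ : 0 < β) (ht : 0 < t)
    (hpq : p.HolderConjugate q) (h0 : 0 < σ) (hf : L.BlockBound σ p M f) (x : Rn n) :
    HasSum (fun j => ∑ d ∈ Finset.Icc (-1 : ℤ) 1, L.blockHeat (2 * β) f t j (j + d) x)
      (L.heatExt β f t x) := by
  have hM := hf.nonneg
  have hn' : (0 : ℝ) < n := by exact_mod_cast hn
  have hq' : 0 < 1 - 1 / q := by
    rw [sub_pos, div_lt_one hpq.symm.pos]; exact hpq.symm.lt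
  obtain ⟨m, hm⟩ := exists_dyadic_exponent (by positivity : 0 < 2 * β) (n * (1 - 1 / q) + σ)
  obtain ⟨C, hC0, hC⟩ := L.exists_eLpNorm_heatPiece_le hpq.symm.lt.le (2 * β) m
  have hs : ∀ d : ℤ, Summable fun j => L.blockHeat (2 * β) f t j (j + d) x := by
    intro d
    have h2 : Summable fun j : ℤ => (M * C * (2 : ℝ) ^ (-(d : ℝ) * σ)) *
        dyadicTerm (n * (1 - 1 / q) + σ) (2 * β) t m (j + d) :=
      (((Equiv.addRight d).summable_iff (f := dyadicTerm (n * (1 - 1 / q) + σ) (2 * β) t m)).2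
        (summable_dyadicTerm (by positivity) hm ht)).mul_left _
    refine Summable.of_norm_bounded h2 fun j => ?_
    refine (hf.norm_blockHeat_le hpq (2 * β) t j (j + d) x).1.trans ?_
    have h3 := ENNReal.toReal_le_of_le_ofReal
      (mul_nonneg hC0 (dyadicTerm_nonneg ht.le (j + d))) (hC t ht.le (j + d))
    refine (mul_le_mul (hf.le j) h3 ENNReal.toReal_nonneg (by positivity)).trans_eq ?_
    have e : (2 : ℝ) ^ (-(d : ℝ) * σ) * (2 : ℝ) ^ (((j + d : ℤ) : ℝ) * (n * (1 - 1 / q) + σ))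
        = (2 : ℝ) ^ ((j : ℝ) * σ) * (2 : ℝ) ^ (((j + d : ℤ) : ℝ) * (n * (1 - 1 / q))) := by
      rw [← Real.rpow_add two_pos, ← Real.rpow_add two_pos]
      congr 1
      push_cast
      ring
    simp only [dyadicTerm]
    linear_combination (-(M * C / (1 + t * (2 : ℝ) ^ (2 * β * ((j + d : ℤ) : ℝ))) ^ m)) * e
  have hs2 : Summable fun j => ∑ d ∈ Finset.Icc (-1 : ℤ) 1, L.blockHeat (2 * β) f t j (j + d) x :=
    summable_sum fun d _ => hs d
  have e : L.heatExt β f t x = ∑' j, ∑ d ∈ Finset.Icc (-1 : ℤ) 1,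
      L.blockHeat (2 * β) f t j (j + d) x :=
    tsum_congr fun j => hf.integral_block_mul_fracKernel hn hβ ht hpq j x
  rw [e]
  exact hs2.hasSum

theorem BlockBound.stronglyMeasurable_heatExt (hn : 1 ≤ n) (hβ : 0 < β) (ht : 0 < t)
    (hpq : p.HolderConjugate q) (h0 : 0 < σ) (hf : L.BlockBound σ p M f) :
    StronglyMeasurable (L.heatExt β f t) := by
  refine stronglyMeasurable_of_tendsto (atTop : Filter (Finset ℤ))
    (f := fun s x => ∑ j ∈ s, ∑ d ∈ Finset.Icc (-1 : ℤ) 1, L.blockHeat (2 * β) f t j (j + d) x)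
    (fun s => ?_) (tendsto_pi_nhds.2 fun x => hf.hasSum_heatExt hn hβ ht hpq h0 x)
  exact Finset.stronglyMeasurable_fun_sum _ fun j _ =>
    Finset.stronglyMeasurable_fun_sum _ fun d _ => L.stronglyMeasurable_blockHeat _ _ _ _ _

/-- By Young, the pair `(j, j + d)` contributes at most a constant times `M 2^(jσ) / (1 + t
2^(2β(j+d)))`. As `0 < σ < 2β`, the sum over `j` scales like `t^(-σ/(2β))`. -/
theorem exists_eLpNorm_heatExt_le (L : LittlewoodPaley n) (hn : 1 ≤ n) (hβ : 0 < β)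
    (hpq : p.HolderConjugate q) (h0 : 0 < σ) (hσ : σ < 2 * β) : ∃ C : ℝ, 0 ≤ C ∧
      ∀ (f : S0Dual n) (M : ℝ), L.BlockBound σ p M f → ∀ t : ℝ, 0 < t →
        eLpNorm (L.heatExt β f t) (ENNReal.ofReal p) volume
          ≤ ENNReal.ofReal (C * M * t ^ (-(σ / (2 * β)))) := by
  obtain ⟨C, hC0, hC⟩ := L.exists_eLpNorm_heatPiece_le le_rfl (2 * β) 1
  set S := (2 : ℝ) ^ σ * ∑' j, dyadicTerm σ (2 * β) 1 1 j with hS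
  have hS0 : 0 ≤ S := mul_nonneg (by positivity) (tsum_nonneg (dyadicTerm_nonneg zero_le_one))
  -- Rewriting `2^(jσ)` in terms of the index `j + d` costs the factor `2^(-dσ)`; `E` collects
  -- these.
  set E := ∑ d ∈ Finset.Icc (-1 : ℤ) 1, (2 : ℝ) ^ (-(d : ℝ) * σ) with hE
  have hE0 : 0 ≤ E := Finset.sum_nonneg fun d _ => by positivity
  refine ⟨C * E * S, by positivity, fun f M hf t ht => ?_⟩
  have hM := hf.nonneg
  have hp1 : 1 ≤ ENNReal.ofReal p := by simpa using ENNReal.ofReal_le_ofReal hpq.lt.le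
  have hbd : ∀ j d : ℤ, eLpNorm (L.blockHeat (2 * β) f t j (j + d)) (ENNReal.ofReal p) volume
      ≤ ENNReal.ofReal ((C * M * (2 : ℝ) ^ (-(d : ℝ) * σ)) * dyadicTerm σ (2 * β) t 1 (j + d)) := by
    intro j d
    refine (eLpNorm_conv_le hpq.lt (hf.memLp j).1
      (L.heatPiece (2 * β) t (j + d)).continuous.aestronglyMeasurable).trans ?_
    have h1 := hC t ht.le (j + d)
    rw [ENNReal.ofReal_one, div_one, sub_self, mul_zero] at h1
    have h2 := (ENNReal.le_ofReal_iff_toReal_le (hf.memLp j).2.ne (by positivity)).2 (hf.le j)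
    refine (mul_le_mul' h1 h2).trans_eq ?_
    rw [← ENNReal.ofReal_mul (mul_nonneg hC0 (dyadicTerm_nonneg ht.le _))]
    congr 1
    have e : (2 : ℝ) ^ (-(d : ℝ) * σ) * (2 : ℝ) ^ (((j + d : ℤ) : ℝ) * σ)
        = (2 : ℝ) ^ ((j : ℝ) * σ) := by
      rw [← Real.rpow_add two_pos]
      congr 1
      push_cast
      ring
    simp only [dyadicTerm, mul_zero, Real.rpow_zero]
    rw [← e]
    ring
  have hsum : ∀ d : ℤ, ∑' j : ℤ, ENNReal.ofReal
      ((C * M * (2 : ℝ) ^ (-(d : ℝ) * σ)) * dyadicTerm σ (2 * β) t 1 (j + d))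
      ≤ ENNReal.ofReal ((C * M * (2 : ℝ) ^ (-(d : ℝ) * σ)) * (S * t ^ (-(σ / (2 * β))))) := by
    intro d
    have hs : Summable (dyadicTerm σ (2 * β) t 1) := summable_dyadicTerm h0 (by simpa using hσ) ht
    have hs2 : Summable fun j : ℤ => dyadicTerm σ (2 * β) t 1 (j + d) :=
      ((Equiv.addRight d).summable_iff (f := dyadicTerm σ (2 * β) t 1)).2 hs
    have e2 : ∑' j : ℤ, dyadicTerm σ (2 * β) t 1 (j + d) = ∑' j, dyadicTerm σ (2 * β) t 1 j :=
      (Equiv.addRight d).tsum_eq (dyadicTerm σ (2 * β) t 1)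
    rw [← ENNReal.ofReal_tsum_of_nonneg
      (fun j => mul_nonneg (by positivity) (dyadicTerm_nonneg ht.le _)) (hs2.mul_left _),
      tsum_mul_left, e2]
    refine ENNReal.ofReal_le_ofReal (mul_le_mul_of_nonneg_left ?_ (by positivity))
    exact tsum_dyadicTerm_le h0 hσ ht
  calc eLpNorm (L.heatExt β f t) (ENNReal.ofReal p) volume
      ≤ ∑' j, eLpNorm (fun x => ∑ d ∈ Finset.Icc (-1 : ℤ) 1,
          L.blockHeat (2 * β) f t j (j + d) x) (ENNReal.ofReal p) volume :=
        eLpNorm_tsum_le hp1 (fun j => (Finset.stronglyMeasurable_fun_sum _ fun d _ =>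
          L.stronglyMeasurable_blockHeat _ _ _ _ _).aestronglyMeasurable)
          (hf.hasSum_heatExt hn hβ ht hpq h0)
    _ ≤ ∑' j : ℤ, ∑ d ∈ Finset.Icc (-1 : ℤ) 1, ENNReal.ofReal
          ((C * M * (2 : ℝ) ^ (-(d : ℝ) * σ)) * dyadicTerm σ (2 * β) t 1 (j + d)) := by
        refine ENNReal.tsum_le_tsum fun j => ?_
        have e : (fun x => ∑ d ∈ Finset.Icc (-1 : ℤ) 1, L.blockHeat (2 * β) f t j (j + d) x)
          = ∑ d ∈ Finset.Icc (-1 : ℤ) 1, L.blockHeat (2 * β) f t j (j + d) := by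
            ext x; simp
        rw [e]
        refine (eLpNorm_sum_le (fun d _ =>
          (L.stronglyMeasurable_blockHeat _ _ _ _ _).aestronglyMeasurable) hp1).trans ?_
        exact Finset.sum_le_sum fun d _ => hbd j d
    _ = ∑ d ∈ Finset.Icc (-1 : ℤ) 1, ∑' j : ℤ, ENNReal.ofReal
          ((C * M * (2 : ℝ) ^ (-(d : ℝ) * σ)) * dyadicTerm σ (2 * β) t 1 (j + d)) :=
        Summable.tsum_finsetSum fun d _ => ENNReal.summable
    _ ≤ ∑ d ∈ Finset.Icc (-1 : ℤ) 1,
          ENNReal.ofReal ((C * M * (2 : ℝ) ^ (-(d : ℝ) * σ)) * (S * t ^ (-(σ / (2 * β))))) :=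
        Finset.sum_le_sum fun d _ => hsum d
    _ = ENNReal.ofReal (C * E * S * M * t ^ (-(σ / (2 * β)))) := by
        rw [← ENNReal.ofReal_sum_of_nonneg fun d _ => by positivity]
        congr 1
        rw [← Finset.sum_mul, ← Finset.mul_sum]
        ring

end LittlewoodPaley

end QBesov

namespace QBesov

/-! ### The Carleson norm -/

variable {n : ℕ}

theorem lintegral_Ioo_rpow {e R : ℝ} (he : -1 < e) (hR : 0 < R) :
    ∫⁻ t in Ioo 0 R, ENNReal.ofReal (t ^ e) = ENNReal.ofReal (R ^ (e + 1) / (e + 1)) := by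
  have hi : IntegrableOn (fun t : ℝ => t ^ e) (Ioo 0 R) :=
    (intervalIntegral.integrableOn_Ioo_rpow_iff hR).2 he
  rw [← ofReal_integral_eq_lintegral_ofReal hi
    ((ae_restrict_iff' measurableSet_Ioo).2 (Eventually.of_forall fun t ht =>
      Real.rpow_nonneg ht.1.le e)),
    ← integral_Ioc_eq_integral_Ioo, ← intervalIntegral.integral_of_le hR.le,
    integral_rpow (Or.inl he), Real.zero_rpow (by linarith), sub_zero]

theorem lintegral_ball_sq_le (hn : 1 ≤ n) {p : ℝ} (hp : 2 < p) {u : Rn n → ℂ}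
    (hu : AEStronglyMeasurable u volume) {A : ℝ} (hA : 0 ≤ A)
    (h : eLpNorm u (ENNReal.ofReal p) volume ≤ ENNReal.ofReal A) (x : Rn n) {r : ℝ} (hr : 0 < r) :
    ∫⁻ y in Metric.ball x r, ‖u y‖ₑ ^ 2 ≤ ENNReal.ofReal (A ^ 2 *
      (r ^ n * (volume (Metric.ball (0 : Rn n) 1)).toReal) ^ (1 - 2 / p)) := by
  have : Nonempty (Fin n) := ⟨⟨0, hn⟩⟩
  have hp0 : 0 < p := by linarith
  set v := (volume (Metric.ball (0 : Rn n) 1)).toReal with hv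
  have hv0 : 0 ≤ v := ENNReal.toReal_nonneg
  have hvol : volume (Metric.ball x r) = ENNReal.ofReal (r ^ n * v) := by
    rw [Measure.addHaar_ball volume x hr.le, finrank_euclideanSpace_fin,
      ENNReal.ofReal_mul (by positivity), ENNReal.ofReal_toReal measure_ball_lt_top.ne]
  have h2p : (2 : ℝ≥0∞) ≤ ENNReal.ofReal p := by
    simpa using ENNReal.ofReal_le_ofReal hp.le
  have hexp : 0 ≤ 1 / 2 - 1 / p := sub_nonneg.2 (one_div_le_one_div_of_le two_pos hp.le)
  have h1 := eLpNorm_le_eLpNorm_mul_rpow_measure_univ h2p (hu.restrict (s := Metric.ball x r))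
  rw [Measure.restrict_apply_univ, hvol, ENNReal.toReal_ofReal hp0.le, ENNReal.toReal_ofNat,
    ENNReal.ofReal_rpow_of_nonneg (by positivity) hexp] at h1
  have h2 := h1.trans (mul_le_mul_left ((eLpNorm_mono_measure u Measure.restrict_le_self).trans h) _)
  rw [← ENNReal.ofReal_mul hA] at h2
  have h3 : ∫⁻ y in Metric.ball x r, ‖u y‖ₑ ^ 2
      = eLpNorm u 2 (volume.restrict (Metric.ball x r)) ^ 2 := by
    have := eLpNorm_nnreal_pow_eq_lintegral (μ := volume.restrict (Metric.ball x r)) (f := u)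
      (p := 2) two_ne_zero
    simpa using this.symm
  rw [h3]
  refine (pow_le_pow_left' h2 2).trans_eq ?_
  rw [← ENNReal.ofReal_pow (by positivity), mul_pow]
  congr 2
  rw [← Real.rpow_natCast, ← Real.rpow_mul (by positivity)]
  congr 1
  push_cast
  ring

/-- Hölder on the ball gives the factor `r^(n(1-2/p))`, and the remaining time integrand is `t^e`
with `e = -(σ+α)/β`. It is integrable at `0` because `α + σ < β`. -/
theorem exists_carlesonNorm_le (hn : 1 ≤ n) {α β σ p : ℝ} (hβ : 0 < β) (hp : 2 < p)
    (hσ : σ = 2 * β - 1 - n / p) (hα : α + σ < β) : ∃ C : ℝ≥0,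
      ∀ (u : ℝ → Rn n → ℂ) (B : ℝ), 0 ≤ B →
        (∀ t, 0 < t → AEStronglyMeasurable (u t) volume) →
        (∀ t, 0 < t → eLpNorm (u t) (ENNReal.ofReal p) volume
          ≤ ENNReal.ofReal (B * t ^ (-(σ / (2 * β))))) →
        carlesonNorm α β u ≤ C * ENNReal.ofReal B := by
  set v := (volume (Metric.ball (0 : Rn n) 1)).toReal with hv
  have hv0 : 0 ≤ v := ENNReal.toReal_nonneg
  set e := -(σ + α) / β with he
  have he1 : 0 < e + 1 := by
    rw [he, div_add_one hβ.ne']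
    exact div_pos (by linarith) hβ
  set K := v ^ (1 - 2 / p) / (e + 1) with hK
  have hK0 : 0 ≤ K := by positivity
  have hp0 : 0 < p := by linarith
  refine ⟨(K ^ (1 / 2 : ℝ)).toNNReal, fun u B hB hu hle => ?_⟩
  refine iSup_le fun x => iSup_le fun r => iSup_le fun hr => ?_
  set D := B ^ 2 * (r ^ n * v) ^ (1 - 2 / p) with hD
  have hD0 : 0 ≤ D := by positivity
  have hinner : ∀ t ∈ Ioo (0 : ℝ) (r ^ (2 * β)), ∫⁻ y in Metric.ball x r,
      ‖u t y‖ₑ ^ 2 * ENNReal.ofReal (t ^ (-α / β)) ≤ ENNReal.ofReal D * ENNReal.ofReal (t ^ e) := by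
    intro t ht
    have ht0 := ht.1
    rw [lintegral_mul_const' _ _ ENNReal.ofReal_ne_top]
    refine (mul_le_mul_left (lintegral_ball_sq_le hn hp (hu t ht0) (by positivity) (hle t ht0) x hr)
      _).trans_eq ?_
    rw [← ENNReal.ofReal_mul (by positivity), ← ENNReal.ofReal_mul hD0]
    congr 1
    have e1 : t ^ e = (t ^ (-(σ / (2 * β)))) ^ 2 * t ^ (-α / β) := by
      rw [← Real.rpow_natCast, ← Real.rpow_mul ht0.le, ← Real.rpow_add ht0, he]
      congr 1
      push_cast
      field_simp
      ring
    rw [e1, hD]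
    ring
  have hR : 0 < r ^ (2 * β) := by positivity
  have hint : ∫⁻ t in Ioo (0 : ℝ) (r ^ (2 * β)), ∫⁻ y in Metric.ball x r,
      ‖u t y‖ₑ ^ 2 * ENNReal.ofReal (t ^ (-α / β))
      ≤ ENNReal.ofReal (D * ((r ^ (2 * β)) ^ (e + 1) / (e + 1))) := by
    refine (setLIntegral_mono' measurableSet_Ioo hinner).trans_eq ?_
    rw [lintegral_const_mul' _ _ ENNReal.ofReal_ne_top, lintegral_Ioo_rpow (by linarith) hR,
      ← ENNReal.ofReal_mul hD0]
  -- The total exponent of `r` is `4β - 2 - 2n/p - 2σ`, which is zero by the choice of `σ`: the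
  -- estimate is scale invariant.
  have hpow : r ^ (2 * α - n + 2 * β - 2) * (D * ((r ^ (2 * β)) ^ (e + 1) / (e + 1)))
      = B ^ 2 * K := by
    have e2 : r ^ (2 * α - n + 2 * β - 2) * ((r ^ n) ^ (1 - 2 / p) * (r ^ (2 * β)) ^ (e + 1))
        = 1 := by
      rw [← Real.rpow_natCast, ← Real.rpow_mul hr.le, ← Real.rpow_mul hr.le, ← Real.rpow_add hr,
        ← Real.rpow_add hr]
      convert Real.rpow_zero r using 2
      rw [he, hσ]
      field_simp
      ring
    rw [hD, hK, Real.mul_rpow (by positivity) hv0]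
    linear_combination (B ^ 2 * (v ^ (1 - 2 / p) / (e + 1))) * e2
  calc _ ≤ (ENNReal.ofReal (r ^ (2 * α - n + 2 * β - 2)) *
        ENNReal.ofReal (D * ((r ^ (2 * β)) ^ (e + 1) / (e + 1)))) ^ (1 / 2 : ℝ) := by gcongr
    _ = ENNReal.ofReal (B ^ 2 * K) ^ (1 / 2 : ℝ) := by
        rw [← ENNReal.ofReal_mul (by positivity), hpow]
    _ = ENNReal.ofReal (K ^ (1 / 2 : ℝ) * B) := by
        rw [ENNReal.ofReal_rpow_of_nonneg (by positivity) (by norm_num),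
          Real.mul_rpow (by positivity) hK0, ← Real.sqrt_eq_rpow, Real.sqrt_sq hB, mul_comm]
    _ = _ := by
        rw [ENNReal.ofReal_mul (by positivity)]
        rfl

/-! ### The embeddings -/

/-- With `σ = -s`, the upper condition says `σ > 0`, `β < 1` gives `σ < 1`, and the lower condition
says `α + σ < β`. -/
theorem besovEmbedsInQ_top (hn : 1 ≤ n) (L : LittlewoodPaley n) {α β p : ℝ} (hβ0 : 1 / 2 < β)
    (hβ : β < 1) (hp : 2 < p) (hlow : α + β < 1 + n / p) (hupp : 1 + n / p < 2 * β) :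
    BesovEmbedsInQ L (1 + n / p - 2 * β) (ENNReal.ofReal p) ⊤ α β := by
  have hp0 : 0 < p := by linarith
  have hnp : 0 ≤ n / p := by positivity
  have hpq : p.HolderConjugate p.conjExponent := Real.HolderConjugate.conjExponent (by linarith)
  set s := 1 + n / p - 2 * β with hs
  have hs0 : 0 < -s := by linarith
  have hs1 : -s < 1 := by linarith
  have hβ' : 0 < β := by linarith
  obtain ⟨J, hJ⟩ := exists_realization L (s := s) hpq (by linarith) (by linarith)
  obtain ⟨C1, hC1, h1⟩ := L.exists_eLpNorm_heatExt_le hn hβ' hpq hs0 (by linarith)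
  obtain ⟨C2, h2⟩ := exists_carlesonNorm_le hn (α := α) (σ := -s) hβ' hp
    (by rw [hs]; ring) (by linarith)
  have key : ∀ f : Besov L s (ENNReal.ofReal p) ⊤, qNorm α β (J f)
      ≤ (C2 * C1.toNNReal : ℝ≥0) * besovNorm L s (ENNReal.ofReal p) ⊤ (f : S0Dual n) := by
    intro f
    have hf := Besov.blockBound f.2
    refine (iInf₂_le (L.heatExt β f) (hf.isSemigroupOf hn hβ' hpq hs0 hs1 (hJ f))).trans ?_
    refine (h2 _ (C1 * (besovNorm L s (ENNReal.ofReal p) ⊤ (f : S0Dual n)).toReal) (by positivity)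
      (fun t ht => (hf.stronglyMeasurable_heatExt hn hβ' ht hpq hs0).aestronglyMeasurable)
      (h1 f _ hf)).trans_eq ?_
    rw [ENNReal.ofReal_mul hC1, ENNReal.ofReal_toReal f.2.2.ne, ENNReal.coe_mul, mul_assoc]
    rfl
  refine ⟨J, fun f φ => ?_, fun f => (key f).trans_lt ?_, _, key⟩
  · rw [hJ]
    exact (L.hasSum_apply_corr_Psi f φ).tsum_eq
  · exact ENNReal.mul_lt_top ENNReal.coe_lt_top f.2.2

/-! ### Reduction of the other Besov spaces to third index `∞` and exponent `p`. -/

theorem BesovEmbedsInQ.of_le {L : LittlewoodPaley n} {s s' α β : ℝ} {p p' q q' : ℝ≥0∞}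
    (h : BesovEmbedsInQ L s' p' q' α β) (hle : Besov L s p q ≤ Besov L s' p' q') {C : ℝ≥0}
    (hC : ∀ f ∈ Besov L s p q, besovNorm L s' p' q' f ≤ C * besovNorm L s p q f) :
    BesovEmbedsInQ L s p q α β := by
  obtain ⟨J, hJ, hQ, D, hD⟩ := h
  refine ⟨J ∘ₗ Submodule.inclusion hle, fun f φ => hJ _ φ, fun f => hQ _, D * C, fun f => ?_⟩
  refine (hD (Submodule.inclusion hle f)).trans ?_
  rw [ENNReal.coe_mul, mul_assoc]
  gcongr
  exact hC f f.2

theorem besovNorm_top_le (L : LittlewoodPaley n) (s : ℝ) (p : ℝ≥0∞) {q : ℝ≥0∞} (hq : 1 ≤ q)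
    (f : S0Dual n) : besovNorm L s p ⊤ f ≤ besovNorm L s p q f := by
  by_cases h : q = ⊤
  · rw [h]
  have hq0 : 0 < q.toReal := ENNReal.toReal_pos (zero_lt_one.trans_le hq).ne' h
  rw [besovNorm, if_pos rfl, besovNorm, if_neg h]
  refine iSup_le fun j => ?_
  calc besovTerm L s p f j = (besovTerm L s p f j ^ q.toReal) ^ (1 / q.toReal) := by
        rw [← ENNReal.rpow_mul, mul_one_div_cancel hq0.ne', ENNReal.rpow_one]
    _ ≤ _ := by
        gcongr
        exact ENNReal.le_tsum (f := fun j => besovTerm L s p f j ^ q.toReal) j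

theorem BesovEmbedsInQ.of_top {L : LittlewoodPaley n} {s α β : ℝ} {p q : ℝ≥0∞} (hq : 1 ≤ q)
    (h : BesovEmbedsInQ L s p ⊤ α β) : BesovEmbedsInQ L s p q α β :=
  h.of_le (C := 1) (fun f hf => ⟨hf.1, (besovNorm_top_le L s p hq f).trans_lt hf.2⟩)
    fun f _ => by simpa using besovNorm_top_le L s p hq f

/-- The sup bound of `exists_norm_block_le`, interpolated with `L²`, costs `(2^(jn/2))^(1-2/p) =
2^(jn(1/2-1/p))`, precisely the difference of the two smoothness weights. -/
theorem exists_besovTerm_le (L : LittlewoodPaley n) {p : ℝ} (hp : 2 < p) (s : ℝ) : ∃ C : ℝ≥0,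
    ∀ (f : S0Dual n) (j : ℤ), MemLp (L.block j f) 2 volume →
      MemLp (L.block j f) (ENNReal.ofReal p) volume ∧
      besovTerm L (s + n / p) (ENNReal.ofReal p) f j ≤ C * besovTerm L (s + n / 2) 2 f j := by
  obtain ⟨C, hC0, hC⟩ := L.exists_norm_block_le
  have hp0 : 0 < p := by linarith
  refine ⟨(C ^ (1 - 2 / p)).toNNReal, fun f j hf => ?_⟩
  set A := (eLpNorm (L.block j f) 2 volume).toReal with hA
  have hA0 : 0 ≤ A := ENNReal.toReal_nonneg
  have hB : 0 ≤ C * (2 : ℝ) ^ ((j : ℝ) * n / 2) * A := by positivity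
  have hAe : eLpNorm (L.block j f) 2 volume = ENNReal.ofReal A := (ENNReal.ofReal_toReal hf.2.ne).symm
  have h1 := eLpNorm_le_of_bound_of_two hp hB (hC f j hf)
  have h12 : 0 ≤ 1 - 2 / p := by
    rw [sub_nonneg, div_le_one hp0]; exact hp.le
  have hA1 : A ^ (1 - 2 / p) * A ^ (2 / p) = A := by
    rcases hA0.eq_or_lt with h | h
    · rw [← h, Real.zero_rpow (by positivity : 2 / p ≠ 0), mul_zero]
    · rw [← Real.rpow_add h, sub_add_cancel, Real.rpow_one]
  rw [hAe, ENNReal.ofReal_rpow_of_nonneg hA0 (by positivity),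
    ← ENNReal.ofReal_mul (by positivity)] at h1
  refine ⟨⟨hf.1, h1.trans_lt ENNReal.ofReal_lt_top⟩, ?_⟩
  unfold besovTerm
  refine (mul_le_mul_right h1 _).trans_eq ?_
  rw [hAe, ← ENNReal.ofReal_mul (by positivity), ← ENNReal.ofReal_mul (by positivity),
    ← ENNReal.ofReal_coe_nnreal, ← ENNReal.ofReal_mul (by positivity),
    Real.coe_toNNReal _ (by positivity)]
  congr 1
  rw [Real.mul_rpow (by positivity) hA0, Real.mul_rpow hC0 (by positivity),
    ← Real.rpow_mul two_pos.le]
  have e : (2 : ℝ) ^ ((j : ℝ) * (s + n / p)) * (2 : ℝ) ^ ((j : ℝ) * n / 2 * (1 - 2 / p))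
      = (2 : ℝ) ^ ((j : ℝ) * (s + n / 2)) := by
    rw [← Real.rpow_add two_pos]
    congr 1
    field_simp
    ring
  calc _ = C ^ (1 - 2 / p) * ((2 : ℝ) ^ ((j : ℝ) * (s + n / p)) *
        (2 : ℝ) ^ ((j : ℝ) * n / 2 * (1 - 2 / p))) * (A ^ (1 - 2 / p) * A ^ (2 / p)) := by ring
    _ = _ := by rw [e, hA1]; ring

/-- The Sobolev embedding between Besov spaces of exponents `2` and `p > 2`. -/
theorem BesovEmbedsInQ.of_exponent {L : LittlewoodPaley n} {p s α β : ℝ} (hp : 2 < p)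
    (h : BesovEmbedsInQ L (s + n / p) (ENNReal.ofReal p) ⊤ α β) :
    BesovEmbedsInQ L (s + n / 2) 2 ⊤ α β := by
  obtain ⟨C, hC⟩ := exists_besovTerm_le L hp s
  have hle : ∀ f ∈ Besov L (s + n / 2) 2 ⊤, besovNorm L (s + n / p) (ENNReal.ofReal p) ⊤ f
      ≤ C * besovNorm L (s + n / 2) 2 ⊤ f := fun f hf => by
    rw [besovNorm, if_pos rfl, besovNorm, if_pos rfl]
    refine iSup_le fun j => (hC f j (hf.1 j)).2.trans ?_
    gcongr
    exact le_iSup (besovTerm L (s + n / 2) 2 f) j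
  exact h.of_le (fun f hf => ⟨fun j => (hC f j (hf.1 j)).1,
    (hle f hf).trans_lt (ENNReal.mul_lt_top ENNReal.coe_lt_top hf.2)⟩) hle

end QBesov

end

theorem theorem4p6 (n : ℕ) (hn : 1 ≤ n) (L : QBesov.LittlewoodPaley n)
    (α β : ℝ) (hα : 0 < α) (hαβ : max α (1 / 2) < β) (hβ : β < 1) (hsum : 0 ≤ α + β - 1)
    (q : ℝ≥0∞) (hq : 1 ≤ q) (p : ℝ) (hp : 2 < p)
    (hlow : α + β < 1 + n / p) (hupp : 1 + n / p < 2 * β) :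
    QBesov.BesovEmbedsInQ L (1 + n / p - 2 * β) (ENNReal.ofReal p) q α β ∧
    QBesov.BesovEmbedsInQ L (1 + n / 2 - 2 * β) 2 q α β := by
  have hβ0 : 1 / 2 < β := (le_max_right _ _).trans_lt hαβ
  have h := QBesov.besovEmbedsInQ_top hn L hβ0 hβ hp hlow hupp
  refine ⟨h.of_top hq, ?_⟩
  -- Both spaces have the same smoothness `1 - 2β` after subtraction of `n` over the integrability
  -- exponent, the invariant of the Sobolev embedding.
  have e : 1 + n / p - 2 * β = (1 - 2 * β) + n / p := by ring
  have e2 : 1 + (n : ℝ) / 2 - 2 * β = (1 - 2 * β) + n / 2 := by ring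
  rw [e] at h
  rw [e2]
  exact (h.of_exponent hp).of_top hq
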